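/- **Theorem (the limit set is a limit of embedded polygons).** Let $\varphi=\frac{\sqrt5-1}{2}$, so that $1-\varphi=\varphi^2$ and $\lfloor 1/\varphi\rfloor=1$. *The map.* Let $F_0\subset\mathbb R^2$ be the closed parallelogram with a vertex at the origin and sides $(2,0)$ and $\varphi(1,\sqrt3)$, and let $F_1,F_2$ be its images under the counterclockwise rotations by $2\pi/3$ and $4\pi/3$ about the origin. Let $L_0,L_1,L_2$ be the lattices generated by $\{(-1,\sqrt3),\varphi(1,\sqrt3)\}$, $\{(1,\sqrt3),\varphi(2,0)\}$ and $\{(2,0),\varphi(-1,\sqrt3)\}$. For $p\in F_i$ let $g(p)=p+V_p$, where $V_p$ is the vector of $L_i$ with $p+V_p\in F_{i+1 \bmod 3}$; $g(p)$ is undefined when $V_p$ is not unique. Let $X$ be the translate of $F_0$ centred at the origin, and let $f'$ be the map $g^3|_{F_0}$ transported to $X$ by this translation. Let $Y\subset X$ be the parallelogram that shares the lower left vertex of $X$ and has sides $\varphi(1,\sqrt3)$ and $(2-2\varphi,0)$, and let $\mathcal{OP}:X\to X$ (cut and paste) translate $Y$ by $(2\varphi,0)$ and $X\setminus Y$ by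 $-(2-2\varphi,0)$. The triple lattice PET is $f=\mathcal{OP}\circ f'\circ\mathcal{OP}^{-1}$, defined at the points near which this is a translation by a constant vector; its pieces are the connected components of its domain. *The limit set.* A point $p$ is periodic if $f^n(p)=p$ for some $n\ge1$. Its periodic tile is the set of points $q$ whose forward orbit is defined and is at each time in the same piece as that of $p$. The periodic pattern $\Delta_\varphi$ is the union of all periodic tiles, and the limit set $\Lambda_\varphi$ is the set of points of $\mathbb R^2$ each of whose neighbourhoods meets infinitely many periodic tiles. *The substitution rule.* Let $M$ be an isosceles trapezoid with base angles $\pi/3$, longer base $l$, legs $\varphi l$ and shorter base $\varphi^2 l$. The rule replaces $M$ by the three trapezoids similar to $M$, with ratios $\varphi,\varphi^2,\varphi$, that lie in $M$ and whose longer bases are, respectively, the first leg, the shorter base and the second leg of $M$. Let $A$ be the trapezoid with vertices $v_0=(-1+\frac{\varphi}{2},\frac{\sqrt3}{2}\varphi)$ (the top left vertex of $X$), $v_1=v_0+\varphi(1,-\sqrt3)$, $v_1-2(1-\varphi)(1,0)$ and $v_0-(1-\varphi)(1,\sqrt3)$. Let $B$ be the image of $A$ under the counterclockwise rotation by $\pi/3$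 about $v_0$, and $C$ its image under the reflection about the line $x=\frac32\varphi-1$. The marked trapezoids of level $0$ are $A,B,C$; those of level $n+1$ are obtained by applying the rule to those of level $n$. Let $\mathcal C_n$ be the union of the (closed) marked trapezoids of level $n$. *Conclusion.* The parameter $\varphi$ is a fixed point of the renormalization map $R$ on $(0,1)$ given by $R=R_1$ on $(0,\frac12)$, $R=R_2$ on $[\frac12,\frac23)$, $R=R_1\circ R_2$ on $[\frac23,1)$, where $R_1(s)=\frac{s}{1+s-s\lfloor 1/s\rfloor}$ and $R_2(s)=\frac{1-s}{s}$. The periodic pattern $\Delta_\varphi$ is dense in $X$. For every $n$ there are finitely many marked trapezoids of level $n$; each is an isosceles trapezoid with base angles $\pi/3$, longer base $l=2\varphi^{k+1}$ for some $k$ with $n\le k\le 2n$, legs $\varphi l$ and shorter base $\varphi^2l$; and distinct ones have disjoint interiors. Moreover $\mathcal C_{n+1}\subseteq\mathcal C_n$ for all $n$, and $$\Lambda_\varphi=\lim_{n\to\infty}\mathcal C_n ,$$ that is, $\Lambda_\varphi=\bigcap_{n\ge0}\mathcal C_n$, and $\mathcal C_n\to\Lambda_\varphi$ in the Hausdorff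 distance. In this sense $\Lambda_\varphi$ is a limit of embedded polygons in $\mathbb R^2$. -/

import Mathlib

open Set Filter Topology

/-- The Euclidean plane. -/
abbrev Plane := EuclideanSpace ℝ (Fin 2)

namespace TripleLattice

noncomputable section

/-! ### The golden parameter and the renormalization map -/

/-- The parameter `φ = (√5 - 1) / 2`. -/
def phi : ℝ := (√5 - 1) / 2

def renormMap₁ (s : ℝ) : ℝ := s / (1 + s - s * (⌊1 / s⌋ : ℝ))

def renormMap₂ (s : ℝ) : ℝ := (1 - s) / s

/-- The renormalization map `R` on the parameter interval `(0, 1)`. -/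
def renormMap (s : ℝ) : ℝ :=
  if s < 1 / 2 then renormMap₁ s
  else if s < 2 / 3 then renormMap₂ s
  else renormMap₁ (renormMap₂ s)

/-! ### Parallelograms and lattices -/

def vec (x y : ℝ) : Plane := !₂[x, y]

/-- The vectors of length two in the directions `0`, `π / 3` and `2π / 3`. -/
def e₀ : Plane := vec 2 0
def e₁ : Plane := vec 1 (√3)
def e₂ : Plane := vec (-1) (√3)

/-- The closed parallelogram with vertex `o` and sides `u`, `v`. -/
def parallelogram (o u v : Plane) : Set Plane :=
  {p | ∃ a ∈ Icc (0 : ℝ) 1, ∃ b ∈ Icc (0 : ℝ) 1, p = o + a • u + b • v}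

/-- The parallelograms `F₀, F₁, F₂`: the one spanned by `(2, 0)` and `s (1, √3)`, and its images
under the rotations by `2π / 3` and `4π / 3` about the origin. -/
def fund (s : ℝ) : Fin 3 → Set Plane
  | 0 => parallelogram 0 e₀ (s • e₁)
  | 1 => parallelogram 0 e₂ (s • (-e₀))
  | 2 => parallelogram 0 (-e₁) (s • (-e₂))

/-- The lattices `L₀, L₁, L₂`. -/
def lattice (s : ℝ) : Fin 3 → AddSubgroup Plane
  | 0 => AddSubgroup.closure {e₂, s • e₁}
  | 1 => AddSubgroup.closure {e₁, s • e₀}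
  | 2 => AddSubgroup.closure {e₀, s • e₂}

/-- The graph of `g` on `Fᵢ`: the point `p ∈ Fᵢ` goes to the point `q` of `Fᵢ₊₁` with
`q - p ∈ Lᵢ`, provided that there is exactly one such point. -/
def latticeStep (s : ℝ) (i : Fin 3) (p q : Plane) : Prop :=
  p ∈ fund s i ∧ q ∈ fund s (i + 1) ∧ q - p ∈ lattice s i ∧
    ∀ q' ∈ fund s (i + 1), q' - p ∈ lattice s i → q' = q

/-- The centre of `F₀`. -/
def center (s : ℝ) : Plane := (1 / 2 : ℝ) • (e₀ + s • e₁)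

/-- The parallelogram `X`: the translate of `F₀` centred at the origin. -/
def domainX (s : ℝ) : Set Plane := parallelogram (-center s) e₀ (s • e₁)

/-- The graph of `g ∘ g ∘ g : F₀ → F₀`, transported to `X` by the translation `F₀ → X`. -/
def tripleStep (s : ℝ) (p q : Plane) : Prop :=
  ∃ p₁ p₂ : Plane, latticeStep s 0 (p + center s) p₁ ∧ latticeStep s 1 p₁ p₂ ∧
    latticeStep s 2 p₂ (q + center s)

/-! ### Cut and paste -/

/-- The parallelogram at the lower left vertex of `X` with horizontal side `2 - 2 a₁ s`, where
`a₁ = ⌊1 / s⌋`. -/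
def cutPiece (s : ℝ) : Set Plane :=
  parallelogram (-center s) (s • e₁) (vec (2 - 2 * (⌊1 / s⌋ : ℝ) * s) 0)

open Classical in
/-- The cut-and-paste operation: the cut piece is moved to the right end of `X`, and the rest of
`X` is pushed to the left. -/
def cutPaste (s : ℝ) (p : Plane) : Plane :=
  if p ∈ cutPiece s then p + vec (2 * (⌊1 / s⌋ : ℝ) * s) 0
  else p - vec (2 - 2 * (⌊1 / s⌋ : ℝ) * s) 0

/-- The triple lattice map after cut and paste, before the boundaries of the pieces are removed
(only on one segment can it have two values). -/
def rawStep (s : ℝ) (x y : Plane) : Prop :=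
  ∃ p ∈ domainX s, ∃ q ∈ domainX s, x = cutPaste s p ∧ y = cutPaste s q ∧ tripleStep s p q

/-! ### The polygon exchange transformation and its periodic pattern -/

/-- The graph of the triple lattice PET `f`. It is defined at `p` when, on a neighbourhood of `p`,
the map above is the translation by a constant vector; that is, `f` is defined on the interiors
of its pieces, and not on their boundaries. -/
def petStep (s : ℝ) (p q : Plane) : Prop :=
  ∀ᶠ x in 𝓝 p, rawStep s x (x + (q - p))

/-- The set where `f` is defined. -/
def petDomain (s : ℝ) : Set Plane := {p | ∃ q, petStep s p q}

/-- The open piece (maximal connected set on which `f` is defined and continuous) of `p`. -/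
def piece (s : ℝ) (p : Plane) : Set Plane := connectedComponentIn (petDomain s) p

/-- `o` is an infinite forward orbit of `f`. -/
def IsOrbit (s : ℝ) (o : ℕ → Plane) : Prop := ∀ n, petStep s (o n) (o (n + 1))

def IsPeriodic (s : ℝ) (p : Plane) : Prop :=
  ∃ o : ℕ → Plane, IsOrbit s o ∧ o 0 = p ∧ ∃ n, 0 < n ∧ o n = p

/-- The points `p` and `q` have the same coding: at each time their orbits are in the same
piece. -/
def SameCoding (s : ℝ) (p q : Plane) : Prop :=
  ∃ o o' : ℕ → Plane, IsOrbit s o ∧ IsOrbit s o' ∧ o 0 = p ∧ o' 0 = q ∧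
    ∀ n, piece s (o n) = piece s (o' n)

/-- The set of all periodic tiles. -/
def periodicTiles (s : ℝ) : Set (Set Plane) :=
  {T | ∃ p, IsPeriodic s p ∧ T = {q | SameCoding s p q}}

/-- The periodic pattern `Δ`. -/
def periodicPattern (s : ℝ) : Set Plane := ⋃₀ periodicTiles s

/-- The limit set `Λ`: the points each of whose neighbourhoods meets infinitely many periodic
tiles. -/
def limitSet (s : ℝ) : Set Plane :=
  {p | ∀ U ∈ 𝓝 p, {T ∈ periodicTiles s | (T ∩ U).Nonempty}.Infinite}

/-! ### Trapezoids and the substitution rule -/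

/-- A quadrilateral given by its vertices in cyclic order; for a trapezoid, `a b` is the longer
base, `d c` the shorter base, `a d` and `b c` are the legs. -/
structure Trapezoid where
  a : Plane
  b : Plane
  c : Plane
  d : Plane

namespace Trapezoid

/-- The closed region bounded by the trapezoid. -/
def region (t : Trapezoid) : Set Plane := convexHull ℝ {t.a, t.b, t.c, t.d}

def map (f : Plane → Plane) (t : Trapezoid) : Trapezoid := ⟨f t.a, f t.b, f t.c, f t.d⟩

/-- `t` is an isosceles trapezoid with base angles `π / 3`, longer base `l`, legs `φ l` and
shorter base `φ² l`. -/
def IsGolden (t : Trapezoid) (l : ℝ) : Prop :=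
  0 < l ∧ dist t.a t.b = l ∧ t.c - t.d = phi ^ 2 • (t.b - t.a) ∧
    dist t.a t.d = phi * l ∧ dist t.b t.c = phi * l ∧
    EuclideanGeometry.angle t.d t.a t.b = Real.pi / 3 ∧
    EuclideanGeometry.angle t.a t.b t.c = Real.pi / 3

/-- The trapezoid inside `t` whose longer base is the leg `a d`; one of its legs lies on `a b`. -/
def left (t : Trapezoid) : Trapezoid where
  a := t.a
  b := t.d
  c := t.a + phi ^ 2 • (t.b - t.a) + phi ^ 2 • (t.d - t.a)
  d := t.a + phi ^ 2 • (t.b - t.a)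

/-- The trapezoid inside `t` whose longer base is the leg `b c`; one of its legs lies on `a b`. -/
def right (t : Trapezoid) : Trapezoid where
  a := t.b
  b := t.c
  c := t.b + phi ^ 2 • (t.a - t.b) + phi ^ 2 • (t.c - t.b)
  d := t.b + phi ^ 2 • (t.a - t.b)

/-- The trapezoid inside `t` whose longer base is the shorter base `d c` of `t`; its legs lie on
legs of `t.left` and `t.right`. -/
def top (t : Trapezoid) : Trapezoid where
  a := t.d
  b := t.c
  c := t.c + phi • (t.right.c - t.c)
  d := t.d + phi • (t.left.c - t.d)

/-- The substitution rule. -/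
def substitution (t : Trapezoid) : Set Trapezoid := {t.left, t.top, t.right}

end Trapezoid

/-- The top left vertex of `X`. -/
def topLeft (s : ℝ) : Plane := vec (-1 + s / 2) (√3 / 2 * s)

/-- The counterclockwise rotation by `π / 3` about the top left vertex of `X`. -/
def rotationMu (s : ℝ) (p : Plane) : Plane :=
  topLeft s + vec ((p - topLeft s) 0 / 2 - √3 / 2 * (p - topLeft s) 1)
    (√3 / 2 * (p - topLeft s) 0 + (p - topLeft s) 1 / 2)

/-- The reflection about the vertical line `x = 3 s / 2 - 1`. -/
def reflectionNu (s : ℝ) (p : Plane) : Plane := vec (2 * (3 / 2 * s - 1) - p 0) (p 1)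

/-- The fundamental trapezoids `A`, `B`, `C`. -/
def trapA (s : ℝ) : Trapezoid where
  a := topLeft s
  b := topLeft s + s • vec 1 (-√3)
  c := topLeft s + s • vec 1 (-√3) - (2 * (1 - s)) • vec 1 0
  d := topLeft s - (1 - s) • vec 1 (√3)

def trapB (s : ℝ) : Trapezoid := (trapA s).map (rotationMu s)

def trapC (s : ℝ) : Trapezoid := (trapA s).map (reflectionNu s)

/-- The marked trapezoids of level `n`. -/
def marked : ℕ → Set Trapezoid
  | 0 => {trapA phi, trapB phi, trapC phi}
  | n + 1 => ⋃ t ∈ marked n, t.substitution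

/-- The union `𝒞ₙ` of the marked trapezoids of level `n`. -/
def chain (n : ℕ) : Set Plane := ⋃ t ∈ marked n, t.region

end

end TripleLattice

namespace TripleLattice

noncomputable section

/-! A `Frame` is a golden trapezoid in the affine coordinates of the equilateral triangle on its
longer base. The substitution rule covers it except for two open triangles, `Frame.bot` and
`Frame.cap`. The relation `Tri` collects the triangles left open at all stages below a frame, each
with a scale; those of the fundamental trapezoids A, B, C are the gaps (`IsGap`). The proof is a
study of how f acts on gaps.

Permutation. In the coordinates `ca`, `cb` the map translates seven convex cells and fixes four
triangles. Each of A, B, C is cut into three frames and two triangles (`Tri.cases_inner`), every one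
of which lies in a single cell. The translation takes each frame to a mirrored frame of the same
kind, and since the rule is mirror symmetric, gaps go to gaps of the same scale. By
`IsGap.exists_move` and `IsGap.exists_move_to` this is a surjection of the finite set of gaps of
scale j, hence a permutation. Some power takes a gap to itself by a translation, which is trivial
because the gap is bounded. So a gap consists of periodic points with equal codings and lies in one
tile (`Recurrent.exists_tile`).

Renormalization. The similarity `psi`, of ratio φ, maps A, B, C onto pieces of B and A, and
intertwines f with an iterate of f that depends on the cell. The orbit of psi x contains the
psi-image of the orbit of x and at least one more point, so the period increases strictly
(`IsGap.minimalPeriod_psi`). Every gap of scale j + 1 reaches the psi-image of a gap of scale j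
(`IsGap.returns`). Hence points of gaps of scale j have period greater than j.

Limit set. Up to closures, X minus the level-n union consists of three fixed triangles and finitely
many gaps (`exists_cover`). Each lies in one tile, and tiles are open and pairwise disjoint, so the
open complement of the union meets only finitely many tiles; thus the limit set lies in every union.
Conversely, a small neighbourhood of a point of all unions contains a marked trapezoid, hence gaps
of arbitrarily large scale and period; since each tile has a common period, infinitely many tiles
occur. The vertex a of a marked trapezoid survives at all levels, which gives Hausdorff convergence
at rate φ^n. Density follows because a point of X is either a limit point of tiles or in the closure
of a set contained in a tile. -/

lemma phi_sq : phi ^ 2 = 1 - phi := by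
  have h : √5 ^ 2 = 5 := Real.sq_sqrt (by norm_num)
  unfold phi; linear_combination (1 / 4 : ℝ) * h

lemma phi_gt : 0.618 < phi := by
  have h : (2.236 : ℝ) < √5 := Real.lt_sqrt_of_sq_lt (by norm_num)
  unfold phi; linarith

lemma phi_lt : phi < 0.6181 := by
  have h : √5 < (2.2362 : ℝ) := (Real.sqrt_lt' (by norm_num)).2 (by norm_num)
  unfold phi; linarith

lemma phi_pos : 0 < phi := by linarith [phi_gt]

/-- A trapezoid in affine coordinates: `a` is a vertex, `u` the longer base, `φ v` a leg, and `k`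
counts the scale. -/
@[ext] structure Frame where
  a : Plane
  u : Plane
  v : Plane
  k : ℕ

/-! ### Substitution in affine coordinates and the uncovered triangles -/

namespace Frame

/-- The leg becomes the longer base, so u and v change roles. The ratios are φ, φ and φ² for `left`,
`right` and `top`, which is why k grows by 1, 1 and 2. -/
def left (t : Frame) : Frame := ⟨t.a, phi • t.v, phi • t.u, t.k + 1⟩
def right (t : Frame) : Frame := ⟨t.a + t.u, phi • (t.v - t.u), -(phi • t.u), t.k + 1⟩
def top (t : Frame) : Frame :=
  ⟨t.a + phi • t.v, phi ^ 2 • t.u, phi ^ 2 • (t.u - t.v), t.k + 2⟩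
def mirror (t : Frame) : Frame := ⟨t.a + t.u, -t.u, t.v - t.u, t.k⟩

/-- The trapezoid whose lower triangle is the upper triangle of `t`, on the right. -/
def inner (t : Frame) : Frame := ⟨t.a + phi • t.v, phi • (t.u - t.v), phi • t.u, t.k + 1⟩

/-- The image of `t` under the rotation that takes the leg at `a` to the longer base. -/
def turn (t : Frame) : Frame := ⟨t.a, t.u - t.v, t.u, t.k⟩

/-- The points `b1`, `b2` lie on the longer base, and `c1`, `c2` on the shorter base of `top`. The
two uncovered triangles touch only at `apex`. The first has side φ³ and the second φ⁴ times the
longer base. -/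
def b1 (t : Frame) : Plane := t.a + phi ^ 2 • t.u
def b2 (t : Frame) : Plane := t.a + phi • t.u
def apex (t : Frame) : Plane := t.a + phi ^ 2 • t.u + phi ^ 3 • t.v
def c1 (t : Frame) : Plane := t.a + phi • t.v + phi ^ 3 • (t.u - t.v)
def c2 (t : Frame) : Plane := t.a + phi • t.v + phi ^ 3 • (t.u - t.v) + phi ^ 4 • t.u

def bot (t : Frame) : Set Plane := interior (convexHull ℝ {t.b1, t.b2, t.apex})
def cap (t : Frame) : Set Plane := interior (convexHull ℝ {t.c1, t.c2, t.apex})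

lemma mirror_mirror (t : Frame) : t.mirror.mirror = t := by
  ext i <;> simp [mirror]
lemma mirror_left (t : Frame) : t.mirror.left = t.right := by
  have h := phi_sq
  ext i <;> simp [mirror, left, right]
lemma mirror_right (t : Frame) : t.mirror.right = t.left := by
  ext i <;> simp [mirror, left, right]
lemma mirror_top (t : Frame) : t.mirror.top = t.top.mirror := by
  have h := phi_sq
  ext i <;> simp [mirror, top] <;> grind
-- With the next lemmas and `inner_bot`, `inner_cap`: the subdivision of `inner` reuses pieces of
-- the subdivision of t, and the only new frame, `t.inner.right`, is the `inner` of `t.right`. So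
-- the pattern of `inner` is part of the pattern of t.
lemma inner_left (t : Frame) : t.inner.left = t.top := by
  have h := phi_sq
  ext i <;> simp [inner, left, top] <;> grind
lemma inner_top (t : Frame) : t.inner.top = t.right.right.left := by
  have h := phi_sq
  ext i <;> simp [inner, left, top, right] <;> grind
lemma inner_right (t : Frame) : t.inner.right = t.right.inner := by
  have h := phi_sq
  ext i <;> simp [inner, right] <;> grind
lemma plane_ext {p q : Plane} (h : ∀ i, p i = q i) : p = q := by ext i; exact h i

lemma mirror_bot (t : Frame) : t.mirror.bot = t.bot := by
  have h := phi_sq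
  have h1 : t.mirror.b1 = t.b2 := by ext i; simp [mirror, b1, b2]; grind
  have h2 : t.mirror.b2 = t.b1 := by ext i; simp [mirror, b1, b2]; grind
  have h3 : t.mirror.apex = t.apex := by ext i; simp [mirror, apex]; grind
  rw [bot, bot, h1, h2, h3, insert_comm]
lemma mirror_cap (t : Frame) : t.mirror.cap = t.cap := by
  have h := phi_sq
  have h1 : t.mirror.c1 = t.c2 := by ext i; simp [mirror, c1, c2]; grind
  have h2 : t.mirror.c2 = t.c1 := by ext i; simp [mirror, c1, c2]; grind
  have h3 : t.mirror.apex = t.apex := by ext i; simp [mirror, apex]; grind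
  rw [cap, cap, h1, h2, h3, insert_comm]
lemma inner_bot (t : Frame) : t.inner.bot = t.cap := by
  have h := phi_sq
  have h1 : t.inner.b1 = t.c1 := by ext i; simp [inner, b1, c1]; grind
  have h2 : t.inner.b2 = t.apex := by ext i; simp [inner, b2, apex]; grind
  have h3 : t.inner.apex = t.c2 := by ext i; simp [inner, apex, c2]; grind
  rw [bot, cap, h1, h2, h3, pair_comm]
lemma inner_cap (t : Frame) : t.inner.cap = t.right.right.bot := by
  have h := phi_sq
  have h1 : t.inner.c1 = t.right.right.b1 := by ext i; simp [inner, right, b1, c1]; grind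
  have h2 : t.inner.c2 = t.right.right.apex := by ext i; simp [inner, right, c2, apex]; grind
  have h3 : t.inner.apex = t.right.right.b2 := by ext i; simp [inner, right, apex, b2]; grind
  rw [bot, cap, h1, h2, h3, pair_comm]
end Frame

/-- `Tri t j δ`: the open triangle `δ`, of scale `j`, is one of the two triangles that the
substitution rule leaves uncovered in some descendant of `t`. -/
inductive Tri : Frame → ℕ → Set Plane → Prop
  | bot (t : Frame) : Tri t t.k t.bot
  | cap (t : Frame) : Tri t (t.k + 1) t.cap
  | left {t : Frame} {j : ℕ} {δ : Set Plane} : Tri t.left j δ → Tri t j δ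
  | right {t : Frame} {j : ℕ} {δ : Set Plane} : Tri t.right j δ → Tri t j δ
  | top {t : Frame} {j : ℕ} {δ : Set Plane} : Tri t.top j δ → Tri t j δ

namespace Tri
variable {t : Frame} {j : ℕ} {δ : Set Plane}

/-- The rule is symmetric under the reflection of the trapezoid, which exchanges `left` and `right`.
-/
lemma mirror (h : Tri t j δ) : Tri t.mirror j δ := by
  induction h with
  | bot t => rw [← Frame.mirror_bot]; exact .bot t.mirror
  | cap t => rw [← Frame.mirror_cap]; exact .cap t.mirror
  | left h _ => exact .right (by rwa [Frame.mirror_right])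
  | right h _ => exact .left (by rwa [Frame.mirror_left])
  | top _ ih => exact .top (by rwa [Frame.mirror_top])

lemma of_mirror (h : Tri t.mirror j δ) : Tri t j δ := by
  simpa [Frame.mirror_mirror] using h.mirror

lemma le (h : Tri t j δ) : t.k ≤ j := by
  induction h with
  | bot t => exact le_rfl
  | cap t => exact Nat.le_succ _
  | left _ ih => exact (Nat.le_succ _).trans ih
  | right _ ih => exact (Nat.le_succ _).trans ih
  | top _ ih => exact (Nat.le_add_right _ 2).trans ih

/-- Every substitution step raises k, so only descendants of bounded depth have triangles of scale
j. The number n below bounds that depth. -/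
lemma finite (t : Frame) (j : ℕ) : {δ | Tri t j δ}.Finite := by
  obtain ⟨n, hn⟩ : ∃ n, j + 1 ≤ t.k + n := ⟨j + 1, by omega⟩
  induction n using Nat.strong_induction_on generalizing t with
  | _ n ih =>
    rcases Nat.lt_or_ge j t.k with h | h
    · convert Set.finite_empty using 1
      ext δ
      simp only [mem_ofPred_eq, mem_empty_iff_false, iff_false]
      exact fun h' => absurd h'.le (by omega)
    · have h1 := ih (n - 1) (by omega) t.left (by simp only [Frame.left]; omega)
      have h2 := ih (n - 1) (by omega) t.right (by simp only [Frame.right]; omega)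
      have h3 := ih (n - 1) (by omega) t.top (by simp only [Frame.top]; omega)
      refine (((h1.union h2).union h3).union ((finite_singleton t.bot).union
        (finite_singleton t.cap))).subset ?_
      intro δ hδ
      cases hδ with
      | bot => simp
      | cap => simp
      | left h => exact .inl (.inl (.inl h))
      | right h => exact .inl (.inl (.inr h))
      | top h => exact .inl (.inr h)

/-- Passing to `left` raises k by exactly one, so the lower triangles of the successive left
descendants realise every scale. -/
lemma exists_tri (t : Frame) {j : ℕ} (h : t.k ≤ j) : ∃ δ, Tri t j δ := by
  obtain ⟨n, rfl⟩ := Nat.exists_eq_add_of_le h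
  clear h
  induction n generalizing t with
  | zero => exact ⟨_, .bot t⟩
  | succ n ih =>
    obtain ⟨δ, hδ⟩ := ih t.left
    refine ⟨δ, .left ?_⟩
    convert hδ using 1
    simp only [Frame.left]; omega

/-- Only the `right` case recurses, through the `inner` of `t.right`; the other cases are already
pieces of t. -/
lemma of_inner (h : Tri t.inner j δ) : Tri t j δ := by
  generalize hs : t.inner = s at h
  induction h generalizing t with
  | bot s => subst hs; rw [Frame.inner_bot]; exact .cap t
  | cap s => subst hs; rw [Frame.inner_cap]; exact .right (.right (.bot _))
  | left h _ => subst hs; rw [Frame.inner_left] at h; exact .top h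
  | right _ ih => subst hs; exact .right (ih (Frame.inner_right t).symm)
  | top h _ => subst hs; rw [Frame.inner_top] at h; exact .right (.right (.left h))

/-- The part of `t` on the right of its lower triangle is `t.inner` and half of `t.right`. -/
lemma cases_inner (h : Tri t j δ) : Tri t.inner j δ ∨ (j = t.k ∧ δ = t.bot) ∨ Tri t.left j δ ∨
    (j = t.right.k ∧ δ = t.right.bot) ∨ Tri t.right.left j δ := by
  induction h with
  | bot t => exact .inr (.inl ⟨rfl, rfl⟩)
  | cap t => left; rw [← Frame.inner_bot]; exact .bot _
  | left h _ => exact .inr (.inr (.inl h))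
  -- The five pieces of `t.right` regroup: its `inner`, its right lower triangle and its right left
  -- frame are the `right`, `cap` and `top` of `t.inner`, and the other two are pieces of t itself.
  | right h ih =>
    rename_i t j δ
    rcases ih with h | ⟨rfl, rfl⟩ | h | ⟨rfl, rfl⟩ | h
    · left; apply Tri.right; rwa [Frame.inner_right]
    · exact .inr (.inr (.inr (.inl ⟨rfl, rfl⟩)))
    · exact .inr (.inr (.inr (.inr h)))
    · left; rw [← Frame.inner_cap]; exact .cap _
    · left; apply Tri.top; rwa [Frame.inner_top]
  | top h _ => left; apply Tri.left; rwa [Frame.inner_left]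

lemma cases_inner_mirror (h : Tri t j δ) : Tri t.mirror.inner j δ ∨ (j = t.k ∧ δ = t.bot) ∨
    Tri t.right j δ ∨ (j = t.left.k ∧ δ = t.left.bot) ∨ Tri t.left.left j δ := by
  rcases h.mirror.cases_inner with h | ⟨h, h'⟩ | h | ⟨h, h'⟩ | h
  · exact .inl h
  · rw [Frame.mirror_bot] at h'; exact .inr (.inl ⟨h, h'⟩)
  · rw [Frame.mirror_left] at h; exact .inr (.inr (.inl h))
  · rw [Frame.mirror_right] at h h'; exact .inr (.inr (.inr (.inl ⟨h, h'⟩)))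
  · rw [Frame.mirror_right] at h
    exact .inr (.inr (.inr (.inr h)))
end Tri

/-! ### Affine images of frames -/

namespace Frame

/-- The image of a frame under an affine map, with a shift of the scale. -/
def map (g : Plane ≃ᵃ[ℝ] Plane) (n : ℕ) (t : Frame) : Frame :=
  ⟨g t.a, g.linear t.u, g.linear t.v, t.k + n⟩

variable (g : Plane ≃ᵃ[ℝ] Plane) (n : ℕ) (t : Frame)

lemma affine_add (p q : Plane) : g (p + q) = g p + g.linear q := by
  rw [add_comm p q, ← vadd_eq_add, AffineEquiv.map_vadd, vadd_eq_add, add_comm]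

lemma map_left : (t.map g n).left = t.left.map g n := by
  ext1 <;> simp [map, left, add_right_comm]
lemma map_right : (t.map g n).right = t.right.map g n := by
  ext1 <;> simp [map, right, affine_add, add_right_comm]
lemma map_top : (t.map g n).top = t.top.map g n := by
  ext1 <;> simp [map, top, affine_add, add_right_comm]

lemma image_interior_hull (s : Set Plane) :
    g '' interior (convexHull ℝ s) = interior (convexHull ℝ (g '' s)) := by
  have h1 := (AffineEquiv.toContinuousAffineEquiv g).toHomeomorph.image_interior (convexHull ℝ s)
  have h2 := g.toAffineMap.image_convexHull s
  exact h1.trans (congrArg interior h2)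

lemma map_bot : (t.map g n).bot = g '' t.bot := by
  rw [bot, bot, image_interior_hull, image_insert_eq, image_pair]
  congr 3 <;> simp [map, b1, b2, apex, affine_add]

lemma map_cap : (t.map g n).cap = g '' t.cap := by
  rw [cap, cap, image_interior_hull, image_insert_eq, image_pair]
  congr 3 <;> simp [map, c1, c2, apex, affine_add]

end Frame

lemma Tri.map {t : Frame} {j : ℕ} {δ : Set Plane} (h : Tri t j δ) (g : Plane ≃ᵃ[ℝ] Plane) (n : ℕ) :
    Tri (t.map g n) (j + n) (g '' δ) := by
  induction h with
  | bot t => rw [← Frame.map_bot g n]; exact .bot _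
  | cap t => rw [← Frame.map_cap g n, add_right_comm]; exact .cap _
  | left _ ih => exact .left (by rwa [Frame.map_left])
  | right _ ih => exact .right (by rwa [Frame.map_right])
  | top _ ih => exact .top (by rwa [Frame.map_top])

/-- Converse of `Tri.map`: substitution commutes with affine bijections, so a derivation for the
image frame pulls back step by step. -/
lemma Tri.exists_of_map {t : Frame} {j : ℕ} {δ : Set Plane} {g : Plane ≃ᵃ[ℝ] Plane} {n : ℕ}
    (h : Tri (t.map g n) j δ) : ∃ i ε, Tri t i ε ∧ j = i + n ∧ δ = g '' ε := by
  generalize hs : t.map g n = s at h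
  induction h generalizing t with
  | bot s => subst hs; exact ⟨_, _, .bot t, rfl, Frame.map_bot g n t⟩
  | cap s =>
    subst hs; exact ⟨_, _, .cap t, by simp only [Frame.map]; omega, Frame.map_cap g n t⟩
  | left _ ih =>
    subst hs
    obtain ⟨i, ε, h1, h2⟩ := ih (Frame.map_left g n t).symm
    exact ⟨i, ε, .left h1, h2⟩
  | right _ ih =>
    subst hs
    obtain ⟨i, ε, h1, h2⟩ := ih (Frame.map_right g n t).symm
    exact ⟨i, ε, .right h1, h2⟩
  | top _ ih =>
    subst hs
    obtain ⟨i, ε, h1, h2⟩ := ih (Frame.map_top g n t).symm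
    exact ⟨i, ε, .top h1, h2⟩

/-! ### Regions of frames and separation by linear forms -/

lemma phi_pow_three : phi ^ 3 = 2 * phi - 1 := by linear_combination (phi - 1) * phi_sq
lemma phi_pow_four : phi ^ 4 = 2 - 3 * phi := by
  linear_combination (phi ^ 2 - phi + 2) * phi_sq
-- A nonzero linear form is an open map, so it cannot attain the bound c at an interior point.
lemma lt_of_mem_interior {l : Plane →ₗ[ℝ] ℝ} (hl : l ≠ 0) {s : Set Plane} {c : ℝ}
    (h : ∀ x ∈ s, l x ≤ c) {x : Plane} (hx : x ∈ interior s) : l x < c := by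
  have h1 : IsOpen (l '' interior s) :=
    l.isOpenMap_of_finiteDimensional (LinearMap.surjective hl) _ isOpen_interior
  have h2 : l '' interior s ⊆ interior (Iic c) :=
    interior_maximal (by rintro _ ⟨y, hy, rfl⟩; exact h y (interior_subset hy)) h1
  rw [interior_Iic] at h2
  exact h2 ⟨x, hx, rfl⟩

lemma le_of_mem_hull {l : Plane →ₗ[ℝ] ℝ} {s : Set Plane} {c : ℝ}
    (h : ∀ x ∈ s, l x ≤ c) {x : Plane} (hx : x ∈ convexHull ℝ s) : l x ≤ c :=
  convexHull_min h (convex_halfSpace_le l.isLinear c) hx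

lemma disjoint_interior {l : Plane →ₗ[ℝ] ℝ} (hl : l ≠ 0) {s t : Set Plane} {c : ℝ}
    (hs : ∀ x ∈ s, l x ≤ c) (ht : ∀ x ∈ t, c ≤ l x) : Disjoint (interior s) (interior t) := by
  rw [Set.disjoint_left]
  intro x hx hx'
  have h1 := lt_of_mem_interior hl hs hx
  have h2 := lt_of_mem_interior (l := -l) (neg_ne_zero.2 hl) (c := -c)
    (fun y hy => by simpa using ht y hy) hx'
  simp at h2
  linarith

namespace Frame

/-- The point with affine coordinates `x`, `y`. -/
def para (t : Frame) (x y : ℝ) : Plane := t.a + x • t.u + y • t.v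

def toTrapezoid (t : Frame) : Trapezoid :=
  ⟨t.a, t.a + t.u, t.a + phi ^ 2 • t.u + phi • t.v, t.a + phi • t.v⟩

def region (t : Frame) : Set Plane := t.toTrapezoid.region

lemma left_toTrapezoid (t : Frame) : t.toTrapezoid.left = t.left.toTrapezoid := by
  have h := phi_sq
  simp only [toTrapezoid, Trapezoid.left, left, Trapezoid.mk.injEq]
  refine ⟨trivial, trivial, ?_, ?_⟩ <;> ext i <;> simp <;> grind
lemma right_toTrapezoid (t : Frame) : t.toTrapezoid.right = t.right.toTrapezoid := by
  have h := phi_sq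
  simp only [toTrapezoid, Trapezoid.right, right, Trapezoid.mk.injEq]
  refine ⟨trivial, ?_, ?_, ?_⟩ <;> ext i <;> simp <;> grind
lemma top_toTrapezoid (t : Frame) : t.toTrapezoid.top = t.top.toTrapezoid := by
  have h := phi_sq
  simp only [Trapezoid.top, left_toTrapezoid, right_toTrapezoid]
  simp only [toTrapezoid, top, left, right, Trapezoid.mk.injEq]
  refine ⟨trivial, ?_, ?_, ?_⟩ <;> ext i <;> simp <;> grind

lemma mem_hull_three {p q r : Plane} {α β γ : ℝ} (hα : 0 ≤ α) (hβ : 0 ≤ β) (hγ : 0 ≤ γ)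
    (h : α + β + γ = 1) : α • p + β • q + γ • r ∈ convexHull ℝ {p, q, r} := by
  have := (convex_convexHull ℝ {p, q, r}).sum_mem (t := Finset.univ) (w := ![α, β, γ])
    (z := ![p, q, r]) (by intro i _; fin_cases i <;> simpa) (by simp [Fin.sum_univ_three, h])
    (by intro i _; apply subset_convexHull; fin_cases i <;> simp)
  simpa [Fin.sum_univ_three] using this

lemma mem_hull_four {p q r s : Plane} {α β γ δ : ℝ} (hα : 0 ≤ α) (hβ : 0 ≤ β) (hγ : 0 ≤ γ)
    (hδ : 0 ≤ δ) (h : α + β + γ + δ = 1) :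
    α • p + β • q + γ • r + δ • s ∈ convexHull ℝ {p, q, r, s} := by
  have := (convex_convexHull ℝ {p, q, r, s}).sum_mem (t := Finset.univ) (w := ![α, β, γ, δ])
    (z := ![p, q, r, s]) (by intro i _; fin_cases i <;> simpa) (by simp [Fin.sum_univ_four, h])
    (by intro i _; apply subset_convexHull; fin_cases i <;> simp)
  simpa [Fin.sum_univ_four] using this

lemma convex_trapezoid : Convex ℝ {z : ℝ × ℝ | 0 ≤ z.1 ∧ 0 ≤ z.2 ∧ z.2 ≤ phi ∧ z.1 + z.2 ≤ 1} := by
  rintro ⟨x, y⟩ ⟨h1, h2, h3, h4⟩ ⟨x', y'⟩ ⟨h1', h2', h3', h4'⟩ α β hα hβ hαβ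
  simp only [mem_ofPred_eq, Prod.smul_mk, Prod.mk_add_mk, smul_eq_mul] at *
  refine ⟨by positivity, by positivity, ?_, ?_⟩
  · calc α * y + β * y' ≤ α * phi + β * phi := by gcongr
      _ = phi := by rw [← add_mul, hαβ, one_mul]
  · calc α * x + β * x' + (α * y + β * y') = α * (x + y) + β * (x' + y') := by ring
      _ ≤ α * 1 + β * 1 := by gcongr
      _ = 1 := by linarith

lemma mem_region (t : Frame) (p : Plane) : p ∈ t.region ↔
    ∃ x y, 0 ≤ x ∧ 0 ≤ y ∧ y ≤ phi ∧ x + y ≤ 1 ∧ p = t.para x y := by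
  have h0 := phi_pos
  have h1 := phi_lt
  have h2 := phi_gt
  have hs := phi_sq
  constructor
  · intro hp
    let g : ℝ × ℝ →ᵃ[ℝ] Plane :=
      ((LinearMap.fst ℝ ℝ ℝ).smulRight t.u + (LinearMap.snd ℝ ℝ ℝ).smulRight t.v).toAffineMap +
        AffineMap.const ℝ (ℝ × ℝ) t.a
    have hg : ∀ x y, g (x, y) = t.para x y := by
      intro x y; simp [g, para]; abel
    have : p ∈ g '' {z : ℝ × ℝ | 0 ≤ z.1 ∧ 0 ≤ z.2 ∧ z.2 ≤ phi ∧ z.1 + z.2 ≤ 1} := by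
      refine convexHull_min ?_ (convex_trapezoid.affine_image g) hp
      rintro q (rfl | rfl | rfl | rfl)
      · exact ⟨(0, 0), by simp [h0.le], by rw [hg]; simp [para, toTrapezoid]⟩
      · exact ⟨(1, 0), by simp [h0.le], by rw [hg]; simp [para, toTrapezoid]⟩
      · exact ⟨(phi ^ 2, phi), by simp [h0.le]; linarith,
          by rw [hg]; simp [para, toTrapezoid]⟩
      · exact ⟨(0, phi), by simp [h0.le]; linarith, by rw [hg]; simp [para, toTrapezoid]⟩
    obtain ⟨⟨x, y⟩, ⟨hx, hy, hy', hxy⟩, rfl⟩ := this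
    exact ⟨x, y, hx, hy, hy', hxy, hg x y⟩
  · rintro ⟨x, y, hx, hy, hy', hxy, rfl⟩
    have e1 : 0 < 1 - y := by linarith
    -- The section at height y has width 1 - y. Here r is the relative position in that section and
    -- s the relative height; the weights of the four vertices are bilinear in r and s.
    set r := x / (1 - y) with hr
    set s := y / phi with hs'
    have r0 : 0 ≤ r := by positivity
    have r1 : r ≤ 1 := by rw [hr, div_le_one e1]; linarith
    have s0 : 0 ≤ s := by positivity
    have s1 : s ≤ 1 := by rw [hs', div_le_one h0]; linarith
    have hx' : x = r * (1 - y) := by rw [hr]; field_simp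
    have hy' : y = s * phi := by rw [hs']; field_simp
    have := mem_hull_four (p := t.toTrapezoid.a) (q := t.toTrapezoid.b) (r := t.toTrapezoid.c)
      (s := t.toTrapezoid.d) (α := (1 - s) * (1 - r)) (β := (1 - s) * r) (γ := s * r)
      (δ := s * (1 - r)) (mul_nonneg (by linarith) (by linarith)) (mul_nonneg (by linarith) r0)
      (mul_nonneg s0 r0) (mul_nonneg s0 (by linarith)) (by ring)
    rw [region, Trapezoid.region]
    convert this using 1
    rw [hx', hy']
    ext i
    simp [toTrapezoid, para]
    linear_combination (- s * r * t.u i) * hs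

lemma para_mem_bot {t : Frame} {x y : ℝ} (h1 : phi ^ 2 ≤ x) (h2 : 0 ≤ y) (h3 : x + y ≤ phi) :
    t.para x y ∈ convexHull ℝ {t.b1, t.b2, t.apex} := by
  have h0 := phi_pos
  have h := phi_pow_three
  have hs := phi_sq
  have hp : 0 < phi ^ 3 := by positivity
  -- The weights are the barycentric coordinates: distances to the three sides divided by the side
  -- length φ³.
  have := mem_hull_three (p := t.b1) (q := t.b2) (r := t.apex) (α := (phi - x - y) / phi ^ 3)
    (β := (x - phi ^ 2) / phi ^ 3) (γ := y / phi ^ 3) (div_nonneg (by linarith) hp.le)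
    (div_nonneg (by linarith) hp.le) (div_nonneg h2 hp.le)
    (by rw [← add_div, ← add_div, div_eq_one_iff_eq hp.ne']; linarith)
  convert this using 1
  ext i
  simp only [para, b1, b2, apex, PiLp.add_apply, PiLp.smul_apply, smul_eq_mul]
  field_simp
  rw [hs, h]; ring

lemma para_mem_cap {t : Frame} {x y : ℝ} (h1 : x ≤ phi ^ 2) (h2 : y ≤ phi ^ 2)
    (h3 : phi ≤ x + y) : t.para x y ∈ convexHull ℝ {t.c1, t.c2, t.apex} := by
  have h0 := phi_pos
  have h := phi_pow_four
  have hh := phi_pow_three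
  have hs := phi_sq
  have hp : 0 < phi ^ 4 := by positivity
  have := mem_hull_three (p := t.c1) (q := t.c2) (r := t.apex) (α := (phi ^ 2 - x) / phi ^ 4)
    (β := (x + y - phi) / phi ^ 4) (γ := (phi ^ 2 - y) / phi ^ 4) (div_nonneg (by linarith) hp.le)
    (div_nonneg (by linarith) hp.le) (div_nonneg (by linarith) hp.le)
    (by rw [← add_div, ← add_div, div_eq_one_iff_eq hp.ne']; linarith)
  convert this using 1
  ext i
  simp only [para, c1, c2, apex, PiLp.add_apply, PiLp.smul_apply, PiLp.sub_apply, smul_eq_mul]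
  field_simp
  rw [hs, h, hh]; ring

/-- The lines x = φ² and x + y = φ cross at the apex and separate `left`, `right`, the lower
triangle and the part above the apex. The line y = φ² divides the last part into `top` and the upper
triangle. -/
lemma region_subset (t : Frame) : t.region ⊆ t.left.region ∪ t.right.region ∪ t.top.region ∪
    convexHull ℝ {t.b1, t.b2, t.apex} ∪ convexHull ℝ {t.c1, t.c2, t.apex} := by
  intro p hp
  obtain ⟨x, y, hx, hy, hy', hxy, rfl⟩ := (mem_region t p).1 hp
  have h0 := phi_pos
  have hs := phi_sq
  have h3 := phi_pow_three
  rcases le_total x (phi ^ 2) with h1 | h1 <;> rcases le_total (x + y) phi with h2 | h2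
  · refine .inl (.inl (.inl (.inl ((mem_region _ _).2 ⟨y / phi, x / phi, by positivity,
      by positivity, ?_, ?_, ?_⟩))))
    · rw [div_le_iff₀ h0]; linarith
    · rw [← add_div, div_le_one h0]; linarith
    · simp only [para, left, smul_smul]; field_simp; abel
  · rcases le_total y (phi ^ 2) with h4 | h4
    · exact .inr (para_mem_cap h1 h4 h2)
    · refine .inl (.inl (.inr ((mem_region _ _).2 ⟨(x + y - phi) / phi ^ 2, (phi - y) / phi ^ 2,
        div_nonneg (by linarith) (by positivity), div_nonneg (by linarith) (by positivity),
        ?_, ?_, ?_⟩)))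
      · rw [div_le_iff₀ (by positivity)]; linarith
      · rw [← add_div, div_le_one (by positivity)]; linarith
      · simp only [para, top, smul_smul]; field_simp; module
  · exact .inl (.inr (para_mem_bot h1 hy h2))
  · refine .inl (.inl (.inl (.inr ((mem_region _ _).2 ⟨y / phi, (1 - x - y) / phi, by positivity,
      div_nonneg (by linarith) h0.le, ?_, ?_, ?_⟩))))
    · rw [div_le_iff₀ h0]; linarith
    · rw [← add_div, div_le_one h0]; linarith
    · simp only [para, right, smul_smul, smul_neg]; rw [← neg_smul]; field_simp
      ext i; simp; field_simp; ring

lemma left_region (t : Frame) {p : Plane} (hp : p ∈ t.left.region) :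
    ∃ x y, 0 ≤ x ∧ x ≤ phi ^ 2 ∧ 0 ≤ y ∧ x + y ≤ phi ∧ p = t.para x y := by
  obtain ⟨x, y, hx, hy, hy', hxy, rfl⟩ := (mem_region _ p).1 hp
  have h0 := phi_pos
  refine ⟨phi * y, phi * x, by positivity, by nlinarith, by positivity, by nlinarith, ?_⟩
  simp only [para, left]; module

lemma right_region (t : Frame) {p : Plane} (hp : p ∈ t.right.region) :
    ∃ x y, phi ^ 2 ≤ x ∧ phi ≤ x + y ∧ 0 ≤ y ∧ x + y ≤ 1 ∧ p = t.para x y := by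
  obtain ⟨x, y, hx, hy, hy', hxy, rfl⟩ := (mem_region _ p).1 hp
  have h0 := phi_pos
  have hs := phi_sq
  refine ⟨1 - phi * x - phi * y, phi * x, by nlinarith, by nlinarith, by positivity, by nlinarith,
    ?_⟩
  simp only [para, right]; module

lemma top_region (t : Frame) {p : Plane} (hp : p ∈ t.top.region) :
    ∃ x y, x ≤ phi ^ 2 ∧ phi ≤ x + y ∧ phi ^ 2 ≤ y ∧ y ≤ phi ∧ p = t.para x y := by
  obtain ⟨x, y, hx, hy, hy', hxy, rfl⟩ := (mem_region _ p).1 hp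
  have h0 := phi_pos
  have hs := phi_sq
  have h3 := phi_pow_three
  have hp : 0 < phi ^ 2 := by positivity
  refine ⟨phi ^ 2 * (x + y), phi - phi ^ 2 * y, by nlinarith, by nlinarith, by nlinarith,
    by nlinarith, ?_⟩
  simp only [para, top]; module

lemma left_region_subset (t : Frame) : t.left.region ⊆ t.region := by
  intro p hp
  obtain ⟨x, y, h1, h2, h3, h4, rfl⟩ := t.left_region hp
  exact (mem_region _ _).2 ⟨x, y, h1, h3, by linarith, by linarith [phi_lt], rfl⟩

lemma right_region_subset (t : Frame) : t.right.region ⊆ t.region := by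
  intro p hp
  obtain ⟨x, y, h1, h2, h3, h4, rfl⟩ := t.right_region hp
  exact (mem_region _ _).2 ⟨x, y, by nlinarith [phi_pos], h3, by linarith [phi_sq], h4, rfl⟩

lemma top_region_subset (t : Frame) : t.top.region ⊆ t.region := by
  intro p hp
  obtain ⟨x, y, h1, h2, h3, h4, rfl⟩ := t.top_region hp
  exact (mem_region _ _).2 ⟨x, y, by linarith, by linarith [sq_nonneg phi], h4,
    by linarith [phi_sq], rfl⟩

lemma bot_hull_subset (t : Frame) : convexHull ℝ {t.b1, t.b2, t.apex} ⊆ t.region := by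
  have h0 := phi_pos
  have h1 := phi_lt
  have hs := phi_sq
  have h3 := phi_pow_three
  refine convexHull_min ?_ (convex_convexHull _ _)
  rintro q (rfl | rfl | rfl)
  · exact (mem_region _ _).2 ⟨phi ^ 2, 0, by positivity, le_rfl, h0.le, by linarith,
      by simp [para, b1]⟩
  · exact (mem_region _ _).2 ⟨phi, 0, h0.le, le_rfl, h0.le, by linarith, by simp [para, b2]⟩
  · exact (mem_region _ _).2 ⟨phi ^ 2, phi ^ 3, by positivity, by positivity, by linarith,
      by linarith, by simp [para, apex]⟩

lemma cap_hull_subset (t : Frame) : convexHull ℝ {t.c1, t.c2, t.apex} ⊆ t.region := by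
  have h0 := phi_pos
  have h1 := phi_lt
  have h2 := phi_gt
  have hs := phi_sq
  have h3 := phi_pow_three
  have h4 := phi_pow_four
  refine convexHull_min ?_ (convex_convexHull _ _)
  rintro q (rfl | rfl | rfl)
  · exact (mem_region _ _).2 ⟨phi ^ 3, phi ^ 2, by positivity, by positivity, by linarith,
      by linarith, by ext i; simp [para, c1]; grind⟩
  · exact (mem_region _ _).2 ⟨phi ^ 2, phi ^ 2, by positivity, by positivity, by linarith,
      by linarith, by ext i; simp [para, c2]; grind⟩
  · exact (mem_region _ _).2 ⟨phi ^ 2, phi ^ 3, by positivity, by positivity, by linarith,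
      by linarith, by simp [para, apex]⟩

end Frame

lemma Tri.subset_interior {t : Frame} {j : ℕ} {δ : Set Plane} (h : Tri t j δ) :
    δ ⊆ interior t.region := by
  induction h with
  | bot t => exact interior_mono t.bot_hull_subset
  | cap t => exact interior_mono t.cap_hull_subset
  | left _ ih => exact ih.trans (interior_mono (Frame.left_region_subset _))
  | right _ ih => exact ih.trans (interior_mono (Frame.right_region_subset _))
  | top _ ih => exact ih.trans (interior_mono (Frame.top_region_subset _))

lemma Tri.convex {t : Frame} {j : ℕ} {δ : Set Plane} (h : Tri t j δ) : Convex ℝ δ := by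
  induction h with
  | bot t => exact (convex_convexHull _ _).interior
  | cap t => exact (convex_convexHull _ _).interior
  | _ => assumption

lemma Frame.isCompact_region (t : Frame) : IsCompact t.region :=
  Set.Finite.isCompact_convexHull (𝕜 := ℝ) (by simp)

lemma Tri.isBounded {t : Frame} {j : ℕ} {δ : Set Plane} (h : Tri t j δ) :
    Bornology.IsBounded δ :=
  t.isCompact_region.isBounded.subset (h.subset_interior.trans interior_subset)

/-- The linear form `p ↦ w × p`. -/
def crossForm (w : Plane) : Plane →ₗ[ℝ] ℝ where
  toFun p := w 0 * p 1 - w 1 * p 0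
  map_add' p q := by simp; ring
  map_smul' c p := by simp; ring

lemma crossForm_apply (w p : Plane) : crossForm w p = w 0 * p 1 - w 1 * p 0 := rfl

/-! ### Equilateral frames: metric data, nonempty triangles, disjointness -/

namespace Frame

/-- The sides of the frame are those of an equilateral triangle of side `2 φ ^ (k + 1)`. -/
def Equilateral (t : Frame) : Prop :=
  t.u 0 ^ 2 + t.u 1 ^ 2 = (2 * phi ^ (t.k + 1)) ^ 2 ∧
  t.v 0 ^ 2 + t.v 1 ^ 2 = (2 * phi ^ (t.k + 1)) ^ 2 ∧
  t.u 0 * t.v 0 + t.u 1 * t.v 1 = (2 * phi ^ (t.k + 1)) ^ 2 / 2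

lemma Equilateral.left {t : Frame} (h : t.Equilateral) : t.left.Equilateral := by
  obtain ⟨h1, h2, h3⟩ := h
  refine ⟨?_, ?_, ?_⟩ <;> simp [Frame.left]
  · linear_combination phi ^ 2 * h2
  · linear_combination phi ^ 2 * h1
  · linear_combination phi ^ 2 * h3

lemma Equilateral.right {t : Frame} (h : t.Equilateral) : t.right.Equilateral := by
  obtain ⟨h1, h2, h3⟩ := h
  refine ⟨?_, ?_, ?_⟩ <;> simp [Frame.right]
  · linear_combination phi ^ 2 * (h1 + h2 - 2 * h3)
  · linear_combination phi ^ 2 * h1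
  · linear_combination phi ^ 2 * (h1 - h3)

lemma Equilateral.top {t : Frame} (h : t.Equilateral) : t.top.Equilateral := by
  obtain ⟨h1, h2, h3⟩ := h
  refine ⟨?_, ?_, ?_⟩ <;> simp [Frame.top]
  · linear_combination phi ^ 4 * h1
  · linear_combination phi ^ 4 * (h1 + h2 - 2 * h3)
  · linear_combination phi ^ 4 * (h1 - h3)

/-- Lagrange's identity: a vanishing cross product would make (u·v)² equal to |u|²|v|², whereas it
is a quarter of it. -/
lemma Equilateral.cross_ne {t : Frame} (h : t.Equilateral) : crossForm t.u t.v ≠ 0 := by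
  obtain ⟨h1, h2, h3⟩ := h
  intro h0
  rw [crossForm_apply] at h0
  have hr : 0 < (2 * phi ^ (t.k + 1)) ^ 2 := by have := phi_pos; positivity
  generalize (2 * phi ^ (t.k + 1)) ^ 2 = r at *
  have : 0 < r ^ 2 := by positivity
  nlinarith [congrArg₂ (· * ·) h1 h2, congrArg₂ (· * ·) h3 h3, congrArg₂ (· * ·) h0 h0]

lemma norm_sq_plane (p : Plane) : ‖p‖ ^ 2 = p 0 ^ 2 + p 1 ^ 2 := by
  simp [EuclideanSpace.norm_sq_eq, Fin.sum_univ_two]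

lemma norm_eq_of {p : Plane} {r : ℝ} (hr : 0 ≤ r) (h : p 0 ^ 2 + p 1 ^ 2 = r ^ 2) : ‖p‖ = r := by
  rw [← abs_of_nonneg hr, ← abs_of_nonneg (norm_nonneg p), ← sq_eq_sq_iff_abs_eq_abs,
    norm_sq_plane, h]

lemma inner_plane (p q : Plane) : Inner.inner ℝ p q = p 0 * q 0 + p 1 * q 1 := by
  simp [PiLp.inner_apply, Fin.sum_univ_two]; ring

lemma angle_eq_of {p q : Plane} {r s : ℝ} (hr : 0 < r) (hs : 0 < s)
    (h1 : p 0 ^ 2 + p 1 ^ 2 = r ^ 2) (h2 : q 0 ^ 2 + q 1 ^ 2 = s ^ 2)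
    (h3 : p 0 * q 0 + p 1 * q 1 = r * s / 2) : InnerProductGeometry.angle p q = Real.pi / 3 := by
  rw [InnerProductGeometry.angle, inner_plane, norm_eq_of hr.le h1, norm_eq_of hs.le h2, h3,
    show r * s / 2 / (r * s) = 1 / 2 by field_simp, ← Real.cos_pi_div_three,
    Real.arccos_cos (by positivity) (by linarith [Real.pi_pos])]

lemma Equilateral.isGolden {t : Frame} (h : t.Equilateral) :
    t.toTrapezoid.IsGolden (2 * phi ^ (t.k + 1)) := by
  obtain ⟨h1, h2, h3⟩ := h
  have hp := phi_pos
  have hr : 0 < 2 * phi ^ (t.k + 1) := by positivity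
  generalize 2 * phi ^ (t.k + 1) = r at *
  have hs := phi_sq
  refine ⟨hr, ?_, ?_, ?_, ?_, ?_, ?_⟩
  · rw [dist_eq_norm]
    exact norm_eq_of hr.le (by simp [toTrapezoid]; linarith)
  · simp only [toTrapezoid]; module
  · rw [dist_eq_norm]
    exact norm_eq_of (by positivity) (by simp [toTrapezoid]; linear_combination phi ^ 2 * h2)
  · rw [dist_eq_norm]
    exact norm_eq_of (by positivity)
      (by simp [toTrapezoid, hs]; linear_combination phi ^ 2 * (h1 + h2 - 2 * h3))
  · rw [EuclideanGeometry.angle]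
    exact angle_eq_of (r := phi * r) (s := r) (by positivity) hr
      (by simp [toTrapezoid]; linear_combination phi ^ 2 * h2) (by simpa [toTrapezoid])
      (by simp [toTrapezoid]; linear_combination phi * h3)
  · rw [EuclideanGeometry.angle]
    exact angle_eq_of (r := r) (s := phi * r) hr (by positivity)
      (by simpa [toTrapezoid])
      (by simp [toTrapezoid, hs]; linear_combination phi ^ 2 * (h1 + h2 - 2 * h3))
      (by simp [toTrapezoid, hs]; linear_combination phi * (h1 - h3))

lemma Equilateral.para_surjective {t : Frame} (h : t.Equilateral) (p : Plane) :
    ∃ x y, t.para x y = p := by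
  have hD := h.cross_ne
  refine ⟨crossForm (p - t.a) t.v / crossForm t.u t.v, crossForm t.u (p - t.a) / crossForm t.u t.v,
    ?_⟩
  generalize hD' : crossForm t.u t.v = D at *
  have e : ∀ i, t.a i + crossForm (p - t.a) t.v / D * t.u i + crossForm t.u (p - t.a) / D * t.v i =
      p i := by
    intro i
    rw [div_mul_eq_mul_div, div_mul_eq_mul_div, add_assoc, ← add_div]
    rw [crossForm_apply] at hD'
    have : (crossForm (p - t.a) t.v * t.u i + crossForm t.u (p - t.a) * t.v i) = D *
        (p i - t.a i) := by
      rw [crossForm_apply, crossForm_apply, ← hD']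
      fin_cases i <;> simp <;> ring
    rw [this, mul_div_cancel_left₀ _ hD]; ring
  exact plane_ext fun i => by simpa [para] using e i

lemma Equilateral.isOpen_para {t : Frame} (h : t.Equilateral) {s : Set (ℝ × ℝ)} (hs : IsOpen s) :
    IsOpen ((fun z : ℝ × ℝ => t.para z.1 z.2) '' s) := by
  let g : ℝ × ℝ →ₗ[ℝ] Plane :=
    (LinearMap.fst ℝ ℝ ℝ).smulRight t.u + (LinearMap.snd ℝ ℝ ℝ).smulRight t.v
  have hg : Function.Surjective g := by
    intro p
    obtain ⟨x, y, hxy⟩ := h.para_surjective (t.a + p)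
    refine ⟨(x, y), ?_⟩
    simp only [para, add_assoc, add_right_inj] at hxy
    simpa [g] using hxy
  have h1 := g.isOpenMap_of_finiteDimensional hg s hs
  have h2 := (Homeomorph.addLeft t.a).isOpenMap _ h1
  convert h2 using 1
  rw [image_image]
  refine image_congr fun z _ => ?_
  simp [g, para, add_assoc]

lemma Equilateral.bot_nonempty {t : Frame} (h : t.Equilateral) : t.bot.Nonempty := by
  have h1 : IsOpen {z : ℝ × ℝ | phi ^ 2 < z.1 ∧ 0 < z.2 ∧ z.1 + z.2 < phi} := by
    simp only [Set.ofPred_and]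
    refine (isOpen_lt ?_ ?_).inter ((isOpen_lt ?_ ?_).inter (isOpen_lt ?_ ?_)) <;> fun_prop
  refine ⟨_, interior_maximal ?_ (h.isOpen_para h1) ⟨(0.4, 0.1), ?_, rfl⟩⟩
  · rintro _ ⟨z, ⟨h1, h2, h3⟩, rfl⟩
    exact para_mem_bot h1.le h2.le h3.le
  · have := phi_gt
    have := phi_sq
    refine ⟨?_, ?_, ?_⟩ <;> norm_num <;> linarith

lemma Equilateral.cap_nonempty {t : Frame} (h : t.Equilateral) : t.cap.Nonempty := by
  have h1 : IsOpen {z : ℝ × ℝ | z.1 < phi ^ 2 ∧ z.2 < phi ^ 2 ∧ phi < z.1 + z.2} := by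
    simp only [Set.ofPred_and]
    refine (isOpen_lt ?_ ?_).inter ((isOpen_lt ?_ ?_).inter (isOpen_lt ?_ ?_)) <;> fun_prop
  refine ⟨_, interior_maximal ?_ (h.isOpen_para h1) ⟨(0.35, 0.35), ?_, rfl⟩⟩
  · rintro _ ⟨z, ⟨h1, h2, h3⟩, rfl⟩
    exact para_mem_cap h1.le h2.le h3.le
  · have := phi_lt
    have := phi_sq
    refine ⟨?_, ?_, ?_⟩ <;> norm_num <;> linarith

/-- A convex set with nonempty interior lies in the closure of its interior. -/
lemma Equilateral.closure_bot {t : Frame} (h : t.Equilateral) :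
    convexHull ℝ {t.b1, t.b2, t.apex} ⊆ closure t.bot := by
  rw [bot, (convex_convexHull ℝ _).closure_interior_eq_closure_of_nonempty_interior h.bot_nonempty]
  exact subset_closure

lemma Equilateral.closure_cap {t : Frame} (h : t.Equilateral) :
    convexHull ℝ {t.c1, t.c2, t.apex} ⊆ closure t.cap := by
  rw [cap, (convex_convexHull ℝ _).closure_interior_eq_closure_of_nonempty_interior h.cap_nonempty]
  exact subset_closure

/-- Separation by a line in the affine coordinates of a frame. -/
lemma Equilateral.disjoint {t : Frame} (h : t.Equilateral) {s s' : Set Plane} (α β c : ℝ)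
    (h0 : α ≠ 0 ∨ β ≠ 0)
    (hs : ∀ p ∈ s, ∃ x y, p = t.para x y ∧ α * x + β * y ≤ c)
    (hs' : ∀ p ∈ s', ∃ x y, p = t.para x y ∧ c ≤ α * x + β * y) :
    Disjoint (interior s) (interior s') := by
  have hD := h.cross_ne
  set D := crossForm t.u t.v with hD'
  set l := D⁻¹ • crossForm (β • t.u - α • t.v) with hl
  have key : ∀ x y, l (t.para x y) = l t.a + (α * x + β * y) := by
    intro x y
    rw [crossForm_apply] at hD'
    have : crossForm (β • t.u - α • t.v) (x • t.u + y • t.v) = (α * x + β * y) * D := by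
      rw [crossForm_apply, hD']; simp; ring
    rw [para, add_assoc, map_add, hl, LinearMap.smul_apply, LinearMap.smul_apply, this,
      smul_eq_mul, smul_eq_mul]
    field_simp
  have hl0 : l ≠ 0 := by
    intro hl0
    simp only [hl0, LinearMap.zero_apply, zero_add] at key
    have h1 := key 1 0
    have h2 := key 0 1
    rcases h0 with h0 | h0
    · apply h0; linarith
    · apply h0; linarith
  refine disjoint_interior hl0 (c := l t.a + c) ?_ ?_
  · intro p hp
    obtain ⟨x, y, rfl, h⟩ := hs p hp
    rw [key]; linarith
  · intro p hp
    obtain ⟨x, y, rfl, h⟩ := hs' p hp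
    rw [key]; linarith

lemma Equilateral.disjoint_left_right {t : Frame} (h : t.Equilateral) :
    Disjoint (interior t.left.region) (interior t.right.region) := by
  refine h.disjoint 1 1 phi (.inl one_ne_zero) ?_ ?_
  · intro p hp
    obtain ⟨x, y, h1, h2, h3, h4, rfl⟩ := t.left_region hp
    exact ⟨x, y, rfl, by linarith⟩
  · intro p hp
    obtain ⟨x, y, h1, h2, h3, h4, rfl⟩ := t.right_region hp
    exact ⟨x, y, rfl, by linarith⟩

lemma Equilateral.disjoint_left_top {t : Frame} (h : t.Equilateral) :
    Disjoint (interior t.left.region) (interior t.top.region) := by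
  refine h.disjoint 1 1 phi (.inl one_ne_zero) ?_ ?_
  · intro p hp
    obtain ⟨x, y, h1, h2, h3, h4, rfl⟩ := t.left_region hp
    exact ⟨x, y, rfl, by linarith⟩
  · intro p hp
    obtain ⟨x, y, h1, h2, h3, h4, rfl⟩ := t.top_region hp
    exact ⟨x, y, rfl, by linarith⟩

lemma Equilateral.disjoint_top_right {t : Frame} (h : t.Equilateral) :
    Disjoint (interior t.top.region) (interior t.right.region) := by
  refine h.disjoint 1 0 (phi ^ 2) (.inl one_ne_zero) ?_ ?_
  · intro p hp
    obtain ⟨x, y, h1, h2, h3, h4, rfl⟩ := t.top_region hp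
    exact ⟨x, y, rfl, by linarith⟩
  · intro p hp
    obtain ⟨x, y, h1, h2, h3, h4, rfl⟩ := t.right_region hp
    exact ⟨x, y, rfl, by linarith⟩

lemma a_mem_region (t : Frame) : t.a ∈ t.region := by
  rw [mem_region]
  exact ⟨0, 0, le_rfl, le_rfl, phi_pos.le, by norm_num, by simp [para]⟩

lemma Equilateral.dist_le {t : Frame} (h : t.Equilateral) {p q : Plane} (hp : p ∈ t.region)
    (hq : q ∈ t.region) : dist p q ≤ 4 * phi ^ t.k := by
  have h0 := phi_pos
  have hr : 0 ≤ 2 * phi ^ (t.k + 1) := by positivity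
  have hu := norm_eq_of hr h.1
  have hv := norm_eq_of hr h.2.1
  have key : ∀ p ∈ t.region, dist p t.a ≤ 2 * phi ^ (t.k + 1) := by
    intro p hp
    obtain ⟨x, y, h1, h2, h3, h4, rfl⟩ := (mem_region t p).1 hp
    rw [dist_eq_norm, show t.para x y - t.a = x • t.u + y • t.v by simp [para, add_assoc]]
    calc _ ≤ ‖x • t.u‖ + ‖y • t.v‖ := norm_add_le _ _
      _ = (x + y) * (2 * phi ^ (t.k + 1)) := by
        rw [norm_smul, norm_smul, hu, hv, Real.norm_of_nonneg h1, Real.norm_of_nonneg h2]; ring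
      _ ≤ 1 * (2 * phi ^ (t.k + 1)) := by gcongr
      _ = _ := one_mul _
  have h3 : phi ^ (t.k + 1) ≤ phi ^ t.k := pow_le_pow_of_le_one h0.le (by linarith [phi_lt])
      (by omega)
  linarith [dist_triangle_right p q t.a, key p hp, key q hq]

end Frame

lemma Tri.nonempty {t : Frame} {j : ℕ} {δ : Set Plane} (h : Tri t j δ) (ht : t.Equilateral) :
    δ.Nonempty := by
  induction h with
  | bot t => exact ht.bot_nonempty
  | cap t => exact ht.cap_nonempty
  | left _ ih => exact ih ht.left
  | right _ ih => exact ih ht.right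
  | top _ ih => exact ih ht.top

/-! ### Lattice coordinates -/

/-- The first coordinate in the basis `e₀`, `e₁`. -/
def ca : Plane →ₗ[ℝ] ℝ where
  toFun p := p 0 / 2 - p 1 / (2 * √3)
  map_add' p q := by simp; ring
  map_smul' c p := by simp; ring

/-- The second coordinate in the basis `e₀`, `e₁`. -/
def cb : Plane →ₗ[ℝ] ℝ where
  toFun p := p 1 / √3
  map_add' p q := by simp; ring
  map_smul' c p := by simp; ring

lemma sqrt_three_ne : (√3 : ℝ) ≠ 0 := by positivity

/-- The point with coordinates a, b in the basis `e₀`, `e₁`, in which the lattices, the domain and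
the cells are all given by linear conditions without √3. -/
def pt (a b : ℝ) : Plane := vec (2 * a + b) (√3 * b)

@[simp] lemma ca_vec (x y : ℝ) : ca (vec x y) = x / 2 - y / (2 * √3) := by simp [ca, vec]
@[simp] lemma cb_vec (x y : ℝ) : cb (vec x y) = y / √3 := by simp [cb, vec]
@[simp] lemma ca_pt (a b : ℝ) : ca (pt a b) = a := by
  have := sqrt_three_ne
  rw [pt, ca_vec]; field_simp; ring
@[simp] lemma cb_pt (a b : ℝ) : cb (pt a b) = b := by
  have := sqrt_three_ne
  rw [pt, cb_vec]; field_simp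

lemma plane_ext_coord {p q : Plane} (ha : ca p = ca q) (hb : cb p = cb q) : p = q := by
  have h3 := sqrt_three_ne
  simp only [ca, cb, LinearMap.coe_mk, AddHom.coe_mk] at ha hb
  have h1 : p 1 = q 1 := by field_simp at hb; exact hb
  have h0 : p 0 = q 0 := by rw [h1] at ha; linarith
  ext i; fin_cases i
  · exact h0
  · exact h1

@[simp] lemma ca_e₀ : ca e₀ = 1 := by simp [e₀]
@[simp] lemma cb_e₀ : cb e₀ = 0 := by simp [e₀]
@[simp] lemma ca_e₁ : ca e₁ = 0 := by
  have := sqrt_three_ne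
  rw [e₁, ca_vec]; field_simp; ring
@[simp] lemma cb_e₁ : cb e₁ = 1 := by simp [e₁]
@[simp] lemma ca_e₂ : ca e₂ = -1 := by
  have := sqrt_three_ne
  rw [e₂, ca_vec]; field_simp; ring
@[simp] lemma cb_e₂ : cb e₂ = 1 := by simp [e₂]

lemma ca_ne : ca ≠ 0 := fun h => by simpa using LinearMap.congr_fun h e₀
lemma cb_ne : cb ≠ 0 := fun h => by simpa using LinearMap.congr_fun h e₁
lemma cs_ne : ca + cb ≠ 0 := fun h => by simpa using LinearMap.congr_fun h e₁

@[fun_prop] lemma continuous_ca : Continuous ca := ca.continuous_of_finiteDimensional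
@[fun_prop] lemma continuous_cb : Continuous cb := cb.continuous_of_finiteDimensional

lemma floor_inv_phi : (⌊1 / phi⌋ : ℝ) = 1 := by
  have h : ⌊1 / phi⌋ = 1 := by
    have h0 := phi_pos
    rw [Int.floor_eq_iff]
    constructor
    · rw [le_div_iff₀ h0]; norm_num; linarith [phi_lt]
    · rw [div_lt_iff₀ h0]; norm_num; linarith [phi_gt]
  rw [h]; norm_num

@[simp] lemma ca_center : ca (center phi) = 1 / 2 := by simp [center]
@[simp] lemma cb_center : cb (center phi) = phi / 2 := by simp [center]; ring

lemma mem_fund_zero (p : Plane) : p ∈ fund phi 0 ↔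
    0 ≤ ca p ∧ ca p ≤ 1 ∧ 0 ≤ cb p ∧ cb p ≤ phi := by
  have h0 := phi_pos
  simp only [fund, parallelogram, mem_ofPred_eq, mem_Icc]
  constructor
  · rintro ⟨α, hα, β, hβ, rfl⟩
    simp
    exact ⟨hα.1, hα.2, mul_nonneg hβ.1 h0.le, mul_le_of_le_one_left h0.le hβ.2⟩
  · rintro ⟨h1, h2, h3, h4⟩
    refine ⟨ca p, ⟨h1, h2⟩, cb p / phi, ⟨by positivity, (div_le_one h0).2 h4⟩, ?_⟩
    apply plane_ext_coord <;> simp; field_simp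

lemma mem_fund_one (p : Plane) : p ∈ fund phi 1 ↔
    0 ≤ cb p ∧ cb p ≤ 1 ∧ -phi ≤ ca p + cb p ∧ ca p + cb p ≤ 0 := by
  have h0 := phi_pos
  simp only [fund, parallelogram, mem_ofPred_eq, mem_Icc]
  constructor
  · rintro ⟨α, hα, β, hβ, rfl⟩
    simp
    exact ⟨hα.1, hα.2, by nlinarith, by nlinarith⟩
  · rintro ⟨h1, h2, h3, h4⟩
    refine ⟨cb p, ⟨h1, h2⟩, -(ca p + cb p) / phi, ⟨div_nonneg (by linarith) h0.le,
      (div_le_one h0).2 (by linarith)⟩, ?_⟩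
    apply plane_ext_coord <;> simp; field_simp; ring

lemma mem_fund_two (p : Plane) : p ∈ fund phi 2 ↔
    0 ≤ ca p ∧ ca p ≤ phi ∧ -1 ≤ ca p + cb p ∧ ca p + cb p ≤ 0 := by
  have h0 := phi_pos
  simp only [fund, parallelogram, mem_ofPred_eq, mem_Icc]
  constructor
  · rintro ⟨α, hα, β, hβ, rfl⟩
    simp
    exact ⟨mul_nonneg hβ.1 h0.le, mul_le_of_le_one_left h0.le hβ.2, by linarith [hα.2], by linarith [hα.1]⟩
  · rintro ⟨h1, h2, h3, h4⟩
    refine ⟨-(ca p + cb p), ⟨by linarith, by linarith⟩, ca p / phi, ⟨by positivity,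
      (div_le_one h0).2 h2⟩, ?_⟩
    apply plane_ext_coord <;> simp <;> field_simp; ring

lemma mem_domainX (p : Plane) : p ∈ domainX phi ↔
    -1 / 2 ≤ ca p ∧ ca p ≤ 1 / 2 ∧ -phi / 2 ≤ cb p ∧ cb p ≤ phi / 2 := by
  have h0 := phi_pos
  simp only [domainX, parallelogram, mem_ofPred_eq, mem_Icc]
  constructor
  · rintro ⟨α, hα, β, hβ, rfl⟩
    simp
    exact ⟨by linarith, by linarith, by nlinarith, by nlinarith⟩
  · rintro ⟨h1, h2, h3, h4⟩
    refine ⟨ca p + 1 / 2, ⟨by linarith, by linarith⟩, (cb p + phi / 2) / phi,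
      ⟨div_nonneg (by linarith) h0.le, (div_le_one h0).2 (by linarith)⟩, ?_⟩
    apply plane_ext_coord <;> simp; field_simp; ring

lemma mem_cutPiece (p : Plane) : p ∈ cutPiece phi ↔
    -1 / 2 ≤ ca p ∧ ca p ≤ 1 / 2 - phi ∧ -phi / 2 ≤ cb p ∧ cb p ≤ phi / 2 := by
  have h0 := phi_pos
  have h1 : 0 < 1 - phi := by linarith [phi_lt]
  simp only [cutPiece, parallelogram, mem_ofPred_eq, mem_Icc, floor_inv_phi]
  constructor
  · rintro ⟨α, hα, β, hβ, rfl⟩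
    simp
    exact ⟨by nlinarith, by nlinarith, by nlinarith, by nlinarith⟩
  · rintro ⟨h1, h2, h3, h4⟩
    refine ⟨(cb p + phi / 2) / phi, ⟨div_nonneg (by linarith) h0.le,
      (div_le_one h0).2 (by linarith)⟩, (ca p + 1 / 2) / (1 - phi),
      ⟨div_nonneg (by linarith) (by linarith), (div_le_one (by linarith)).2 (by linarith)⟩, ?_⟩
    apply plane_ext_coord <;> simp <;> field_simp <;> ring

lemma cutPaste_of_mem {p : Plane} (hp : p ∈ cutPiece phi) : cutPaste phi p = p + pt phi 0 := by
  rw [cutPaste, if_pos hp, floor_inv_phi]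
  apply plane_ext_coord <;> simp

lemma cutPaste_of_notMem {p : Plane} (hp : p ∉ cutPiece phi) :
    cutPaste phi p = p + pt (phi - 1) 0 := by
  rw [cutPaste, if_neg hp, floor_inv_phi]
  apply plane_ext_coord <;> simp; ring

lemma mem_lattice_zero {p : Plane} : p ∈ lattice phi 0 ↔
    ∃ m n : ℤ, ca p = -m ∧ cb p = m + n * phi := by
  simp only [lattice, AddSubgroup.mem_closure_pair]
  constructor
  · rintro ⟨m, n, rfl⟩
    exact ⟨m, n, by simp, by simp⟩
  · rintro ⟨m, n, h1, h2⟩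
    exact ⟨m, n, by apply plane_ext_coord <;> simp [h1, h2]⟩

lemma mem_lattice_one {p : Plane} : p ∈ lattice phi 1 ↔
    ∃ m n : ℤ, ca p = n * phi ∧ cb p = m := by
  simp only [lattice, AddSubgroup.mem_closure_pair]
  constructor
  · rintro ⟨m, n, rfl⟩
    exact ⟨m, n, by simp, by simp⟩
  · rintro ⟨m, n, h1, h2⟩
    exact ⟨m, n, by apply plane_ext_coord <;> simp [h1, h2]⟩

lemma mem_lattice_two {p : Plane} : p ∈ lattice phi 2 ↔
    ∃ m n : ℤ, ca p = m - n * phi ∧ cb p = n * phi := by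
  simp only [lattice, AddSubgroup.mem_closure_pair]
  constructor
  · rintro ⟨m, n, rfl⟩
    exact ⟨m, n, by simp [sub_eq_add_neg], by simp⟩
  · rintro ⟨m, n, h1, h2⟩
    exact ⟨m, n, by apply plane_ext_coord <;> simp [h1, h2, sub_eq_add_neg]⟩

lemma int_eq_of_mul_phi {m n : ℤ} (h1 : -phi < m * phi - n * phi) (h2 : m * phi - n * phi < phi) :
    m = n := by
  have h0 := phi_pos
  have h3 : ((m - n : ℤ) : ℝ) < 1 := by push_cast; nlinarith
  have h4 : (-1 : ℝ) < ((m - n : ℤ) : ℝ) := by push_cast; nlinarith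
  have h5 : m - n < 1 := by exact_mod_cast h3
  have h6 : -1 < m - n := by exact_mod_cast h4
  omega

lemma int_eq_of_abs {m n : ℤ} (h1 : -1 < (m : ℝ) - n) (h2 : (m : ℝ) - n < 1) : m = n := by
  have h5 : m - n < 1 := by exact_mod_cast h2
  have h6 : -1 < m - n := by exact_mod_cast h1
  omega

/-- F₁ is a fundamental domain of L₀, and the strict inequalities put q in its interior. For a
competing point, the strip of width φ for `ca + cb` determines n, and then the strip of width 1 for
`cb` determines m. The other two steps work in the same way. -/
lemma latticeStep_zero (m n : ℤ) {p q : Plane} (hp : p ∈ fund phi 0) (hb : 0 < cb q)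
    (hb' : cb q < 1) (hc : -phi < ca q + cb q) (hc' : ca q + cb q < 0) (e1 : ca q = ca p - m)
    (e2 : cb q = cb p + m + n * phi) : latticeStep phi 0 p q := by
  refine ⟨hp, (mem_fund_one q).2 ⟨hb.le, hb'.le, hc.le, hc'.le⟩,
    mem_lattice_zero.2 ⟨m, n, by rw [map_sub, e1]; ring, by rw [map_sub, e2]; ring⟩, ?_⟩
  intro q' hq' hl
  obtain ⟨h1, h2, h3, h4⟩ := (mem_fund_one q').1 hq'
  obtain ⟨m', n', h5, h6⟩ := mem_lattice_zero.1 hl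
  rw [map_sub] at h5 h6
  have hn : n' = n := int_eq_of_mul_phi (by linarith) (by linarith)
  subst hn
  have hm : m' = m := int_eq_of_abs (by linarith) (by linarith)
  subst hm
  exact plane_ext_coord (by linarith) (by linarith)

lemma latticeStep_one (m n : ℤ) {p q : Plane} (hp : p ∈ fund phi 1) (hb : 0 < ca q)
    (hb' : ca q < phi) (hc : -1 < ca q + cb q) (hc' : ca q + cb q < 0) (e1 : ca q = ca p + n * phi)
    (e2 : cb q = cb p + m) : latticeStep phi 1 p q := by
  refine ⟨hp, (mem_fund_two q).2 ⟨hb.le, hb'.le, hc.le, hc'.le⟩,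
    mem_lattice_one.2 ⟨m, n, by rw [map_sub, e1]; ring, by rw [map_sub, e2]; ring⟩, ?_⟩
  intro q' hq' hl
  obtain ⟨h1, h2, h3, h4⟩ := (mem_fund_two q').1 hq'
  obtain ⟨m', n', h5, h6⟩ := mem_lattice_one.1 hl
  rw [map_sub] at h5 h6
  have hn : n' = n := int_eq_of_mul_phi (by linarith) (by linarith)
  subst hn
  have hm : m' = m := int_eq_of_abs (by linarith) (by linarith)
  subst hm
  exact plane_ext_coord (by linarith) (by linarith)

lemma latticeStep_two (m n : ℤ) {p q : Plane} (hp : p ∈ fund phi 2) (hb : 0 < ca q)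
    (hb' : ca q < 1) (hc : 0 < cb q) (hc' : cb q < phi) (e1 : ca q = ca p + m - n * phi)
    (e2 : cb q = cb p + n * phi) : latticeStep phi 2 p q := by
  refine ⟨hp, (mem_fund_zero q).2 ⟨hb.le, hb'.le, hc.le, hc'.le⟩,
    mem_lattice_two.2 ⟨m, n, by rw [map_sub, e1]; ring, by rw [map_sub, e2]; ring⟩, ?_⟩
  intro q' hq' hl
  obtain ⟨h1, h2, h3, h4⟩ := (mem_fund_zero q').1 hq'
  obtain ⟨m', n', h5, h6⟩ := mem_lattice_two.1 hl
  rw [map_sub] at h5 h6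
  have hn : n' = n := int_eq_of_mul_phi (by linarith) (by linarith)
  subst hn
  have hm : m' = m := int_eq_of_abs (by linarith) (by linarith)
  subst hm
  exact plane_ext_coord (by linarith) (by linarith)

/-- The integers are the coefficients of the three successive lattice vectors in the given
generators. The strict inequalities keep the two intermediate points and the endpoint inside their
parallelograms, so that each step is unique. -/
lemma tripleStep_of (m₀ n₀ m₁ n₁ m₂ n₂ : ℤ) {p q : Plane}
    (hp : -1 / 2 ≤ ca p ∧ ca p ≤ 1 / 2 ∧ -phi / 2 ≤ cb p ∧ cb p ≤ phi / 2)
    (h1 : 0 < cb p + phi / 2 + m₀ + n₀ * phi ∧ cb p + phi / 2 + m₀ + n₀ * phi < 1 ∧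
      -phi < ca p + cb p + 1 / 2 + phi / 2 + n₀ * phi ∧
      ca p + cb p + 1 / 2 + phi / 2 + n₀ * phi < 0)
    (h2 : 0 < ca p + 1 / 2 - m₀ + n₁ * phi ∧ ca p + 1 / 2 - m₀ + n₁ * phi < phi ∧
      -1 < ca p + cb p + 1 / 2 + phi / 2 + n₀ * phi + n₁ * phi + m₁ ∧
      ca p + cb p + 1 / 2 + phi / 2 + n₀ * phi + n₁ * phi + m₁ < 0)
    (hq : -1 / 2 < ca q ∧ ca q < 1 / 2 ∧ -phi / 2 < cb q ∧ cb q < phi / 2)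
    (e1 : ca q = ca p - m₀ + n₁ * phi + m₂ - n₂ * phi)
    (e2 : cb q = cb p + m₀ + n₀ * phi + m₁ + n₂ * phi) : tripleStep phi p q := by
  set p₁ := pt (ca p + 1 / 2 - m₀) (cb p + phi / 2 + m₀ + n₀ * phi)
  set p₂ := pt (ca p + 1 / 2 - m₀ + n₁ * phi) (cb p + phi / 2 + m₀ + n₀ * phi + m₁)
  have a1 : ca p₁ = ca p + 1 / 2 - m₀ := ca_pt _ _
  have b1 : cb p₁ = cb p + phi / 2 + m₀ + n₀ * phi := cb_pt _ _
  have a2 : ca p₂ = ca p + 1 / 2 - m₀ + n₁ * phi := ca_pt _ _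
  have b2 : cb p₂ = cb p + phi / 2 + m₀ + n₀ * phi + m₁ := cb_pt _ _
  have s0 : latticeStep phi 0 (p + center phi) p₁ := by
    refine latticeStep_zero m₀ n₀ ((mem_fund_zero _).2 ?_) ?_ ?_ ?_ ?_ ?_ ?_ <;>
      simp only [map_add, ca_center, cb_center, a1, b1]
    · refine ⟨?_, ?_, ?_, ?_⟩ <;> linarith
    all_goals linarith
  have s1 : latticeStep phi 1 p₁ p₂ := by
    refine latticeStep_one m₁ n₁ s0.2.1 ?_ ?_ ?_ ?_ ?_ ?_ <;> simp only [a1, b1, a2, b2]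
        <;> linarith
  refine ⟨p₁, p₂, s0, s1, latticeStep_two m₂ n₂ s1.2.1 ?_ ?_ ?_ ?_ ?_ ?_⟩ <;>
    simp only [map_add, ca_center, cb_center, a2, b2] <;> linarith

/-! ### The open cells on which the map is a translation -/

/-- The numbered cells are moved, the four lettered ones are fixed. `cellL`, `cellC`, `cellR` are
the triangles of X outside A, B, C; `cellB` contains the lower uncovered triangle of B. -/
def cell₁ : Set Plane := {x | phi - 1 / 2 < ca x ∧ -phi / 2 < cb x ∧ ca x + cb x < 1 / 2 - phi / 2}
def cell₂ : Set Plane := {x | ca x < 1 / 2 ∧ cb x < 1 - 3 / 2 * phi ∧ 1 / 2 - phi / 2 < ca x + cb x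
    ∧ ca x + cb x < 3 / 2 * phi - 1 / 2}
def cell₃ : Set Plane := {x | phi - 1 / 2 < ca x ∧ 1 - 3 / 2 * phi < cb x
    ∧ ca x + cb x < 3 / 2 * phi - 1 / 2}
def cell₄ : Set Plane := {x | -phi / 2 < cb x ∧ cb x < 3 / 2 * phi - 1 ∧ ca x < 1 / 2 - phi
    ∧ 3 / 2 * phi - 3 / 2 < ca x + cb x}
def cell₅ : Set Plane := {x | 1 / 2 - phi < ca x ∧ -phi / 2 < cb x ∧ ca x + cb x < phi / 2 - 1 / 2}
def cell₆ : Set Plane := {x | -1 / 2 < ca x ∧ 3 / 2 * phi - 1 < cb x ∧ cb x < phi / 2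
    ∧ ca x + cb x < 5 / 2 * phi - 3 / 2}
def cell₇ : Set Plane := {x | 1 / 2 - phi < ca x ∧ ca x < phi - 1 / 2 ∧ cb x < phi / 2
    ∧ 5 / 2 * phi - 3 / 2 < ca x + cb x}
def cellB : Set Plane := {x | ca x < 1 / 2 - phi ∧ cb x < phi / 2
    ∧ 5 / 2 * phi - 3 / 2 < ca x + cb x}
def cellL : Set Plane := {x | -1 / 2 < ca x ∧ -phi / 2 < cb x ∧ ca x + cb x < 3 / 2 * phi - 3 / 2}
def cellC : Set Plane := {x | ca x < phi - 1 / 2 ∧ cb x < 3 / 2 * phi - 1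
    ∧ phi / 2 - 1 / 2 < ca x + cb x}
def cellR : Set Plane := {x | ca x < 1 / 2 ∧ cb x < phi / 2 ∧ 3 / 2 * phi - 1 / 2 < ca x + cb x}

lemma petStep_of_open {s : Set Plane} (hs : IsOpen s) {d : Plane}
    (h : ∀ x ∈ s, rawStep phi x (x + d)) : ∀ x ∈ s, petStep phi x (x + d) := by
  intro x hx
  rw [petStep, add_sub_cancel_left]
  exact eventually_of_mem (hs.mem_nhds hx) h

lemma rawStep_of {x y p q : Plane} (hp : -1 / 2 ≤ ca p ∧ ca p ≤ 1 / 2 ∧ -phi / 2 ≤ cb p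
    ∧ cb p ≤ phi / 2)
    (hq : -1 / 2 < ca q ∧ ca q < 1 / 2 ∧ -phi / 2 < cb q ∧ cb q < phi / 2)
    (hx : x = cutPaste phi p) (hy : y = cutPaste phi q) (h : tripleStep phi p q) :
    rawStep phi x y :=
  ⟨p, (mem_domainX p).2 hp, q, (mem_domainX q).2 ⟨hq.1.le, hq.2.1.le, hq.2.2.1.le, hq.2.2.2.le⟩,
    hx, hy, h⟩

/-- After cut and paste the seam is the line `ca` = φ - 1/2. Points to its right come from the cut
piece at the left end of X; points to its left come from the rest, as in the next lemma. -/
lemma eq_cutPaste_left {x : Plane} (h1 : phi - 1 / 2 ≤ ca x) (h2 : ca x ≤ 1 / 2)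
    (h3 : -phi / 2 ≤ cb x) (h4 : cb x ≤ phi / 2) :
    x = cutPaste phi (pt (ca x - phi) (cb x)) := by
  rw [cutPaste_of_mem ((mem_cutPiece _).2 (by
    rw [ca_pt, cb_pt]; exact ⟨by linarith, by linarith, h3, h4⟩))]
  apply plane_ext_coord <;> simp

lemma eq_cutPaste_right {x : Plane} (h1 : -1 / 2 < ca x) :
    x = cutPaste phi (pt (ca x - (phi - 1)) (cb x)) := by
  rw [cutPaste_of_notMem (fun h => by
    rw [mem_cutPiece, ca_pt, cb_pt] at h
    linarith [h.2.1])]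
  apply plane_ext_coord <;> simp

lemma rawStep_₁ {x : Plane} (hx : x ∈ cell₁) : rawStep phi x (x + pt (phi - 1) 0) := by
  have g1 := phi_gt
  have g2 := phi_lt
  obtain ⟨h0, h1, h2⟩ := hx
  obtain ⟨p, hp⟩ : ∃ p, p = pt (ca x - phi) (cb x) := ⟨_, rfl⟩
  obtain ⟨q, hq⟩ : ∃ q, q = pt (ca x + (phi - 1) - (phi - 1)) (cb x + 0) := ⟨_, rfl⟩
  have pa : ca p = ca x - phi := by rw [hp, ca_pt]
  have pb : cb p = cb x := by rw [hp, cb_pt]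
  have qa : ca q = ca x + (phi - 1) - (phi - 1) := by rw [hq, ca_pt]
  have qb : cb q = cb x + 0 := by rw [hq, cb_pt]
  have hp' : -1 / 2 ≤ ca p ∧ ca p ≤ 1 / 2 ∧ -phi / 2 ≤ cb p ∧ cb p ≤ phi / 2 := by
    rw [pa, pb]; clear pa pb qa qb; refine ⟨?_, ?_, ?_, ?_⟩ <;> linarith
  have hq' : -1 / 2 < ca q ∧ ca q < 1 / 2 ∧ -phi / 2 < cb q ∧ cb q < phi / 2 := by
    rw [qa, qb]; clear pa pb qa qb hp'; refine ⟨?_, ?_, ?_, ?_⟩ <;> linarith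
  -- The six integers are the lattice coefficients of the itinerary of this cell; the remaining
  -- goals check them by linear inequalities. The other cells differ only in these data and in the
  -- side of the seam.
  refine rawStep_of hp' hq'
      (by rw [hp]; exact eq_cutPaste_left (by linarith) (by linarith) (by linarith) (by linarith)) ?_ (tripleStep_of (1) (-1) (-1) (2) (1) (1) hp' ?_ ?_ hq' ?_ ?_)
  · rw [hq]
    convert eq_cutPaste_right (x := x + pt (phi - 1) 0) (by simp; linarith) using 3 <;> simp
  all_goals simp only [pa, pb, qa, qb]; push_cast; clear hp' hq' pa pb qa qb
  · refine ⟨?_, ?_, ?_, ?_⟩ <;> linarith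
  · refine ⟨?_, ?_, ?_, ?_⟩ <;> linarith
  · ring
  · ring

lemma rawStep_₂ {x : Plane} (hx : x ∈ cell₂) : rawStep phi x (x + pt (-phi) (2 * phi - 1)) := by
  have g1 := phi_gt
  have g2 := phi_lt
  obtain ⟨h0, h1, h2, h3⟩ := hx
  obtain ⟨p, hp⟩ : ∃ p, p = pt (ca x - phi) (cb x) := ⟨_, rfl⟩
  obtain ⟨q, hq⟩ : ∃ q, q = pt (ca x + (-phi) - (phi - 1)) (cb x + (2 * phi - 1)) := ⟨_, rfl⟩
  have pa : ca p = ca x - phi := by rw [hp, ca_pt]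
  have pb : cb p = cb x := by rw [hp, cb_pt]
  have qa : ca q = ca x + (-phi) - (phi - 1) := by rw [hq, ca_pt]
  have qb : cb q = cb x + (2 * phi - 1) := by rw [hq, cb_pt]
  have hp' : -1 / 2 ≤ ca p ∧ ca p ≤ 1 / 2 ∧ -phi / 2 ≤ cb p ∧ cb p ≤ phi / 2 := by
    rw [pa, pb]; clear pa pb qa qb; refine ⟨?_, ?_, ?_, ?_⟩ <;> linarith
  have hq' : -1 / 2 < ca q ∧ ca q < 1 / 2 ∧ -phi / 2 < cb q ∧ cb q < phi / 2 := by
    rw [qa, qb]; clear pa pb qa qb hp'; refine ⟨?_, ?_, ?_, ?_⟩ <;> linarith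
  refine rawStep_of hp' hq'
      (by rw [hp]; exact eq_cutPaste_left (by linarith) (by linarith) (by linarith) (by linarith)) ?_ (tripleStep_of (1) (-1) (-2) (2) (2) (3) hp' ?_ ?_ hq' ?_ ?_)
  · rw [hq]
    convert eq_cutPaste_right (x := x + pt (-phi) (2 * phi - 1)) (by simp; linarith) using 3
        <;> simp
  all_goals simp only [pa, pb, qa, qb]; push_cast; clear hp' hq' pa pb qa qb
  · refine ⟨?_, ?_, ?_, ?_⟩ <;> linarith
  · refine ⟨?_, ?_, ?_, ?_⟩ <;> linarith
  · ring
  · ring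

lemma rawStep_₃ {x : Plane} (hx : x ∈ cell₃) : rawStep phi x (x + pt 0 (phi - 1)) := by
  have g1 := phi_gt
  have g2 := phi_lt
  obtain ⟨h0, h1, h2⟩ := hx
  obtain ⟨p, hp⟩ : ∃ p, p = pt (ca x - phi) (cb x) := ⟨_, rfl⟩
  obtain ⟨q, hq⟩ : ∃ q, q = pt (ca x + 0 - phi) (cb x + (phi - 1)) := ⟨_, rfl⟩
  have pa : ca p = ca x - phi := by rw [hp, ca_pt]
  have pb : cb p = cb x := by rw [hp, cb_pt]
  have qa : ca q = ca x + 0 - phi := by rw [hq, ca_pt]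
  have qb : cb q = cb x + (phi - 1) := by rw [hq, cb_pt]
  have hp' : -1 / 2 ≤ ca p ∧ ca p ≤ 1 / 2 ∧ -phi / 2 ≤ cb p ∧ cb p ≤ phi / 2 := by
    rw [pa, pb]; clear pa pb qa qb; refine ⟨?_, ?_, ?_, ?_⟩ <;> linarith
  have hq' : -1 / 2 < ca q ∧ ca q < 1 / 2 ∧ -phi / 2 < cb q ∧ cb q < phi / 2 := by
    rw [qa, qb]; clear pa pb qa qb hp'; refine ⟨?_, ?_, ?_, ?_⟩ <;> linarith
  refine rawStep_of hp' hq'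
      (by rw [hp]; exact eq_cutPaste_left (by linarith) (by linarith) (by linarith) (by linarith)) ?_ (tripleStep_of (1) (-1) (-2) (2) (1) (2) hp' ?_ ?_ hq' ?_ ?_)
  · rw [hq]
    convert eq_cutPaste_left (x := x + pt 0 (phi - 1)) (by simp; linarith) (by simp; linarith)
        (by simp; linarith) (by simp; linarith) using 3 <;> simp
  all_goals simp only [pa, pb, qa, qb]; push_cast; clear hp' hq' pa pb qa qb
  · refine ⟨?_, ?_, ?_, ?_⟩ <;> linarith
  · refine ⟨?_, ?_, ?_, ?_⟩ <;> linarith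
  · ring
  · ring

lemma rawStep_₄ {x : Plane} (hx : x ∈ cell₄) : rawStep phi x (x + pt phi 0) := by
  have g1 := phi_gt
  have g2 := phi_lt
  obtain ⟨h0, h1, h2, h3⟩ := hx
  obtain ⟨p, hp⟩ : ∃ p, p = pt (ca x - (phi - 1)) (cb x) := ⟨_, rfl⟩
  obtain ⟨q, hq⟩ : ∃ q, q = pt (ca x + phi - phi) (cb x + 0) := ⟨_, rfl⟩
  have pa : ca p = ca x - (phi - 1) := by rw [hp, ca_pt]
  have pb : cb p = cb x := by rw [hp, cb_pt]
  have qa : ca q = ca x + phi - phi := by rw [hq, ca_pt]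
  have qb : cb q = cb x + 0 := by rw [hq, cb_pt]
  have hp' : -1 / 2 ≤ ca p ∧ ca p ≤ 1 / 2 ∧ -phi / 2 ≤ cb p ∧ cb p ≤ phi / 2 := by
    rw [pa, pb]; clear pa pb qa qb; refine ⟨?_, ?_, ?_, ?_⟩ <;> linarith
  have hq' : -1 / 2 < ca q ∧ ca q < 1 / 2 ∧ -phi / 2 < cb q ∧ cb q < phi / 2 := by
    rw [qa, qb]; clear pa pb qa qb hp'; refine ⟨?_, ?_, ?_, ?_⟩ <;> linarith
  refine rawStep_of hp' hq' (by rw [hp]; exact eq_cutPaste_right (by linarith)) ?_ (tripleStep_of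
      (2) (-2) (-2) (3) (1) (2) hp' ?_ ?_ hq' ?_ ?_)
  · rw [hq]
    convert eq_cutPaste_left (x := x + pt phi 0) (by simp; linarith) (by simp; linarith)
        (by simp; linarith) (by simp; linarith) using 3 <;> simp
  all_goals simp only [pa, pb, qa, qb]; push_cast; clear hp' hq' pa pb qa qb
  · refine ⟨?_, ?_, ?_, ?_⟩ <;> linarith
  · refine ⟨?_, ?_, ?_, ?_⟩ <;> linarith
  · ring
  · ring

lemma rawStep_₅ {x : Plane} (hx : x ∈ cell₅) : rawStep phi x (x + pt (phi - 1) (1 - phi)) := by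
  have g1 := phi_gt
  have g2 := phi_lt
  obtain ⟨h0, h1, h2⟩ := hx
  obtain ⟨p, hp⟩ : ∃ p, p = pt (ca x - (phi - 1)) (cb x) := ⟨_, rfl⟩
  obtain ⟨q, hq⟩ : ∃ q, q = pt (ca x + (phi - 1) - (phi - 1)) (cb x + (1 - phi)) := ⟨_, rfl⟩
  have pa : ca p = ca x - (phi - 1) := by rw [hp, ca_pt]
  have pb : cb p = cb x := by rw [hp, cb_pt]
  have qa : ca q = ca x + (phi - 1) - (phi - 1) := by rw [hq, ca_pt]
  have qb : cb q = cb x + (1 - phi) := by rw [hq, cb_pt]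
  have hp' : -1 / 2 ≤ ca p ∧ ca p ≤ 1 / 2 ∧ -phi / 2 ≤ cb p ∧ cb p ≤ phi / 2 := by
    rw [pa, pb]; clear pa pb qa qb; refine ⟨?_, ?_, ?_, ?_⟩ <;> linarith
  have hq' : -1 / 2 < ca q ∧ ca q < 1 / 2 ∧ -phi / 2 < cb q ∧ cb q < phi / 2 := by
    rw [qa, qb]; clear pa pb qa qb hp'; refine ⟨?_, ?_, ?_, ?_⟩ <;> linarith
  refine rawStep_of hp' hq' (by rw [hp]; exact eq_cutPaste_right (by linarith)) ?_ (tripleStep_of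
      (2) (-2) (-1) (2) (1) (1) hp' ?_ ?_ hq' ?_ ?_)
  · rw [hq]
    convert eq_cutPaste_right (x := x + pt (phi - 1) (1 - phi)) (by simp; linarith) using 3 <;> simp
  all_goals simp only [pa, pb, qa, qb]; push_cast; clear hp' hq' pa pb qa qb
  · refine ⟨?_, ?_, ?_, ?_⟩ <;> linarith
  · refine ⟨?_, ?_, ?_, ?_⟩ <;> linarith
  · ring
  · ring

/-- The cell is split by the segment whose image lies on the seam: there the endpoint before pasting
is on a side of X and the last lattice step has two candidates. Both halves have the same
translation, but m₂ differs by one. -/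
lemma rawStep_₆_left {x : Plane} (hx : x ∈ cell₆) (hs : ca x < 2 * phi - 3 / 2) : rawStep phi x
    (x + pt (1 - phi) 0) := by
  have g1 := phi_gt
  have g2 := phi_lt
  obtain ⟨h0, h1, h2, h3⟩ := hx
  obtain ⟨p, hp⟩ : ∃ p, p = pt (ca x - (phi - 1)) (cb x) := ⟨_, rfl⟩
  obtain ⟨q, hq⟩ : ∃ q, q = pt (ca x + (1 - phi) - (phi - 1)) (cb x + 0) := ⟨_, rfl⟩
  have pa : ca p = ca x - (phi - 1) := by rw [hp, ca_pt]
  have pb : cb p = cb x := by rw [hp, cb_pt]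
  have qa : ca q = ca x + (1 - phi) - (phi - 1) := by rw [hq, ca_pt]
  have qb : cb q = cb x + 0 := by rw [hq, cb_pt]
  have hp' : -1 / 2 ≤ ca p ∧ ca p ≤ 1 / 2 ∧ -phi / 2 ≤ cb p ∧ cb p ≤ phi / 2 := by
    rw [pa, pb]; clear pa pb qa qb; refine ⟨?_, ?_, ?_, ?_⟩ <;> linarith
  have hq' : -1 / 2 < ca q ∧ ca q < 1 / 2 ∧ -phi / 2 < cb q ∧ cb q < phi / 2 := by
    rw [qa, qb]; clear pa pb qa qb hp'; refine ⟨?_, ?_, ?_, ?_⟩ <;> linarith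
  refine rawStep_of hp' hq' (by rw [hp]; exact eq_cutPaste_right (by linarith)) ?_ (tripleStep_of
      (1) (-2) (-1) (1) (2) (2) hp' ?_ ?_ hq' ?_ ?_)
  · rw [hq]
    convert eq_cutPaste_right (x := x + pt (1 - phi) 0) (by simp; linarith) using 3 <;> simp
  all_goals simp only [pa, pb, qa, qb]; push_cast; clear hp' hq' pa pb qa qb
  · refine ⟨?_, ?_, ?_, ?_⟩ <;> linarith
  · refine ⟨?_, ?_, ?_, ?_⟩ <;> linarith
  · ring
  · ring

lemma rawStep_₆_right {x : Plane} (hx : x ∈ cell₆) (hs : 2 * phi - 3 / 2 < ca x) : rawStep phi x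
    (x + pt (1 - phi) 0) := by
  have g1 := phi_gt
  have g2 := phi_lt
  obtain ⟨h0, h1, h2, h3⟩ := hx
  obtain ⟨p, hp⟩ : ∃ p, p = pt (ca x - (phi - 1)) (cb x) := ⟨_, rfl⟩
  obtain ⟨q, hq⟩ : ∃ q, q = pt (ca x + (1 - phi) - phi) (cb x + 0) := ⟨_, rfl⟩
  have pa : ca p = ca x - (phi - 1) := by rw [hp, ca_pt]
  have pb : cb p = cb x := by rw [hp, cb_pt]
  have qa : ca q = ca x + (1 - phi) - phi := by rw [hq, ca_pt]
  have qb : cb q = cb x + 0 := by rw [hq, cb_pt]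
  have hp' : -1 / 2 ≤ ca p ∧ ca p ≤ 1 / 2 ∧ -phi / 2 ≤ cb p ∧ cb p ≤ phi / 2 := by
    rw [pa, pb]; clear pa pb qa qb; refine ⟨?_, ?_, ?_, ?_⟩ <;> linarith
  have hq' : -1 / 2 < ca q ∧ ca q < 1 / 2 ∧ -phi / 2 < cb q ∧ cb q < phi / 2 := by
    rw [qa, qb]; clear pa pb qa qb hp'; refine ⟨?_, ?_, ?_, ?_⟩ <;> linarith
  refine rawStep_of hp' hq' (by rw [hp]; exact eq_cutPaste_right (by linarith)) ?_ (tripleStep_of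
      (1) (-2) (-1) (1) (1) (2) hp' ?_ ?_ hq' ?_ ?_)
  · rw [hq]
    convert eq_cutPaste_left (x := x + pt (1 - phi) 0) (by simp; linarith) (by simp; linarith)
        (by simp; linarith) (by simp; linarith) using 3 <;> simp
  all_goals simp only [pa, pb, qa, qb]; push_cast; clear hp' hq' pa pb qa qb
  · refine ⟨?_, ?_, ?_, ?_⟩ <;> linarith
  · refine ⟨?_, ?_, ?_, ?_⟩ <;> linarith
  · ring
  · ring

lemma rawStep_₇ {x : Plane} (hx : x ∈ cell₇) : rawStep phi x (x + pt (phi - 1) (1 - 2 * phi)) := by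
  have g1 := phi_gt
  have g2 := phi_lt
  obtain ⟨h0, h1, h2, h3⟩ := hx
  obtain ⟨p, hp⟩ : ∃ p, p = pt (ca x - (phi - 1)) (cb x) := ⟨_, rfl⟩
  obtain ⟨q, hq⟩ : ∃ q, q = pt (ca x + (phi - 1) - (phi - 1)) (cb x + (1 - 2 * phi)) := ⟨_, rfl⟩
  have pa : ca p = ca x - (phi - 1) := by rw [hp, ca_pt]
  have pb : cb p = cb x := by rw [hp, cb_pt]
  have qa : ca q = ca x + (phi - 1) - (phi - 1) := by rw [hq, ca_pt]
  have qb : cb q = cb x + (1 - 2 * phi) := by rw [hq, cb_pt]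
  have hp' : -1 / 2 ≤ ca p ∧ ca p ≤ 1 / 2 ∧ -phi / 2 ≤ cb p ∧ cb p ≤ phi / 2 := by
    rw [pa, pb]; clear pa pb qa qb; refine ⟨?_, ?_, ?_, ?_⟩ <;> linarith
  have hq' : -1 / 2 < ca q ∧ ca q < 1 / 2 ∧ -phi / 2 < cb q ∧ cb q < phi / 2 := by
    rw [qa, qb]; clear pa pb qa qb hp'; refine ⟨?_, ?_, ?_, ?_⟩ <;> linarith
  refine rawStep_of hp' hq' (by rw [hp]; exact eq_cutPaste_right (by linarith)) ?_ (tripleStep_of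
      (2) (-3) (-1) (2) (1) (1) hp' ?_ ?_ hq' ?_ ?_)
  · rw [hq]
    convert eq_cutPaste_right (x := x + pt (phi - 1) (1 - 2 * phi)) (by simp; linarith) using 3
        <;> simp
  all_goals simp only [pa, pb, qa, qb]; push_cast; clear hp' hq' pa pb qa qb
  · refine ⟨?_, ?_, ?_, ?_⟩ <;> linarith
  · refine ⟨?_, ?_, ?_, ?_⟩ <;> linarith
  · ring
  · ring

lemma rawStep_B {x : Plane} (hx : x ∈ cellB) : rawStep phi x (x + pt 0 0) := by
  have g1 := phi_gt
  have g2 := phi_lt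
  obtain ⟨h0, h1, h2⟩ := hx
  obtain ⟨p, hp⟩ : ∃ p, p = pt (ca x - (phi - 1)) (cb x) := ⟨_, rfl⟩
  obtain ⟨q, hq⟩ : ∃ q, q = pt (ca x + 0 - (phi - 1)) (cb x + 0) := ⟨_, rfl⟩
  have pa : ca p = ca x - (phi - 1) := by rw [hp, ca_pt]
  have pb : cb p = cb x := by rw [hp, cb_pt]
  have qa : ca q = ca x + 0 - (phi - 1) := by rw [hq, ca_pt]
  have qb : cb q = cb x + 0 := by rw [hq, cb_pt]
  have hp' : -1 / 2 ≤ ca p ∧ ca p ≤ 1 / 2 ∧ -phi / 2 ≤ cb p ∧ cb p ≤ phi / 2 := by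
    rw [pa, pb]; clear pa pb qa qb; refine ⟨?_, ?_, ?_, ?_⟩ <;> linarith
  have hq' : -1 / 2 < ca q ∧ ca q < 1 / 2 ∧ -phi / 2 < cb q ∧ cb q < phi / 2 := by
    rw [qa, qb]; clear pa pb qa qb hp'; refine ⟨?_, ?_, ?_, ?_⟩ <;> linarith
  refine rawStep_of hp' hq' (by rw [hp]; exact eq_cutPaste_right (by linarith)) ?_ (tripleStep_of
      (2) (-3) (-2) (3) (2) (3) hp' ?_ ?_ hq' ?_ ?_)
  · rw [hq]
    convert eq_cutPaste_right (x := x + pt 0 0) (by simp; linarith) using 3 <;> simp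
  all_goals simp only [pa, pb, qa, qb]; push_cast; clear hp' hq' pa pb qa qb
  · refine ⟨?_, ?_, ?_, ?_⟩ <;> linarith
  · refine ⟨?_, ?_, ?_, ?_⟩ <;> linarith
  · ring
  · ring

lemma rawStep_L {x : Plane} (hx : x ∈ cellL) : rawStep phi x (x + pt 0 0) := by
  have g1 := phi_gt
  have g2 := phi_lt
  obtain ⟨h0, h1, h2⟩ := hx
  obtain ⟨p, hp⟩ : ∃ p, p = pt (ca x - (phi - 1)) (cb x) := ⟨_, rfl⟩
  obtain ⟨q, hq⟩ : ∃ q, q = pt (ca x + 0 - (phi - 1)) (cb x + 0) := ⟨_, rfl⟩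
  have pa : ca p = ca x - (phi - 1) := by rw [hp, ca_pt]
  have pb : cb p = cb x := by rw [hp, cb_pt]
  have qa : ca q = ca x + 0 - (phi - 1) := by rw [hq, ca_pt]
  have qb : cb q = cb x + 0 := by rw [hq, cb_pt]
  have hp' : -1 / 2 ≤ ca p ∧ ca p ≤ 1 / 2 ∧ -phi / 2 ≤ cb p ∧ cb p ≤ phi / 2 := by
    rw [pa, pb]; clear pa pb qa qb; refine ⟨?_, ?_, ?_, ?_⟩ <;> linarith
  have hq' : -1 / 2 < ca q ∧ ca q < 1 / 2 ∧ -phi / 2 < cb q ∧ cb q < phi / 2 := by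
    rw [qa, qb]; clear pa pb qa qb hp'; refine ⟨?_, ?_, ?_, ?_⟩ <;> linarith
  refine rawStep_of hp' hq' (by rw [hp]; exact eq_cutPaste_right (by linarith)) ?_ (tripleStep_of
      (1) (-1) (-1) (1) (1) (1) hp' ?_ ?_ hq' ?_ ?_)
  · rw [hq]
    convert eq_cutPaste_right (x := x + pt 0 0) (by simp; linarith) using 3 <;> simp
  all_goals simp only [pa, pb, qa, qb]; push_cast; clear hp' hq' pa pb qa qb
  · refine ⟨?_, ?_, ?_, ?_⟩ <;> linarith
  · refine ⟨?_, ?_, ?_, ?_⟩ <;> linarith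
  · ring
  · ring

lemma rawStep_C {x : Plane} (hx : x ∈ cellC) : rawStep phi x (x + pt 0 0) := by
  have g1 := phi_gt
  have g2 := phi_lt
  obtain ⟨h0, h1, h2⟩ := hx
  obtain ⟨p, hp⟩ : ∃ p, p = pt (ca x - (phi - 1)) (cb x) := ⟨_, rfl⟩
  obtain ⟨q, hq⟩ : ∃ q, q = pt (ca x + 0 - (phi - 1)) (cb x + 0) := ⟨_, rfl⟩
  have pa : ca p = ca x - (phi - 1) := by rw [hp, ca_pt]
  have pb : cb p = cb x := by rw [hp, cb_pt]
  have qa : ca q = ca x + 0 - (phi - 1) := by rw [hq, ca_pt]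
  have qb : cb q = cb x + 0 := by rw [hq, cb_pt]
  have hp' : -1 / 2 ≤ ca p ∧ ca p ≤ 1 / 2 ∧ -phi / 2 ≤ cb p ∧ cb p ≤ phi / 2 := by
    rw [pa, pb]; clear pa pb qa qb; refine ⟨?_, ?_, ?_, ?_⟩ <;> linarith
  have hq' : -1 / 2 < ca q ∧ ca q < 1 / 2 ∧ -phi / 2 < cb q ∧ cb q < phi / 2 := by
    rw [qa, qb]; clear pa pb qa qb hp'; refine ⟨?_, ?_, ?_, ?_⟩ <;> linarith
  refine rawStep_of hp' hq' (by rw [hp]; exact eq_cutPaste_right (by linarith)) ?_ (tripleStep_of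
      (2) (-2) (-2) (2) (2) (2) hp' ?_ ?_ hq' ?_ ?_)
  · rw [hq]
    convert eq_cutPaste_right (x := x + pt 0 0) (by simp; linarith) using 3 <;> simp
  all_goals simp only [pa, pb, qa, qb]; push_cast; clear hp' hq' pa pb qa qb
  · refine ⟨?_, ?_, ?_, ?_⟩ <;> linarith
  · refine ⟨?_, ?_, ?_, ?_⟩ <;> linarith
  · ring
  · ring

lemma rawStep_R {x : Plane} (hx : x ∈ cellR) : rawStep phi x (x + pt 0 0) := by
  have g1 := phi_gt
  have g2 := phi_lt
  obtain ⟨h0, h1, h2⟩ := hx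
  obtain ⟨p, hp⟩ : ∃ p, p = pt (ca x - phi) (cb x) := ⟨_, rfl⟩
  obtain ⟨q, hq⟩ : ∃ q, q = pt (ca x + 0 - phi) (cb x + 0) := ⟨_, rfl⟩
  have pa : ca p = ca x - phi := by rw [hp, ca_pt]
  have pb : cb p = cb x := by rw [hp, cb_pt]
  have qa : ca q = ca x + 0 - phi := by rw [hq, ca_pt]
  have qb : cb q = cb x + 0 := by rw [hq, cb_pt]
  have hp' : -1 / 2 ≤ ca p ∧ ca p ≤ 1 / 2 ∧ -phi / 2 ≤ cb p ∧ cb p ≤ phi / 2 := by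
    rw [pa, pb]; clear pa pb qa qb; refine ⟨?_, ?_, ?_, ?_⟩ <;> linarith
  have hq' : -1 / 2 < ca q ∧ ca q < 1 / 2 ∧ -phi / 2 < cb q ∧ cb q < phi / 2 := by
    rw [qa, qb]; clear pa pb qa qb hp'; refine ⟨?_, ?_, ?_, ?_⟩ <;> linarith
  refine rawStep_of hp' hq'
      (by rw [hp]; exact eq_cutPaste_left (by linarith) (by linarith) (by linarith) (by linarith)) ?_ (tripleStep_of (1) (-2) (-1) (2) (1) (2) hp' ?_ ?_ hq' ?_ ?_)
  · rw [hq]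
    convert eq_cutPaste_left (x := x + pt 0 0) (by simp; linarith) (by simp; linarith)
        (by simp; linarith) (by simp; linarith) using 3 <;> simp
  all_goals simp only [pa, pb, qa, qb]; push_cast; clear hp' hq' pa pb qa qb
  · refine ⟨?_, ?_, ?_, ?_⟩ <;> linarith
  · refine ⟨?_, ?_, ?_, ?_⟩ <;> linarith
  · ring
  · ring

/-! ### The fundamental frames -/

/-- The frame with given lattice coordinates. -/
def fr (a b c d e f : ℝ) (k : ℕ) : Frame := ⟨pt a b, pt c d, pt e f, k⟩

lemma fr_congr {a b c d e f a' b' c' d' e' f' : ℝ} (k : ℕ) (h₁ : a = a') (h₂ : b = b')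
    (h₃ : c = c') (h₄ : d = d') (h₅ : e = e') (h₆ : f = f') :
    fr a b c d e f k = fr a' b' c' d' e' f' k := by
  subst h₁ h₂ h₃ h₄ h₅ h₆; rfl

section
variable (a b c d e f : ℝ) (k : ℕ)

lemma fr_left : (fr a b c d e f k).left =
    fr a b (phi * e) (phi * f) (phi * c) (phi * d) (k + 1) := by
  simp only [fr, Frame.left, Frame.mk.injEq, and_true, true_and]
  refine ⟨?_, ?_⟩ <;> apply plane_ext_coord <;> simp

lemma fr_right : (fr a b c d e f k).right =
    fr (a + c) (b + d) (phi * (e - c)) (phi * (f - d)) (-(phi * c)) (-(phi * d)) (k + 1) := by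
  simp only [fr, Frame.right, Frame.mk.injEq, and_true]
  refine ⟨?_, ?_, ?_⟩ <;> apply plane_ext_coord <;> simp

lemma fr_mirror : (fr a b c d e f k).mirror = fr (a + c) (b + d) (-c) (-d) (e - c) (f - d) k := by
  simp only [fr, Frame.mirror, Frame.mk.injEq, and_true]
  refine ⟨?_, ?_, ?_⟩ <;> apply plane_ext_coord <;> simp

lemma fr_inner : (fr a b c d e f k).inner = fr (a + phi * e) (b + phi * f) (phi * (c - e))
    (phi * (d - f)) (phi * c) (phi * d) (k + 1) := by
  simp only [fr, Frame.inner, Frame.mk.injEq, and_true]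
  refine ⟨?_, ?_, ?_⟩ <;> apply plane_ext_coord <;> simp

lemma fr_turn : (fr a b c d e f k).turn = fr a b (c - e) (d - f) c d k := by
  simp only [fr, Frame.turn, Frame.mk.injEq, and_true, true_and]
  apply plane_ext_coord <;> simp

end

/-- Lattice coordinates of the trapezoids A, B, C, as `trapA_eq`, `trapB_eq`, `trapC_eq` verify. The
coordinates of the subframes below all reduce by φ² = 1 - φ. -/
def fA : Frame := fr (-1 / 2) (1 / 2 * phi) phi (-phi) 0 (-phi) 0
def fB : Frame := fA.turn
def fC : Frame := fr (-1 / 2 + phi) (1 / 2 * phi) 0 (-phi) phi (-phi) 0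

lemma fB_eq : fB = fr (-1 / 2) (1 / 2 * phi) phi 0 phi (-phi) 0 := by
  rw [fB, fA, fr_turn]
  apply fr_congr <;> ring

lemma fC_right : fC.right = fr (-1 / 2 + phi) (-1 / 2 * phi) (1 - phi) 0 0 (1 - phi) 1 := by
  have h := phi_sq
  rw [fC, fr_right]
  apply fr_congr <;> grind

lemma fA_right : fA.right = fr (-1 / 2 + phi) (-1 / 2 * phi) (-1 + phi) 0 (-1 + phi)
    (1 - phi) 1 := by
  have h := phi_sq
  rw [fA, fr_right]
  apply fr_congr <;> grind

lemma fC_mirror_inner : fC.mirror.inner = fr (1 / 2) (-1 / 2 * phi) (-1 + phi) (1 - phi) 0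
    (1 - phi) 1 := by
  have h := phi_sq
  rw [fC, fr_mirror, fr_inner]
  apply fr_congr <;> grind

lemma fB_left : fB.left = fr (-1 / 2) (1 / 2 * phi) (1 - phi) (-1 + phi) (1 - phi) 0 1 := by
  have h := phi_sq
  rw [fB_eq, fr_left]
  apply fr_congr <;> grind

lemma fC_left : fC.left = fr (-1 / 2 + phi) (1 / 2 * phi) (1 - phi) (-1 + phi) 0 (-1 + phi) 1 := by
  have h := phi_sq
  rw [fC, fr_left]
  apply fr_congr <;> grind

lemma fC_left_left : fC.left.left = fr (-1 / 2 + phi) (1 / 2 * phi) 0 (1 - 2 * phi) (-1 + 2 * phi)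
    (1 - 2 * phi) 2 := by
  have h := phi_sq
  rw [fC_left, fr_left]
  apply fr_congr <;> grind

lemma fC_right_left : fC.right.left = fr (-1 / 2 + phi) (-1 / 2 * phi) 0 (-1 + 2 * phi)
    (-1 + 2 * phi) 0 2 := by
  have h := phi_sq
  rw [fC_right, fr_left]
  apply fr_congr <;> grind

lemma fA_inner : fA.inner = fr (-1 / 2) (-1 + 3 / 2 * phi) (1 - phi) 0 (1 - phi) (-1 + phi) 1 := by
  have h := phi_sq
  rw [fA, fr_inner]
  apply fr_congr <;> grind

lemma fC_inner : fC.inner = fr (1 / 2) (-1 + 3 / 2 * phi) (-1 + phi) 0 0 (-1 + phi) 1 := by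
  have h := phi_sq
  rw [fC, fr_inner]
  apply fr_congr <;> grind

lemma fA_right_left : fA.right.left = fr (-1 / 2 + phi) (-1 / 2 * phi) (1 - 2 * phi) (-1 + 2 * phi)
    (1 - 2 * phi) 0 2 := by
  have h := phi_sq
  rw [fA_right, fr_left]
  apply fr_congr <;> grind

lemma fA_left : fA.left = fr (-1 / 2) (1 / 2 * phi) 0 (-1 + phi) (1 - phi) (-1 + phi) 1 := by
  have h := phi_sq
  rw [fA, fr_left]
  apply fr_congr <;> grind

lemma fA_left_left : fA.left.left = fr (-1 / 2) (1 / 2 * phi) (-1 + 2 * phi) (1 - 2 * phi) 0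
    (1 - 2 * phi) 2 := by
  have h := phi_sq
  rw [fA_left, fr_left]
  apply fr_congr <;> grind

lemma fB_inner : fB.inner = fr (1 / 2 - phi) (-1 + 3 / 2 * phi) 0 (1 - phi) (1 - phi) 0 1 := by
  have h := phi_sq
  rw [fB_eq, fr_inner]
  apply fr_congr <;> grind

lemma fB_left_left : fB.left.left = fr (-1 / 2) (1 / 2 * phi) (-1 + 2 * phi) 0 (-1 + 2 * phi)
    (1 - 2 * phi) 2 := by
  have h := phi_sq
  rw [fB_left, fr_left]
  apply fr_congr <;> grind

lemma fB_right : fB.right = fr (-1 / 2 + phi) (1 / 2 * phi) 0 (-1 + phi) (-1 + phi) 0 1 := by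
  have h := phi_sq
  rw [fB_eq, fr_right]
  apply fr_congr <;> grind

lemma fB_right_left : fB.right.left = fr (-1 / 2 + phi) (1 / 2 * phi) (1 - 2 * phi) 0 0
    (1 - 2 * phi) 2 := by
  have h := phi_sq
  rw [fB_right, fr_left]
  apply fr_congr <;> grind

lemma fB_mirror_inner : fB.mirror.inner = fr (-1 / 2 + phi) (-1 + 3 / 2 * phi) (-1 + phi) (1 - phi)
    (-1 + phi) 0 1 := by
  have h := phi_sq
  rw [fB_eq, fr_mirror, fr_inner]
  apply fr_congr <;> grind

lemma fA_mirror_inner : fA.mirror.inner = fr (-3 / 2 + 2 * phi) (-1 / 2 * phi) 0 (1 - phi)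
    (-1 + phi) (1 - phi) 1 := by
  have h := phi_sq
  rw [fA, fr_mirror, fr_inner]
  apply fr_congr <;> grind

/-! ### The map on the open cells -/

lemma isOpen_cell₁ : IsOpen cell₁ := by
  simp only [cell₁, Set.ofPred_and]
  refine (isOpen_lt ?_ ?_).inter ((isOpen_lt ?_ ?_).inter (isOpen_lt ?_ ?_)) <;> fun_prop

lemma isOpen_cell₂ : IsOpen cell₂ := by
  simp only [cell₂, Set.ofPred_and]
  refine (isOpen_lt ?_ ?_).inter ((isOpen_lt ?_ ?_).inter ((isOpen_lt ?_ ?_).inter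
      (isOpen_lt ?_ ?_))) <;> fun_prop

lemma isOpen_cell₃ : IsOpen cell₃ := by
  simp only [cell₃, Set.ofPred_and]
  refine (isOpen_lt ?_ ?_).inter ((isOpen_lt ?_ ?_).inter (isOpen_lt ?_ ?_)) <;> fun_prop

lemma isOpen_cell₄ : IsOpen cell₄ := by
  simp only [cell₄, Set.ofPred_and]
  refine (isOpen_lt ?_ ?_).inter ((isOpen_lt ?_ ?_).inter ((isOpen_lt ?_ ?_).inter
      (isOpen_lt ?_ ?_))) <;> fun_prop

lemma isOpen_cell₅ : IsOpen cell₅ := by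
  simp only [cell₅, Set.ofPred_and]
  refine (isOpen_lt ?_ ?_).inter ((isOpen_lt ?_ ?_).inter (isOpen_lt ?_ ?_)) <;> fun_prop

lemma isOpen_cell₆ : IsOpen cell₆ := by
  simp only [cell₆, Set.ofPred_and]
  refine (isOpen_lt ?_ ?_).inter ((isOpen_lt ?_ ?_).inter ((isOpen_lt ?_ ?_).inter
      (isOpen_lt ?_ ?_))) <;> fun_prop

lemma isOpen_cell₇ : IsOpen cell₇ := by
  simp only [cell₇, Set.ofPred_and]
  refine (isOpen_lt ?_ ?_).inter ((isOpen_lt ?_ ?_).inter ((isOpen_lt ?_ ?_).inter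
      (isOpen_lt ?_ ?_))) <;> fun_prop

lemma isOpen_cellB : IsOpen cellB := by
  simp only [cellB, Set.ofPred_and]
  refine (isOpen_lt ?_ ?_).inter ((isOpen_lt ?_ ?_).inter (isOpen_lt ?_ ?_)) <;> fun_prop

lemma isOpen_cellL : IsOpen cellL := by
  simp only [cellL, Set.ofPred_and]
  refine (isOpen_lt ?_ ?_).inter ((isOpen_lt ?_ ?_).inter (isOpen_lt ?_ ?_)) <;> fun_prop

lemma isOpen_cellC : IsOpen cellC := by
  simp only [cellC, Set.ofPred_and]
  refine (isOpen_lt ?_ ?_).inter ((isOpen_lt ?_ ?_).inter (isOpen_lt ?_ ?_)) <;> fun_prop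

lemma isOpen_cellR : IsOpen cellR := by
  simp only [cellR, Set.ofPred_and]
  refine (isOpen_lt ?_ ?_).inter ((isOpen_lt ?_ ?_).inter (isOpen_lt ?_ ?_)) <;> fun_prop

open Classical in
/-- The map `f` on the cells that it moves, extended by the identity. -/
def stepMap (x : Plane) : Plane :=
  if x ∈ cell₁ then x + pt (phi - 1) 0 else
  if x ∈ cell₂ then x + pt (-phi) (2 * phi - 1) else
  if x ∈ cell₃ then x + pt 0 (phi - 1) else
  if x ∈ cell₄ then x + pt phi 0 else
  if x ∈ cell₅ then x + pt (phi - 1) (1 - phi) else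
  if x ∈ cell₆ then x + pt (1 - phi) 0 else
  if x ∈ cell₇ then x + pt (phi - 1) (1 - 2 * phi) else
  x

lemma stepMap_cell₁ {x : Plane} (hx : x ∈ cell₁) : stepMap x = x + pt (phi - 1) 0 := by
  rw [stepMap, if_pos hx]

lemma stepMap_cell₂ {x : Plane} (hx : x ∈ cell₂) : stepMap x = x + pt (-phi) (2 * phi - 1) := by
  have g1 := phi_gt
  have g2 := phi_lt
  rw [stepMap, if_neg, if_pos hx] <;>
  · intro h
    simp only [cell₁, cell₂, mem_ofPred_eq] at h hx
    casesm* _ ∧ _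
    linarith

lemma stepMap_cell₃ {x : Plane} (hx : x ∈ cell₃) : stepMap x = x + pt 0 (phi - 1) := by
  have g1 := phi_gt
  have g2 := phi_lt
  rw [stepMap, if_neg, if_neg, if_pos hx] <;>
  · intro h
    simp only [cell₁, cell₂, cell₃, mem_ofPred_eq] at h hx
    casesm* _ ∧ _
    linarith

lemma stepMap_cell₄ {x : Plane} (hx : x ∈ cell₄) : stepMap x = x + pt phi 0 := by
  have g1 := phi_gt
  have g2 := phi_lt
  rw [stepMap, if_neg, if_neg, if_neg, if_pos hx] <;>
  · intro h
    simp only [cell₁, cell₂, cell₃, cell₄, mem_ofPred_eq] at h hx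
    casesm* _ ∧ _
    linarith

lemma stepMap_cell₅ {x : Plane} (hx : x ∈ cell₅) : stepMap x = x + pt (phi - 1) (1 - phi) := by
  have g1 := phi_gt
  have g2 := phi_lt
  rw [stepMap, if_neg, if_neg, if_neg, if_neg, if_pos hx] <;>
  · intro h
    simp only [cell₁, cell₂, cell₃, cell₄, cell₅, mem_ofPred_eq] at h hx
    casesm* _ ∧ _
    linarith

lemma stepMap_cell₆ {x : Plane} (hx : x ∈ cell₆) : stepMap x = x + pt (1 - phi) 0 := by
  have g1 := phi_gt
  have g2 := phi_lt
  rw [stepMap, if_neg, if_neg, if_neg, if_neg, if_neg, if_pos hx] <;>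
  · intro h
    simp only [cell₁, cell₂, cell₃, cell₄, cell₅, cell₆, mem_ofPred_eq] at h hx
    casesm* _ ∧ _
    linarith

lemma stepMap_cell₇ {x : Plane} (hx : x ∈ cell₇) : stepMap x = x + pt (phi - 1) (1 - 2 * phi) := by
  have g1 := phi_gt
  have g2 := phi_lt
  rw [stepMap, if_neg, if_neg, if_neg, if_neg, if_neg, if_neg, if_pos hx] <;>
  · intro h
    simp only [cell₁, cell₂, cell₃, cell₄, cell₅, cell₆, cell₇, mem_ofPred_eq] at h hx
    casesm* _ ∧ _
    linarith

lemma stepMap_cellB {x : Plane} (hx : x ∈ cellB) : stepMap x = x := by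
  have g1 := phi_gt
  have g2 := phi_lt
  rw [stepMap, if_neg, if_neg, if_neg, if_neg, if_neg, if_neg, if_neg] <;>
  · intro h
    simp only [cell₁, cell₂, cell₃, cell₄, cell₅, cell₆, cell₇, cellB, mem_ofPred_eq] at h hx
    casesm* _ ∧ _
    linarith

lemma stepMap_cellL {x : Plane} (hx : x ∈ cellL) : stepMap x = x := by
  have g1 := phi_gt
  have g2 := phi_lt
  rw [stepMap, if_neg, if_neg, if_neg, if_neg, if_neg, if_neg, if_neg] <;>
  · intro h
    simp only [cell₁, cell₂, cell₃, cell₄, cell₅, cell₆, cell₇, cellL, mem_ofPred_eq] at h hx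
    casesm* _ ∧ _
    linarith

lemma stepMap_cellC {x : Plane} (hx : x ∈ cellC) : stepMap x = x := by
  have g1 := phi_gt
  have g2 := phi_lt
  rw [stepMap, if_neg, if_neg, if_neg, if_neg, if_neg, if_neg, if_neg] <;>
  · intro h
    simp only [cell₁, cell₂, cell₃, cell₄, cell₅, cell₆, cell₇, cellC, mem_ofPred_eq] at h hx
    casesm* _ ∧ _
    linarith

lemma stepMap_cellR {x : Plane} (hx : x ∈ cellR) : stepMap x = x := by
  have g1 := phi_gt
  have g2 := phi_lt
  rw [stepMap, if_neg, if_neg, if_neg, if_neg, if_neg, if_neg, if_neg] <;>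
  · intro h
    simp only [cell₁, cell₂, cell₃, cell₄, cell₅, cell₆, cell₇, cellR, mem_ofPred_eq] at h hx
    casesm* _ ∧ _
    linarith

lemma petStep_cell₁ {x : Plane} (hx : x ∈ cell₁) : petStep phi x (stepMap x) := by
  rw [stepMap_cell₁ hx]
  exact petStep_of_open isOpen_cell₁ (fun y hy => rawStep_₁ hy) x hx

lemma petStep_cell₂ {x : Plane} (hx : x ∈ cell₂) : petStep phi x (stepMap x) := by
  rw [stepMap_cell₂ hx]
  exact petStep_of_open isOpen_cell₂ (fun y hy => rawStep_₂ hy) x hx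

lemma petStep_cell₃ {x : Plane} (hx : x ∈ cell₃) : petStep phi x (stepMap x) := by
  rw [stepMap_cell₃ hx]
  exact petStep_of_open isOpen_cell₃ (fun y hy => rawStep_₃ hy) x hx

lemma petStep_cell₄ {x : Plane} (hx : x ∈ cell₄) : petStep phi x (stepMap x) := by
  rw [stepMap_cell₄ hx]
  exact petStep_of_open isOpen_cell₄ (fun y hy => rawStep_₄ hy) x hx

lemma petStep_cell₅ {x : Plane} (hx : x ∈ cell₅) : petStep phi x (stepMap x) := by
  rw [stepMap_cell₅ hx]
  exact petStep_of_open isOpen_cell₅ (fun y hy => rawStep_₅ hy) x hx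

lemma petStep_cell₆_left {x : Plane} (hx : x ∈ cell₆) (hs : ca x < 2 * phi - 3 / 2) :
    petStep phi x (stepMap x) := by
  rw [stepMap_cell₆ hx]
  refine petStep_of_open (s := cell₆ ∩ {x | ca x < 2 * phi - 3 / 2}) (isOpen_cell₆.inter
      (isOpen_lt ?_ ?_))
    (fun y hy => rawStep_₆_left hy.1 hy.2) x ⟨hx, hs⟩ <;> fun_prop

lemma petStep_cell₆_right {x : Plane} (hx : x ∈ cell₆) (hs : 2 * phi - 3 / 2 < ca x) :
    petStep phi x (stepMap x) := by
  rw [stepMap_cell₆ hx]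
  refine petStep_of_open (s := cell₆ ∩ {x | 2 * phi - 3 / 2 < ca x}) (isOpen_cell₆.inter
      (isOpen_lt ?_ ?_))
    (fun y hy => rawStep_₆_right hy.1 hy.2) x ⟨hx, hs⟩ <;> fun_prop

lemma petStep_cell₇ {x : Plane} (hx : x ∈ cell₇) : petStep phi x (stepMap x) := by
  rw [stepMap_cell₇ hx]
  exact petStep_of_open isOpen_cell₇ (fun y hy => rawStep_₇ hy) x hx

lemma petStep_cellB {x : Plane} (hx : x ∈ cellB) : petStep phi x (stepMap x) := by
  rw [stepMap_cellB hx]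
  have h := petStep_of_open isOpen_cellB (fun y hy => rawStep_B hy) x hx
  rwa [show pt 0 0 = 0 by apply plane_ext_coord <;> simp, add_zero] at h

lemma petStep_cellL {x : Plane} (hx : x ∈ cellL) : petStep phi x (stepMap x) := by
  rw [stepMap_cellL hx]
  have h := petStep_of_open isOpen_cellL (fun y hy => rawStep_L hy) x hx
  rwa [show pt 0 0 = 0 by apply plane_ext_coord <;> simp, add_zero] at h

lemma petStep_cellC {x : Plane} (hx : x ∈ cellC) : petStep phi x (stepMap x) := by
  rw [stepMap_cellC hx]
  have h := petStep_of_open isOpen_cellC (fun y hy => rawStep_C hy) x hx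
  rwa [show pt 0 0 = 0 by apply plane_ext_coord <;> simp, add_zero] at h

lemma petStep_cellR {x : Plane} (hx : x ∈ cellR) : petStep phi x (stepMap x) := by
  rw [stepMap_cellR hx]
  have h := petStep_of_open isOpen_cellR (fun y hy => rawStep_R hy) x hx
  rwa [show pt 0 0 = 0 by apply plane_ext_coord <;> simp, add_zero] at h

/-! ### Pieces of the fundamental frames inside cells -/

lemma Frame.form_lt {t : Frame} {l : Plane →ₗ[ℝ] ℝ} (hl : l ≠ 0) {c : ℝ} (h1 : l t.a ≤ c)
    (h2 : l t.a + l t.u ≤ c) (h3 : l t.a + phi ^ 2 * l t.u + phi * l t.v ≤ c)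
    (h4 : l t.a + phi * l t.v ≤ c) {x : Plane} (hx : x ∈ interior t.region) : l x < c := by
  refine lt_of_mem_interior hl (fun y hy => le_of_mem_hull ?_ hy) hx
  rintro z (rfl | rfl | rfl | rfl) <;> simpa [Frame.toTrapezoid]

lemma Frame.form_bot_lt {t : Frame} {l : Plane →ₗ[ℝ] ℝ} (hl : l ≠ 0) {c : ℝ}
    (h1 : l t.a + phi ^ 2 * l t.u ≤ c) (h2 : l t.a + phi * l t.u ≤ c)
    (h3 : l t.a + phi ^ 2 * l t.u + phi ^ 3 * l t.v ≤ c) {x : Plane} (hx : x ∈ t.bot) :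
    l x < c := by
  refine lt_of_mem_interior hl (fun y hy => le_of_mem_hull ?_ hy) hx
  rintro z (rfl | rfl | rfl) <;> simpa [Frame.b1, Frame.b2, Frame.apex]

section
variable {a b c d e f m : ℝ} {k : ℕ} {x : Plane}

lemma fr_ca_lt (h0 : a ≤ m) (h1 : a + c ≤ m) (h2 : a + phi ^ 2 * c + phi * e ≤ m)
    (h3 : a + phi * e ≤ m) (hx : x ∈ interior (fr a b c d e f k).region) :
    ca x < m := by
  have := Frame.form_lt (l := ca) ca_ne (c := m) (by simp [fr]; linarith) (by simp [fr]; linarith)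
      (by simp [fr]; linarith) (by simp [fr]; linarith) hx
  simpa using this

lemma fr_lt_ca (h0 : m ≤ a) (h1 : m ≤ a + c) (h2 : m ≤ a + phi ^ 2 * c + phi * e)
    (h3 : m ≤ a + phi * e) (hx : x ∈ interior (fr a b c d e f k).region) :
    m < ca x := by
  have := Frame.form_lt (l := -ca) (neg_ne_zero.2 ca_ne) (c := -m) (by simp [fr]; linarith)
      (by simp [fr]; linarith) (by simp [fr]; linarith) (by simp [fr]; linarith) hx
  simpa [add_comm] using this

lemma fr_bot_ca_lt (h0 : a + phi ^ 2 * c ≤ m) (h1 : a + phi * c ≤ m)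
    (h2 : a + phi ^ 2 * c + phi ^ 3 * e ≤ m) (hx : x ∈ (fr a b c d e f k).bot) :
    ca x < m := by
  have := Frame.form_bot_lt (l := ca) ca_ne (c := m) (by simp [fr]; linarith)
      (by simp [fr]; linarith) (by simp [fr]; linarith) hx
  simpa using this

lemma fr_bot_lt_ca (h0 : m ≤ a + phi ^ 2 * c) (h1 : m ≤ a + phi * c)
    (h2 : m ≤ a + phi ^ 2 * c + phi ^ 3 * e) (hx : x ∈ (fr a b c d e f k).bot) :
    m < ca x := by
  have := Frame.form_bot_lt (l := -ca) (neg_ne_zero.2 ca_ne) (c := -m) (by simp [fr]; linarith)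
      (by simp [fr]; linarith) (by simp [fr]; linarith) hx
  simpa [add_comm] using this

lemma fr_cb_lt (h0 : b ≤ m) (h1 : b + d ≤ m) (h2 : b + phi ^ 2 * d + phi * f ≤ m)
    (h3 : b + phi * f ≤ m) (hx : x ∈ interior (fr a b c d e f k).region) :
    cb x < m := by
  have := Frame.form_lt (l := cb) cb_ne (c := m) (by simp [fr]; linarith) (by simp [fr]; linarith)
      (by simp [fr]; linarith) (by simp [fr]; linarith) hx
  simpa using this

lemma fr_lt_cb (h0 : m ≤ b) (h1 : m ≤ b + d) (h2 : m ≤ b + phi ^ 2 * d + phi * f)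
    (h3 : m ≤ b + phi * f) (hx : x ∈ interior (fr a b c d e f k).region) :
    m < cb x := by
  have := Frame.form_lt (l := -cb) (neg_ne_zero.2 cb_ne) (c := -m) (by simp [fr]; linarith)
      (by simp [fr]; linarith) (by simp [fr]; linarith) (by simp [fr]; linarith) hx
  simpa [add_comm] using this

lemma fr_bot_cb_lt (h0 : b + phi ^ 2 * d ≤ m) (h1 : b + phi * d ≤ m)
    (h2 : b + phi ^ 2 * d + phi ^ 3 * f ≤ m) (hx : x ∈ (fr a b c d e f k).bot) :
    cb x < m := by
  have := Frame.form_bot_lt (l := cb) cb_ne (c := m) (by simp [fr]; linarith)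
      (by simp [fr]; linarith) (by simp [fr]; linarith) hx
  simpa using this

lemma fr_bot_lt_cb (h0 : m ≤ b + phi ^ 2 * d) (h1 : m ≤ b + phi * d)
    (h2 : m ≤ b + phi ^ 2 * d + phi ^ 3 * f) (hx : x ∈ (fr a b c d e f k).bot) :
    m < cb x := by
  have := Frame.form_bot_lt (l := -cb) (neg_ne_zero.2 cb_ne) (c := -m) (by simp [fr]; linarith)
      (by simp [fr]; linarith) (by simp [fr]; linarith) hx
  simpa [add_comm] using this

lemma fr_cs_lt (h0 : a + b ≤ m) (h1 : a + b + (c + d) ≤ m) (h2 : a + b + phi ^ 2 * (c + d) + phi *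
    (e + f) ≤ m) (h3 : a + b + phi * (e + f) ≤ m) (hx : x ∈ interior (fr a b c d e f k).region) :
    ca x + cb x < m := by
  have := Frame.form_lt (l := (ca + cb)) cs_ne (c := m) (by simp [fr]; linarith)
      (by simp [fr]; linarith) (by simp [fr]; linarith) (by simp [fr]; linarith) hx
  simpa using this

lemma fr_lt_cs (h0 : m ≤ a + b) (h1 : m ≤ a + b + (c + d)) (h2 : m ≤ a + b + phi ^ 2 *
    (c + d) + phi * (e + f)) (h3 : m ≤ a + b + phi * (e + f)) (hx : x ∈ interior
        (fr a b c d e f k).region) :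
    m < ca x + cb x := by
  have := Frame.form_lt (l := -(ca + cb)) (neg_ne_zero.2 cs_ne) (c := -m) (by simp [fr]; linarith)
      (by simp [fr]; linarith) (by simp [fr]; linarith) (by simp [fr]; linarith) hx
  simpa [add_comm] using this

lemma fr_bot_cs_lt (h0 : a + b + phi ^ 2 * (c + d) ≤ m) (h1 : a + b + phi * (c + d) ≤ m)
    (h2 : a + b + phi ^ 2 * (c + d) + phi ^ 3 * (e + f) ≤ m) (hx : x ∈ (fr a b c d e f k).bot) :
    ca x + cb x < m := by
  have := Frame.form_bot_lt (l := (ca + cb)) cs_ne (c := m) (by simp [fr]; linarith)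
      (by simp [fr]; linarith) (by simp [fr]; linarith) hx
  simpa using this

lemma fr_bot_lt_cs (h0 : m ≤ a + b + phi ^ 2 * (c + d)) (h1 : m ≤ a + b + phi * (c + d))
    (h2 : m ≤ a + b + phi ^ 2 * (c + d) + phi ^ 3 * (e + f)) (hx : x ∈ (fr a b c d e f k).bot) :
    m < ca x + cb x := by
  have := Frame.form_bot_lt (l := -(ca + cb)) (neg_ne_zero.2 cs_ne) (c := -m)
      (by simp [fr]; linarith) (by simp [fr]; linarith) (by simp [fr]; linarith) hx
  simpa [add_comm] using this

end

/-- This and the next lemmas place each piece of A, B, C from `Tri.cases_inner` or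
`Tri.cases_inner_mirror` in a single cell, by evaluating the defining forms at its vertices. In
`cell₆` they also tell the side of the segment on which f is not shown to be defined. -/
lemma fC_right_subset {x : Plane} (hx : x ∈ interior fC.right.region) : x ∈ cell₁ := by
  have g1 := phi_gt
  have g2 := phi_lt
  have hs := phi_sq
  have h3 := phi_pow_three
  rw [fC_right] at hx
  refine ⟨fr_lt_ca ?_ ?_ ?_ ?_ hx, fr_lt_cb ?_ ?_ ?_ ?_ hx, fr_cs_lt ?_ ?_ ?_ ?_ hx⟩ <;>
    linarith

lemma fC_mirror_inner_subset {x : Plane}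
    (hx : x ∈ interior fC.mirror.inner.region) : x ∈ cell₂ := by
  have g1 := phi_gt
  have g2 := phi_lt
  have hs := phi_sq
  have h3 := phi_pow_three
  rw [fC_mirror_inner] at hx
  refine ⟨fr_ca_lt ?_ ?_ ?_ ?_ hx, fr_cb_lt ?_ ?_ ?_ ?_ hx, fr_lt_cs ?_ ?_ ?_ ?_ hx, fr_cs_lt ?_ ?_ ?_ ?_ hx⟩ <;>
    linarith

lemma fC_left_left_subset {x : Plane} (hx : x ∈ interior fC.left.left.region) : x ∈ cell₃ := by
  have g1 := phi_gt
  have g2 := phi_lt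
  have hs := phi_sq
  have h3 := phi_pow_three
  rw [fC_left_left] at hx
  refine ⟨fr_lt_ca ?_ ?_ ?_ ?_ hx, fr_lt_cb ?_ ?_ ?_ ?_ hx, fr_cs_lt ?_ ?_ ?_ ?_ hx⟩ <;>
    linarith

lemma fA_inner_subset {x : Plane} (hx : x ∈ interior fA.inner.region) : x ∈ cell₄ := by
  have g1 := phi_gt
  have g2 := phi_lt
  have hs := phi_sq
  have h3 := phi_pow_three
  rw [fA_inner] at hx
  refine ⟨fr_lt_cb ?_ ?_ ?_ ?_ hx, fr_cb_lt ?_ ?_ ?_ ?_ hx, fr_ca_lt ?_ ?_ ?_ ?_ hx, fr_lt_cs ?_ ?_ ?_ ?_ hx⟩ <;>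
    linarith

lemma fA_right_left_subset {x : Plane} (hx : x ∈ interior fA.right.left.region) : x ∈ cell₅ := by
  have g1 := phi_gt
  have g2 := phi_lt
  have hs := phi_sq
  have h3 := phi_pow_three
  rw [fA_right_left] at hx
  refine ⟨fr_lt_ca ?_ ?_ ?_ ?_ hx, fr_lt_cb ?_ ?_ ?_ ?_ hx, fr_cs_lt ?_ ?_ ?_ ?_ hx⟩ <;>
    linarith

lemma fA_left_subset {x : Plane} (hx : x ∈ interior fA.left.region) : x ∈ cell₆
    ∧ ca x < 2 * phi - 3 / 2 := by
  have g1 := phi_gt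
  have g2 := phi_lt
  have hs := phi_sq
  have h3 := phi_pow_three
  rw [fA_left] at hx
  refine ⟨⟨fr_lt_ca ?_ ?_ ?_ ?_ hx, fr_lt_cb ?_ ?_ ?_ ?_ hx, fr_cb_lt ?_ ?_ ?_ ?_ hx, fr_cs_lt ?_ ?_ ?_ ?_ hx⟩, fr_ca_lt ?_ ?_ ?_ ?_ hx⟩ <;>
    linarith

lemma fB_left_left_subset {x : Plane} (hx : x ∈ interior fB.left.left.region) : x ∈ cell₆
    ∧ ca x < 2 * phi - 3 / 2 := by
  have g1 := phi_gt
  have g2 := phi_lt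
  have hs := phi_sq
  have h3 := phi_pow_three
  rw [fB_left_left] at hx
  refine ⟨⟨fr_lt_ca ?_ ?_ ?_ ?_ hx, fr_lt_cb ?_ ?_ ?_ ?_ hx, fr_cb_lt ?_ ?_ ?_ ?_ hx, fr_cs_lt ?_ ?_ ?_ ?_ hx⟩, fr_ca_lt ?_ ?_ ?_ ?_ hx⟩ <;>
    linarith

lemma fB_mirror_inner_subset {x : Plane} (hx : x ∈ interior fB.mirror.inner.region) : x ∈ cell₆
    ∧ 2 * phi - 3 / 2 < ca x := by
  have g1 := phi_gt
  have g2 := phi_lt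
  have hs := phi_sq
  have h3 := phi_pow_three
  rw [fB_mirror_inner] at hx
  refine ⟨⟨fr_lt_ca ?_ ?_ ?_ ?_ hx, fr_lt_cb ?_ ?_ ?_ ?_ hx, fr_cb_lt ?_ ?_ ?_ ?_ hx, fr_cs_lt ?_ ?_ ?_ ?_ hx⟩, fr_lt_ca ?_ ?_ ?_ ?_ hx⟩ <;>
    linarith

lemma fB_right_subset {x : Plane} (hx : x ∈ interior fB.right.region) : x ∈ cell₇ := by
  have g1 := phi_gt
  have g2 := phi_lt
  have hs := phi_sq
  have h3 := phi_pow_three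
  rw [fB_right] at hx
  refine ⟨fr_lt_ca ?_ ?_ ?_ ?_ hx, fr_ca_lt ?_ ?_ ?_ ?_ hx, fr_cb_lt ?_ ?_ ?_ ?_ hx, fr_lt_cs ?_ ?_ ?_ ?_ hx⟩ <;>
    linarith

lemma fC_bot_subset {x : Plane} (hx : x ∈ fC.bot) : x ∈ cell₁ := by
  have g1 := phi_gt
  have g2 := phi_lt
  have hs := phi_sq
  have h3 := phi_pow_three
  have h4 := phi_pow_four
  rw [fC] at hx
  refine ⟨fr_bot_lt_ca ?_ ?_ ?_ hx, fr_bot_lt_cb ?_ ?_ ?_ hx, fr_bot_cs_lt ?_ ?_ ?_ hx⟩ <;>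
    linarith

lemma fC_left_bot_subset {x : Plane} (hx : x ∈ fC.left.bot) : x ∈ cell₃ := by
  have g1 := phi_gt
  have g2 := phi_lt
  have hs := phi_sq
  have h3 := phi_pow_three
  have h4 := phi_pow_four
  rw [fC_left] at hx
  refine ⟨fr_bot_lt_ca ?_ ?_ ?_ hx, fr_bot_lt_cb ?_ ?_ ?_ hx, fr_bot_cs_lt ?_ ?_ ?_ hx⟩ <;>
    linarith

lemma fA_right_bot_subset {x : Plane} (hx : x ∈ fA.right.bot) : x ∈ cell₅ := by
  have g1 := phi_gt
  have g2 := phi_lt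
  have hs := phi_sq
  have h3 := phi_pow_three
  have h4 := phi_pow_four
  rw [fA_right] at hx
  refine ⟨fr_bot_lt_ca ?_ ?_ ?_ hx, fr_bot_lt_cb ?_ ?_ ?_ hx, fr_bot_cs_lt ?_ ?_ ?_ hx⟩ <;>
    linarith

lemma fB_left_bot_subset {x : Plane} (hx : x ∈ fB.left.bot) : x ∈ cell₆
    ∧ ca x < 2 * phi - 3 / 2 := by
  have g1 := phi_gt
  have g2 := phi_lt
  have hs := phi_sq
  have h3 := phi_pow_three
  have h4 := phi_pow_four
  rw [fB_left] at hx
  refine ⟨⟨fr_bot_lt_ca ?_ ?_ ?_ hx, fr_bot_lt_cb ?_ ?_ ?_ hx, fr_bot_cb_lt ?_ ?_ ?_ hx, fr_bot_cs_lt ?_ ?_ ?_ hx⟩, fr_bot_ca_lt ?_ ?_ ?_ hx⟩ <;>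
    linarith

lemma fA_bot_subset {x : Plane} (hx : x ∈ fA.bot) : x ∈ cell₆ ∧ 2 * phi - 3 / 2 < ca x := by
  have g1 := phi_gt
  have g2 := phi_lt
  have hs := phi_sq
  have h3 := phi_pow_three
  have h4 := phi_pow_four
  rw [fA] at hx
  refine ⟨⟨fr_bot_lt_ca ?_ ?_ ?_ hx, fr_bot_lt_cb ?_ ?_ ?_ hx, fr_bot_cb_lt ?_ ?_ ?_ hx, fr_bot_cs_lt ?_ ?_ ?_ hx⟩, fr_bot_lt_ca ?_ ?_ ?_ hx⟩ <;>
    linarith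

lemma fB_bot_subset {x : Plane} (hx : x ∈ fB.bot) : x ∈ cellB := by
  have g1 := phi_gt
  have g2 := phi_lt
  have hs := phi_sq
  have h3 := phi_pow_three
  have h4 := phi_pow_four
  rw [fB_eq] at hx
  refine ⟨fr_bot_ca_lt ?_ ?_ ?_ hx, fr_bot_cb_lt ?_ ?_ ?_ hx, fr_bot_lt_cs ?_ ?_ ?_ hx⟩ <;>
    linarith

/-! ### The map permutes the uncovered triangles -/

/-- On `δ` the map is the translation by `d`, and it takes `δ` to `δ'`. -/
structure Move (δ : Set Plane) (d : Plane) (δ' : Set Plane) : Prop where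
  image_eq : (fun x => x + d) '' δ = δ'
  step : ∀ x ∈ δ, stepMap x = x + d
  pet : ∀ x ∈ δ, petStep phi x (stepMap x)

/-- The map takes the triangles of `t` to those of `t'` by the translation by `d`. -/
structure Carries (t : Frame) (d : Plane) (t' : Frame) : Prop where
  map_eq : t.map (AffineEquiv.constVAdd ℝ Plane d) 0 = t'.mirror
  step : ∀ x ∈ interior t.region, stepMap x = x + d
  pet : ∀ x ∈ interior t.region, petStep phi x (stepMap x)

lemma constVAdd_image (d : Plane) (s : Set Plane) :
    AffineEquiv.constVAdd ℝ Plane d '' s = (fun x => x + d) '' s := by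
  refine image_congr fun x _ => ?_
  simp [add_comm]

namespace Carries
variable {t t' : Frame} {d : Plane} {j : ℕ} {δ : Set Plane}

/-- The translate of t is the mirror of t', which has the same triangles as t'. -/
lemma exists_move (h : Carries t d t') (hδ : Tri t j δ) : ∃ δ', Tri t' j δ' ∧ Move δ d δ' := by
  have h1 := hδ.map (AffineEquiv.constVAdd ℝ Plane d) 0
  rw [h.map_eq, constVAdd_image] at h1
  exact ⟨_, h1.of_mirror, rfl, fun x hx => h.step x (hδ.subset_interior hx),
    fun x hx => h.pet x (hδ.subset_interior hx)⟩

lemma exists_move_to (h : Carries t d t') (hδ : Tri t' j δ) : ∃ ε, Tri t j ε ∧ Move ε d δ := by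
  have h1 := hδ.mirror
  rw [← h.map_eq] at h1
  obtain ⟨i, ε, h2, rfl, rfl⟩ := h1.exists_of_map
  exact ⟨ε, h2, (constVAdd_image d ε).symm, fun x hx => h.step x (h2.subset_interior hx),
    fun x hx => h.pet x (h2.subset_interior hx)⟩

end Carries

lemma fr_map (x y a b c d e f : ℝ) (k : ℕ) :
    (fr a b c d e f k).map (AffineEquiv.constVAdd ℝ Plane (pt x y)) 0 =
      fr (a + x) (b + y) c d e f k := by
  simp only [fr, Frame.map, Frame.mk.injEq, add_zero]
  refine ⟨?_, by simp, by simp, trivial⟩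
  apply plane_ext_coord <;> simp [add_comm]

lemma bot_move {t t' : Frame} {d : Plane}
    (h : (fun x => x + d) '' {t.b1, t.b2, t.apex} = {t'.b1, t'.b2, t'.apex})
    (h1 : ∀ x ∈ t.bot, stepMap x = x + d) (h2 : ∀ x ∈ t.bot, petStep phi x (stepMap x)) :
    Move t.bot d t'.bot := by
  refine ⟨?_, h1, h2⟩
  rw [← constVAdd_image, Frame.bot, Frame.image_interior_hull, constVAdd_image, h, Frame.bot]

lemma carries_fC_right : Carries fC.right (pt (phi - 1) 0) fA.right where
  map_eq := by
    rw [fC_right, fA_right, fr_map, fr_mirror]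
    apply fr_congr <;> ring
  step _ hx := stepMap_cell₁ (fC_right_subset hx)
  pet _ hx := petStep_cell₁ (fC_right_subset hx)

lemma carries_fC_mirror_inner : Carries fC.mirror.inner (pt (-phi) (2 * phi - 1)) fB.left where
  map_eq := by
    rw [fC_mirror_inner, fB_left, fr_map, fr_mirror]
    apply fr_congr <;> ring
  step _ hx := stepMap_cell₂ (fC_mirror_inner_subset hx)
  pet _ hx := petStep_cell₂ (fC_mirror_inner_subset hx)

lemma carries_fC_left_left : Carries fC.left.left (pt 0 (phi - 1)) fC.right.left where
  map_eq := by
    rw [fC_left_left, fC_right_left, fr_map, fr_mirror]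
    apply fr_congr <;> ring
  step _ hx := stepMap_cell₃ (fC_left_left_subset hx)
  pet _ hx := petStep_cell₃ (fC_left_left_subset hx)

lemma carries_fA_inner : Carries fA.inner (pt phi 0) fC.inner where
  map_eq := by
    rw [fA_inner, fC_inner, fr_map, fr_mirror]
    apply fr_congr <;> ring
  step _ hx := stepMap_cell₄ (fA_inner_subset hx)
  pet _ hx := petStep_cell₄ (fA_inner_subset hx)

lemma carries_fA_right_left : Carries fA.right.left (pt (phi - 1) (1 - phi)) fA.left.left where
  map_eq := by
    rw [fA_right_left, fA_left_left, fr_map, fr_mirror]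
    apply fr_congr <;> ring
  step _ hx := stepMap_cell₅ (fA_right_left_subset hx)
  pet _ hx := petStep_cell₅ (fA_right_left_subset hx)

lemma carries_fA_left : Carries fA.left (pt (1 - phi) 0) fB.inner where
  map_eq := by
    rw [fA_left, fB_inner, fr_map, fr_mirror]
    apply fr_congr <;> ring
  step _ hx := stepMap_cell₆ (fA_left_subset hx).1
  pet _ hx := petStep_cell₆_left (fA_left_subset hx).1 (fA_left_subset hx).2

lemma carries_fB_left_left : Carries fB.left.left (pt (1 - phi) 0) fB.right.left where
  map_eq := by
    rw [fB_left_left, fB_right_left, fr_map, fr_mirror]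
    apply fr_congr <;> ring
  step _ hx := stepMap_cell₆ (fB_left_left_subset hx).1
  pet _ hx := petStep_cell₆_left (fB_left_left_subset hx).1 (fB_left_left_subset hx).2

lemma carries_fB_mirror_inner : Carries fB.mirror.inner (pt (1 - phi) 0) fC.left where
  map_eq := by
    rw [fB_mirror_inner, fC_left, fr_map, fr_mirror]
    apply fr_congr <;> ring
  step _ hx := stepMap_cell₆ (fB_mirror_inner_subset hx).1
  pet _ hx := petStep_cell₆_right (fB_mirror_inner_subset hx).1 (fB_mirror_inner_subset hx).2

lemma carries_fB_right : Carries fB.right (pt (phi - 1) (1 - 2 * phi)) fA.mirror.inner where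
  map_eq := by
    rw [fB_right, fA_mirror_inner, fr_map, fr_mirror]
    apply fr_congr <;> ring
  step _ hx := stepMap_cell₇ (fB_right_subset hx)
  pet _ hx := petStep_cell₇ (fB_right_subset hx)

/-- For single triangles it is enough to match the corners as a set; the order of `b1`, `b2`, `apex`
is not preserved. -/
lemma move_fC_bot : Move fC.bot (pt (phi - 1) 0) fA.bot := by
  have h := phi_sq
  have h' := phi_pow_three
  have hb1 : fC.b1 + pt (phi - 1) 0 = fA.b1 := by
    rw [fC, fA]
    apply plane_ext_coord <;> simp [fr, Frame.b1, Frame.b2, Frame.apex] <;> grind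
  have hb2 : fC.b2 + pt (phi - 1) 0 = fA.apex := by
    rw [fC, fA]
    apply plane_ext_coord <;> simp [fr, Frame.b1, Frame.b2, Frame.apex] <;> grind
  have hapex : fC.apex + pt (phi - 1) 0 = fA.b2 := by
    rw [fC, fA]
    apply plane_ext_coord <;> simp [fr, Frame.b1, Frame.b2, Frame.apex] <;> grind
  refine bot_move ?_ (fun x hx => stepMap_cell₁ (fC_bot_subset hx)) (fun x hx => petStep_cell₁
      (fC_bot_subset hx))
  rw [image_insert_eq, image_pair, hb1, hb2, hapex]
  rw [pair_comm]

lemma move_fC_left_bot : Move fC.left.bot (pt 0 (phi - 1)) fC.right.bot := by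
  have h := phi_sq
  have h' := phi_pow_three
  have hb1 : fC.left.b1 + pt 0 (phi - 1) = fC.right.apex := by
    rw [fC_left, fC_right]
    apply plane_ext_coord <;> simp [fr, Frame.b1, Frame.b2, Frame.apex] <;> grind
  have hb2 : fC.left.b2 + pt 0 (phi - 1) = fC.right.b2 := by
    rw [fC_left, fC_right]
    apply plane_ext_coord <;> simp [fr, Frame.b1, Frame.b2, Frame.apex] <;> grind
  have hapex : fC.left.apex + pt 0 (phi - 1) = fC.right.b1 := by
    rw [fC_left, fC_right]
    apply plane_ext_coord <;> simp [fr, Frame.b1, Frame.b2, Frame.apex] <;> grind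
  refine bot_move ?_ (fun x hx => stepMap_cell₃ (fC_left_bot_subset hx)) (fun x hx => petStep_cell₃
      (fC_left_bot_subset hx))
  rw [image_insert_eq, image_pair, hb1, hb2, hapex]
  rw [insert_comm, pair_comm, insert_comm]

lemma move_fA_right_bot : Move fA.right.bot (pt (phi - 1) (1 - phi)) fA.left.bot := by
  have h := phi_sq
  have h' := phi_pow_three
  have hb1 : fA.right.b1 + pt (phi - 1) (1 - phi) = fA.left.apex := by
    rw [fA_right, fA_left]
    apply plane_ext_coord <;> simp [fr, Frame.b1, Frame.b2, Frame.apex] <;> grind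
  have hb2 : fA.right.b2 + pt (phi - 1) (1 - phi) = fA.left.b2 := by
    rw [fA_right, fA_left]
    apply plane_ext_coord <;> simp [fr, Frame.b1, Frame.b2, Frame.apex] <;> grind
  have hapex : fA.right.apex + pt (phi - 1) (1 - phi) = fA.left.b1 := by
    rw [fA_right, fA_left]
    apply plane_ext_coord <;> simp [fr, Frame.b1, Frame.b2, Frame.apex] <;> grind
  refine bot_move ?_ (fun x hx => stepMap_cell₅ (fA_right_bot_subset hx))
      (fun x hx => petStep_cell₅ (fA_right_bot_subset hx))
  rw [image_insert_eq, image_pair, hb1, hb2, hapex]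
  rw [insert_comm, pair_comm, insert_comm]

lemma move_fB_left_bot : Move fB.left.bot (pt (1 - phi) 0) fB.right.bot := by
  have h := phi_sq
  have h' := phi_pow_three
  have hb1 : fB.left.b1 + pt (1 - phi) 0 = fB.right.apex := by
    rw [fB_left, fB_right]
    apply plane_ext_coord <;> simp [fr, Frame.b1, Frame.b2, Frame.apex] <;> grind
  have hb2 : fB.left.b2 + pt (1 - phi) 0 = fB.right.b2 := by
    rw [fB_left, fB_right]
    apply plane_ext_coord <;> simp [fr, Frame.b1, Frame.b2, Frame.apex] <;> grind
  have hapex : fB.left.apex + pt (1 - phi) 0 = fB.right.b1 := by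
    rw [fB_left, fB_right]
    apply plane_ext_coord <;> simp [fr, Frame.b1, Frame.b2, Frame.apex] <;> grind
  refine bot_move ?_ (fun x hx => stepMap_cell₆ (fB_left_bot_subset hx).1)
      (fun x hx => petStep_cell₆_left (fB_left_bot_subset hx).1 (fB_left_bot_subset hx).2)
  rw [image_insert_eq, image_pair, hb1, hb2, hapex]
  rw [insert_comm, pair_comm, insert_comm]

lemma move_fA_bot : Move fA.bot (pt (1 - phi) 0) fC.bot := by
  have h := phi_sq
  have h' := phi_pow_three
  have hb1 : fA.b1 + pt (1 - phi) 0 = fC.b1 := by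
    rw [fA, fC]
    apply plane_ext_coord <;> simp [fr, Frame.b1, Frame.b2, Frame.apex] <;> grind
  have hb2 : fA.b2 + pt (1 - phi) 0 = fC.apex := by
    rw [fA, fC]
    apply plane_ext_coord <;> simp [fr, Frame.b1, Frame.b2, Frame.apex] <;> grind
  have hapex : fA.apex + pt (1 - phi) 0 = fC.b2 := by
    rw [fA, fC]
    apply plane_ext_coord <;> simp [fr, Frame.b1, Frame.b2, Frame.apex] <;> grind
  refine bot_move ?_ (fun x hx => stepMap_cell₆ (fA_bot_subset hx).1)
      (fun x hx => petStep_cell₆_right (fA_bot_subset hx).1 (fA_bot_subset hx).2)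
  rw [image_insert_eq, image_pair, hb1, hb2, hapex]
  rw [pair_comm]

lemma move_fB_bot : Move fB.bot 0 fB.bot where
  image_eq := by simp
  step x hx := by rw [stepMap_cellB (fB_bot_subset hx), add_zero]
  pet x hx := petStep_cellB (fB_bot_subset hx)

/-- The uncovered triangles of scale `j` in the fundamental trapezoids. -/
def IsGap (j : ℕ) (δ : Set Plane) : Prop := Tri fA j δ ∨ Tri fB j δ ∨ Tri fC j δ

namespace IsGap
variable {j : ℕ} {δ : Set Plane}

/-- The discontinuities of f cut A in the way of `Tri.cases_inner`, and B and C in its mirrored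
form. Every piece has its own translation. -/
lemma exists_move (h : IsGap j δ) : ∃ d δ', IsGap j δ' ∧ Move δ d δ' := by
  rcases h with h | h | h
  · rcases h.cases_inner with h | ⟨rfl, rfl⟩ | h | ⟨rfl, rfl⟩ | h
    · obtain ⟨δ', h1, h2⟩ := carries_fA_inner.exists_move h
      exact ⟨_, _, .inr (.inr h1.of_inner), h2⟩
    · exact ⟨_, _, .inr (.inr (.bot fC)), move_fA_bot⟩
    · obtain ⟨δ', h1, h2⟩ := carries_fA_left.exists_move h
      exact ⟨_, _, .inr (.inl h1.of_inner), h2⟩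
    · exact ⟨_, _, .inl (.left (.bot fA.left)), move_fA_right_bot⟩
    · obtain ⟨δ', h1, h2⟩ := carries_fA_right_left.exists_move h
      exact ⟨_, _, .inl (.left (.left h1)), h2⟩
  · rcases h.cases_inner_mirror with h | ⟨rfl, rfl⟩ | h | ⟨rfl, rfl⟩ | h
    · obtain ⟨δ', h1, h2⟩ := carries_fB_mirror_inner.exists_move h
      exact ⟨_, _, .inr (.inr (.left h1)), h2⟩
    · exact ⟨_, _, .inr (.inl (.bot fB)), move_fB_bot⟩
    · obtain ⟨δ', h1, h2⟩ := carries_fB_right.exists_move h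
      exact ⟨_, _, .inl h1.of_inner.of_mirror, h2⟩
    · exact ⟨_, _, .inr (.inl (.right (.bot fB.right))), move_fB_left_bot⟩
    · obtain ⟨δ', h1, h2⟩ := carries_fB_left_left.exists_move h
      exact ⟨_, _, .inr (.inl (.right (.left h1))), h2⟩
  · rcases h.cases_inner_mirror with h | ⟨rfl, rfl⟩ | h | ⟨rfl, rfl⟩ | h
    · obtain ⟨δ', h1, h2⟩ := carries_fC_mirror_inner.exists_move h
      exact ⟨_, _, .inr (.inl (.left h1)), h2⟩
    · exact ⟨_, _, .inl (.bot fA), move_fC_bot⟩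
    · obtain ⟨δ', h1, h2⟩ := carries_fC_right.exists_move h
      exact ⟨_, _, .inl (.right h1), h2⟩
    · exact ⟨_, _, .inr (.inr (.right (.bot fC.right))), move_fC_left_bot⟩
    · obtain ⟨δ', h1, h2⟩ := carries_fC_left_left.exists_move h
      exact ⟨_, _, .inr (.inr (.right (.left h1))), h2⟩

/-- The images of the pieces cut the trapezoids from the opposite sides: A in the mirrored form, B
and C in the direct one. -/
lemma exists_move_to (h : IsGap j δ) : ∃ d ε, IsGap j ε ∧ Move ε d δ := by
  rcases h with h | h | h
  · rcases h.cases_inner_mirror with h | ⟨rfl, rfl⟩ | h | ⟨rfl, rfl⟩ | h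
    · obtain ⟨ε, h1, h2⟩ := carries_fB_right.exists_move_to h
      exact ⟨_, _, .inr (.inl (.right h1)), h2⟩
    · exact ⟨_, _, .inr (.inr (.bot fC)), move_fC_bot⟩
    · obtain ⟨ε, h1, h2⟩ := carries_fC_right.exists_move_to h
      exact ⟨_, _, .inr (.inr (.right h1)), h2⟩
    · exact ⟨_, _, .inl (.right (.bot fA.right)), move_fA_right_bot⟩
    · obtain ⟨ε, h1, h2⟩ := carries_fA_right_left.exists_move_to h
      exact ⟨_, _, .inl (.right (.left h1)), h2⟩
  · rcases h.cases_inner with h | ⟨rfl, rfl⟩ | h | ⟨rfl, rfl⟩ | h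
    · obtain ⟨ε, h1, h2⟩ := carries_fA_left.exists_move_to h
      exact ⟨_, _, .inl (.left h1), h2⟩
    · exact ⟨_, _, .inr (.inl (.bot fB)), move_fB_bot⟩
    · obtain ⟨ε, h1, h2⟩ := carries_fC_mirror_inner.exists_move_to h
      exact ⟨_, _, .inr (.inr h1.of_inner.of_mirror), h2⟩
    · exact ⟨_, _, .inr (.inl (.left (.bot fB.left))), move_fB_left_bot⟩
    · obtain ⟨ε, h1, h2⟩ := carries_fB_left_left.exists_move_to h
      exact ⟨_, _, .inr (.inl (.left (.left h1))), h2⟩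
  · rcases h.cases_inner with h | ⟨rfl, rfl⟩ | h | ⟨rfl, rfl⟩ | h
    · obtain ⟨ε, h1, h2⟩ := carries_fA_inner.exists_move_to h
      exact ⟨_, _, .inl h1.of_inner, h2⟩
    · exact ⟨_, _, .inl (.bot fA), move_fA_bot⟩
    · obtain ⟨ε, h1, h2⟩ := carries_fB_mirror_inner.exists_move_to h
      exact ⟨_, _, .inr (.inl h1.of_inner.of_mirror), h2⟩
    · exact ⟨_, _, .inr (.inr (.left (.bot fC.left))), move_fC_left_bot⟩
    · obtain ⟨ε, h1, h2⟩ := carries_fC_left_left.exists_move_to h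
      exact ⟨_, _, .inr (.inr (.left (.left h1))), h2⟩

lemma subset_cells (h : IsGap j δ) {x : Plane} (hx : x ∈ δ) : x ∈ cell₁ ∨ x ∈ cell₂ ∨ x ∈ cell₃ ∨
    x ∈ cell₄ ∨ x ∈ cell₅ ∨ x ∈ cell₆ ∨ x ∈ cell₇ ∨ x ∈ cellB := by
  rcases h with h | h | h
  · rcases h.cases_inner with h | ⟨rfl, rfl⟩ | h | ⟨rfl, rfl⟩ | h
    · simp [fA_inner_subset (h.subset_interior hx)]
    · simp [(fA_bot_subset hx).1]
    · simp [(fA_left_subset (h.subset_interior hx)).1]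
    · simp [fA_right_bot_subset hx]
    · simp [fA_right_left_subset (h.subset_interior hx)]
  · rcases h.cases_inner_mirror with h | ⟨rfl, rfl⟩ | h | ⟨rfl, rfl⟩ | h
    · simp [(fB_mirror_inner_subset (h.subset_interior hx)).1]
    · simp [fB_bot_subset hx]
    · simp [fB_right_subset (h.subset_interior hx)]
    · simp [(fB_left_bot_subset hx).1]
    · simp [(fB_left_left_subset (h.subset_interior hx)).1]
  · rcases h.cases_inner_mirror with h | ⟨rfl, rfl⟩ | h | ⟨rfl, rfl⟩ | h
    · simp [fC_mirror_inner_subset (h.subset_interior hx)]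
    · simp [fC_bot_subset hx]
    · simp [fC_right_subset (h.subset_interior hx)]
    · simp [fC_left_bot_subset hx]
    · simp [fC_left_left_subset (h.subset_interior hx)]

end IsGap

lemma fA_equilateral : fA.Equilateral := by
  have h3 : √3 ^ 2 = 3 := Real.sq_sqrt (by norm_num)
  refine ⟨?_, ?_, ?_⟩ <;> simp [fA, fr, pt, vec] <;> ring_nf <;> rw [h3] <;> ring
lemma fB_equilateral : fB.Equilateral := by
  have h3 : √3 ^ 2 = 3 := Real.sq_sqrt (by norm_num)
  rw [fB_eq]
  refine ⟨?_, ?_, ?_⟩ <;> simp [fr, pt, vec] <;> ring_nf <;> (try rw [h3]) <;> ring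
lemma fC_equilateral : fC.Equilateral := by
  have h3 : √3 ^ 2 = 3 := Real.sq_sqrt (by norm_num)
  refine ⟨?_, ?_, ?_⟩ <;> simp [fC, fr, pt, vec] <;> ring_nf <;> rw [h3] <;> ring

/-! ### Periodicity of the gaps -/

namespace IsGap
variable {j : ℕ} {δ : Set Plane}

lemma nonempty (h : IsGap j δ) : δ.Nonempty := by
  rcases h with h | h | h
  · exact h.nonempty fA_equilateral
  · exact h.nonempty fB_equilateral
  · exact h.nonempty fC_equilateral

lemma convex (h : IsGap j δ) : Convex ℝ δ := by
  rcases h with h | h | h <;> exact h.convex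

lemma isBounded (h : IsGap j δ) : Bornology.IsBounded δ := by
  rcases h with h | h | h <;> exact h.isBounded

lemma finite (j : ℕ) : {δ | IsGap j δ}.Finite :=
  (Tri.finite fA j).union ((Tri.finite fB j).union (Tri.finite fC j))

end IsGap

lemma Move.image_step {δ δ' : Set Plane} {d : Plane} (h : Move δ d δ') : stepMap '' δ = δ' := by
  rw [← h.image_eq]; exact image_congr h.step

/-- The translates of a bounded nonempty set are distinct. -/
lemma eq_zero_of_image_add {s : Set Plane} (hs : s.Nonempty) (hb : Bornology.IsBounded s)
    {d : Plane}
    (h : (fun x => x + d) '' s = s) : d = 0 := by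
  obtain ⟨x, hx⟩ := hs
  -- All translates of x by multiples of d stay in s, which contradicts boundedness unless d = 0.
  have hn : ∀ n : ℕ, x + n • d ∈ s := by
    intro n
    induction n with
    | zero => simpa
    | succ n ih => rw [← h]; exact ⟨_, ih, by simp only; rw [succ_nsmul, add_assoc]⟩
  obtain ⟨R, hR⟩ := hb.exists_norm_le
  by_contra hd
  obtain ⟨n, hn'⟩ := exists_nat_gt ((R + ‖x‖) / ‖d‖)
  rw [div_lt_iff₀ (norm_pos_iff.2 hd)] at hn'
  have h1 := hR _ (hn n)
  have h2 : ‖n • d‖ ≤ ‖x + n • d‖ + ‖x‖ := by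
    have := norm_sub_le (x + n • d) x
    simpa using this
  rw [← Nat.cast_smul_eq_nsmul ℝ, norm_smul, Real.norm_natCast] at h2
  rw [← Nat.cast_smul_eq_nsmul ℝ] at h1
  linarith

namespace IsGap
variable {j : ℕ} {δ : Set Plane}

lemma exists_iterate (h : IsGap j δ) (n : ℕ) : ∃ d, IsGap j (stepMap^[n] '' δ) ∧
    ∀ x ∈ δ, stepMap^[n] x = x + d := by
  induction n with
  | zero => exact ⟨0, by simpa, by simp⟩
  | succ n ih =>
    obtain ⟨d, h1, h2⟩ := ih
    obtain ⟨d', δ', h3, h4⟩ := h1.exists_move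
    refine ⟨d + d', ?_, fun x hx => ?_⟩
    · rw [Function.iterate_succ', image_comp, h4.image_step]; exact h3
    · rw [Function.iterate_succ_apply', h4.step _ ⟨x, hx, rfl⟩, h2 x hx, add_assoc]

/-- Every uncovered triangle returns to itself. -/
lemma exists_period (h : IsGap j δ) : ∃ n, 0 < n ∧ ∀ x ∈ δ, stepMap^[n] x = x := by
  have hfin : Finite {δ // IsGap j δ} := finite j
  have hmaps : ∀ δ : {δ // IsGap j δ}, IsGap j (stepMap '' δ.1) := by
    rintro ⟨δ, hδ⟩
    obtain ⟨d, δ', h1, h2⟩ := hδ.exists_move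
    rw [h2.image_step]; exact h1
  -- A surjective self-map of a finite set is injective, so every gap is a periodic point of σ.
  let σ : {δ // IsGap j δ} → {δ // IsGap j δ} := fun δ => ⟨stepMap '' δ.1, hmaps δ⟩
  have hsurj : Function.Surjective σ := by
    rintro ⟨δ, hδ⟩
    obtain ⟨d, ε, h1, h2⟩ := hδ.exists_move_to
    exact ⟨⟨ε, h1⟩, Subtype.ext h2.image_step⟩
  have hinj := Finite.injective_iff_surjective.2 hsurj
  obtain ⟨n, hn, hper⟩ := hinj.mem_periodicPts ⟨δ, h⟩
  have hiter : ∀ n, ((σ^[n] ⟨δ, h⟩ : {δ // IsGap j δ}) : Set Plane) = stepMap^[n] '' δ := by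
    intro n
    induction n with
    | zero => simp
    | succ n ih =>
      rw [Function.iterate_succ_apply', Function.iterate_succ', image_comp, ← ih]
  obtain ⟨d, h1, h2⟩ := h.exists_iterate n
  have h3 : (fun x => x + d) '' δ = δ := by
    rw [← image_congr h2, ← hiter, hper]
  have h4 := eq_zero_of_image_add h.nonempty h.isBounded h3
  exact ⟨n, hn, fun x hx => by rw [h2 x hx, h4, add_zero]⟩

end IsGap

/-! ### Renormalization -/

/-- The linear part of the renormalizing similarity. -/
def psiLinear : Plane ≃ₗ[ℝ] Plane where
  toFun p := pt (-phi * cb p) (-phi * ca p)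
  map_add' p q := by apply plane_ext_coord <;> simp <;> ring
  map_smul' c p := by apply plane_ext_coord <;> simp <;> ring
  invFun p := pt (-(phi⁻¹ * cb p)) (-(phi⁻¹ * ca p))
  left_inv p := by
    have := phi_pos.ne'
    apply plane_ext_coord <;> simp <;> field_simp
  right_inv p := by
    have := phi_pos.ne'
    apply plane_ext_coord <;> simp <;> field_simp

/-- The similarity of ratio `φ` that conjugates the map to a first return map. -/
def psi : Plane ≃ᵃ[ℝ] Plane :=
  psiLinear.toAffineEquiv.trans (AffineEquiv.constVAdd ℝ Plane (pt (-phi / 2) 0))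

lemma ca_psi (p : Plane) : ca (psi p) = -phi / 2 - phi * cb p := by
  simp [psi, psiLinear, sub_eq_add_neg]
lemma cb_psi (p : Plane) : cb (psi p) = -(phi * ca p) := by
  simp [psi, psiLinear]

lemma psi_linear (p : Plane) : psi.linear p = pt (-phi * cb p) (-phi * ca p) := rfl

lemma fr_map_psi (a b c d e f : ℝ) (k : ℕ) : (fr a b c d e f k).map psi 1 =
    fr (-phi / 2 - phi * b) (-(phi * a)) (-(phi * d)) (-(phi * c)) (-(phi * f)) (-(phi * e))
      (k + 1) := by
  simp only [fr, Frame.map, Frame.mk.injEq, and_true]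
  refine ⟨?_, ?_, ?_⟩ <;> apply plane_ext_coord <;> simp [psi_linear, ca_psi, cb_psi]

/-- Self-similarity: `psi` takes A, B, C to the subframes `fB.left`, `fA.left`, `fA.inner`, with the
scale raised by one. -/
lemma fB_left_eq_map : fB.left = fA.map psi 1 := by
  have h := phi_sq
  rw [fB_left, fA, fr_map_psi]
  apply fr_congr <;> grind
lemma fA_left_eq_map : fA.left = fB.map psi 1 := by
  have h := phi_sq
  rw [fA_left, fB_eq, fr_map_psi]
  apply fr_congr <;> grind
lemma fA_inner_eq_map : fA.inner = fC.map psi 1 := by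
  have h := phi_sq
  rw [fA_inner, fC, fr_map_psi]
  apply fr_congr <;> grind

/-- The itinerary of psi x is constant on the cell and its displacements add up to the linear part
of `psi` applied to the displacement of x. The bound on `ca` shows that the first step already
leaves the half-plane that contains the rescaled gaps; this extra point makes periods grow. The
other cells are treated alike. -/
lemma psi_cell₁ {x : Plane} (hx : x ∈ cell₁) : stepMap^[2] (psi x) = psi (stepMap x) ∧
    ca (psi x) < 1 / 2 - phi ∧ 1 / 2 - phi ≤ ca (stepMap (psi x)) := by
  have e := stepMap_cell₁ hx
  have hp := phi_sq
  have hg := phi_gt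
  have hl := phi_lt
  obtain ⟨h1, h2, h3⟩ := hx
  -- Multiplied by φ, the inequalities of the cell become linear in the products that occur in psi
  -- x, given φ² = 1 - φ.
  replace h1 := mul_lt_mul_of_pos_left h1 phi_pos
  replace h2 := mul_lt_mul_of_pos_left h2 phi_pos
  replace h3 := mul_lt_mul_of_pos_left h3 phi_pos
  have m0 : psi x ∈ cell₄ := by
    simp only [cell₄, mem_ofPred_eq, ca_psi, cb_psi]
    refine ⟨?_, ?_, ?_, ?_⟩ <;> linarith
  have m1 : psi x + pt phi 0 ∈ cell₂ := by
    simp only [cell₂, mem_ofPred_eq, map_add, ca_pt, cb_pt, ca_psi, cb_psi]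
    refine ⟨?_, ?_, ?_, ?_⟩ <;> linarith
  refine ⟨?_, ?_, ?_⟩
  · change stepMap (stepMap (psi x)) = _
    rw [e, stepMap_cell₄ m0, stepMap_cell₂ m1]
    apply plane_ext_coord <;> simp only [map_add, ca_pt, cb_pt, ca_psi, cb_psi] <;> linarith
  · rw [ca_psi]; linarith
  · rw [stepMap_cell₄ m0, map_add, ca_pt, ca_psi]; linarith

lemma psi_cell₂ {x : Plane} (hx : x ∈ cell₂) : stepMap^[3] (psi x) = psi (stepMap x) ∧
    ca (psi x) < 1 / 2 - phi ∧ 1 / 2 - phi ≤ ca (stepMap (psi x)) := by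
  have e := stepMap_cell₂ hx
  have hp := phi_sq
  have hg := phi_gt
  have hl := phi_lt
  obtain ⟨h1, h2, h3, h4⟩ := hx
  replace h1 := mul_lt_mul_of_pos_left h1 phi_pos
  replace h2 := mul_lt_mul_of_pos_left h2 phi_pos
  replace h3 := mul_lt_mul_of_pos_left h3 phi_pos
  replace h4 := mul_lt_mul_of_pos_left h4 phi_pos
  have m0 : psi x ∈ cell₄ := by
    simp only [cell₄, mem_ofPred_eq, ca_psi, cb_psi]
    refine ⟨?_, ?_, ?_, ?_⟩ <;> linarith
  have m1 : psi x + pt phi 0 ∈ cell₁ := by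
    simp only [cell₁, mem_ofPred_eq, map_add, ca_pt, cb_pt, ca_psi, cb_psi]
    refine ⟨?_, ?_, ?_⟩ <;> linarith
  have m2 : psi x + pt phi 0 + pt (phi - 1) 0 ∈ cell₅ := by
    simp only [cell₅, mem_ofPred_eq, map_add, ca_pt, cb_pt, ca_psi, cb_psi]
    refine ⟨?_, ?_, ?_⟩ <;> linarith
  refine ⟨?_, ?_, ?_⟩
  · change stepMap (stepMap (stepMap (psi x))) = _
    rw [e, stepMap_cell₄ m0, stepMap_cell₁ m1, stepMap_cell₅ m2]
    apply plane_ext_coord <;> simp only [map_add, ca_pt, cb_pt, ca_psi, cb_psi] <;> linarith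
  · rw [ca_psi]; linarith
  · rw [stepMap_cell₄ m0, map_add, ca_pt, ca_psi]; linarith

lemma psi_cell₃ {x : Plane} (hx : x ∈ cell₃) : stepMap^[2] (psi x) = psi (stepMap x) ∧
    ca (psi x) < 1 / 2 - phi ∧ 1 / 2 - phi ≤ ca (stepMap (psi x)) := by
  have e := stepMap_cell₃ hx
  have hp := phi_sq
  have hg := phi_gt
  have hl := phi_lt
  obtain ⟨h1, h2, h3⟩ := hx
  replace h1 := mul_lt_mul_of_pos_left h1 phi_pos
  replace h2 := mul_lt_mul_of_pos_left h2 phi_pos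
  replace h3 := mul_lt_mul_of_pos_left h3 phi_pos
  have m0 : psi x ∈ cell₄ := by
    simp only [cell₄, mem_ofPred_eq, ca_psi, cb_psi]
    refine ⟨?_, ?_, ?_, ?_⟩ <;> linarith
  have m1 : psi x + pt phi 0 ∈ cell₁ := by
    simp only [cell₁, mem_ofPred_eq, map_add, ca_pt, cb_pt, ca_psi, cb_psi]
    refine ⟨?_, ?_, ?_⟩ <;> linarith
  refine ⟨?_, ?_, ?_⟩
  · change stepMap (stepMap (psi x)) = _
    rw [e, stepMap_cell₄ m0, stepMap_cell₁ m1]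
    apply plane_ext_coord <;> simp only [map_add, ca_pt, cb_pt, ca_psi, cb_psi] <;> linarith
  · rw [ca_psi]; linarith
  · rw [stepMap_cell₄ m0, map_add, ca_pt, ca_psi]; linarith

lemma psi_cell₄ {x : Plane} (hx : x ∈ cell₄) : stepMap^[3] (psi x) = psi (stepMap x) ∧
    ca (psi x) < 1 / 2 - phi ∧ 1 / 2 - phi ≤ ca (stepMap (psi x)) := by
  have e := stepMap_cell₄ hx
  have hp := phi_sq
  have hg := phi_gt
  have hl := phi_lt
  obtain ⟨h1, h2, h3, h4⟩ := hx
  replace h1 := mul_lt_mul_of_pos_left h1 phi_pos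
  replace h2 := mul_lt_mul_of_pos_left h2 phi_pos
  replace h3 := mul_lt_mul_of_pos_left h3 phi_pos
  replace h4 := mul_lt_mul_of_pos_left h4 phi_pos
  have m0 : psi x ∈ cell₆ := by
    simp only [cell₆, mem_ofPred_eq, ca_psi, cb_psi]
    refine ⟨?_, ?_, ?_, ?_⟩ <;> linarith
  have m1 : psi x + pt (1 - phi) 0 ∈ cell₃ := by
    simp only [cell₃, mem_ofPred_eq, map_add, ca_pt, cb_pt, ca_psi, cb_psi]
    refine ⟨?_, ?_, ?_⟩ <;> linarith
  have m2 : psi x + pt (1 - phi) 0 + pt 0 (phi - 1) ∈ cell₁ := by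
    simp only [cell₁, mem_ofPred_eq, map_add, ca_pt, cb_pt, ca_psi, cb_psi]
    refine ⟨?_, ?_, ?_⟩ <;> linarith
  refine ⟨?_, ?_, ?_⟩
  · change stepMap (stepMap (stepMap (psi x))) = _
    rw [e, stepMap_cell₆ m0, stepMap_cell₃ m1, stepMap_cell₁ m2]
    apply plane_ext_coord <;> simp only [map_add, ca_pt, cb_pt, ca_psi, cb_psi] <;> linarith
  · rw [ca_psi]; linarith
  · rw [stepMap_cell₆ m0, map_add, ca_pt, ca_psi]; linarith

lemma psi_cell₅ {x : Plane} (hx : x ∈ cell₅) : stepMap^[2] (psi x) = psi (stepMap x) ∧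
    ca (psi x) < 1 / 2 - phi ∧ 1 / 2 - phi ≤ ca (stepMap (psi x)) := by
  have e := stepMap_cell₅ hx
  have hp := phi_sq
  have hg := phi_gt
  have hl := phi_lt
  obtain ⟨h1, h2, h3⟩ := hx
  replace h1 := mul_lt_mul_of_pos_left h1 phi_pos
  replace h2 := mul_lt_mul_of_pos_left h2 phi_pos
  replace h3 := mul_lt_mul_of_pos_left h3 phi_pos
  have m0 : psi x ∈ cell₆ := by
    simp only [cell₆, mem_ofPred_eq, ca_psi, cb_psi]
    refine ⟨?_, ?_, ?_, ?_⟩ <;> linarith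
  have m1 : psi x + pt (1 - phi) 0 ∈ cell₂ := by
    simp only [cell₂, mem_ofPred_eq, map_add, ca_pt, cb_pt, ca_psi, cb_psi]
    refine ⟨?_, ?_, ?_, ?_⟩ <;> linarith
  refine ⟨?_, ?_, ?_⟩
  · change stepMap (stepMap (psi x)) = _
    rw [e, stepMap_cell₆ m0, stepMap_cell₂ m1]
    apply plane_ext_coord <;> simp only [map_add, ca_pt, cb_pt, ca_psi, cb_psi] <;> linarith
  · rw [ca_psi]; linarith
  · rw [stepMap_cell₆ m0, map_add, ca_pt, ca_psi]; linarith

lemma psi_cell₆ {x : Plane} (hx : x ∈ cell₆) : stepMap^[2] (psi x) = psi (stepMap x) ∧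
    ca (psi x) < 1 / 2 - phi ∧ 1 / 2 - phi ≤ ca (stepMap (psi x)) := by
  have e := stepMap_cell₆ hx
  have hp := phi_sq
  have hg := phi_gt
  have hl := phi_lt
  obtain ⟨h1, h2, h3, h4⟩ := hx
  replace h1 := mul_lt_mul_of_pos_left h1 phi_pos
  replace h2 := mul_lt_mul_of_pos_left h2 phi_pos
  replace h3 := mul_lt_mul_of_pos_left h3 phi_pos
  replace h4 := mul_lt_mul_of_pos_left h4 phi_pos
  have m0 : psi x ∈ cell₆ := by
    simp only [cell₆, mem_ofPred_eq, ca_psi, cb_psi]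
    refine ⟨?_, ?_, ?_, ?_⟩ <;> linarith
  have m1 : psi x + pt (1 - phi) 0 ∈ cell₇ := by
    simp only [cell₇, mem_ofPred_eq, map_add, ca_pt, cb_pt, ca_psi, cb_psi]
    refine ⟨?_, ?_, ?_, ?_⟩ <;> linarith
  refine ⟨?_, ?_, ?_⟩
  · change stepMap (stepMap (psi x)) = _
    rw [e, stepMap_cell₆ m0, stepMap_cell₇ m1]
    apply plane_ext_coord <;> simp only [map_add, ca_pt, cb_pt, ca_psi, cb_psi] <;> linarith
  · rw [ca_psi]; linarith
  · rw [stepMap_cell₆ m0, map_add, ca_pt, ca_psi]; linarith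

lemma psi_cell₇ {x : Plane} (hx : x ∈ cell₇) : stepMap^[3] (psi x) = psi (stepMap x) ∧
    ca (psi x) < 1 / 2 - phi ∧ 1 / 2 - phi ≤ ca (stepMap (psi x)) := by
  have e := stepMap_cell₇ hx
  have hp := phi_sq
  have hg := phi_gt
  have hl := phi_lt
  obtain ⟨h1, h2, h3, h4⟩ := hx
  replace h1 := mul_lt_mul_of_pos_left h1 phi_pos
  replace h2 := mul_lt_mul_of_pos_left h2 phi_pos
  replace h3 := mul_lt_mul_of_pos_left h3 phi_pos
  replace h4 := mul_lt_mul_of_pos_left h4 phi_pos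
  have m0 : psi x ∈ cell₆ := by
    simp only [cell₆, mem_ofPred_eq, ca_psi, cb_psi]
    refine ⟨?_, ?_, ?_, ?_⟩ <;> linarith
  have m1 : psi x + pt (1 - phi) 0 ∈ cell₆ := by
    simp only [cell₆, mem_ofPred_eq, map_add, ca_pt, cb_pt, ca_psi, cb_psi]
    refine ⟨?_, ?_, ?_, ?_⟩ <;> linarith
  have m2 : psi x + pt (1 - phi) 0 + pt (1 - phi) 0 ∈ cell₂ := by
    simp only [cell₂, mem_ofPred_eq, map_add, ca_pt, cb_pt, ca_psi, cb_psi]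
    refine ⟨?_, ?_, ?_, ?_⟩ <;> linarith
  refine ⟨?_, ?_, ?_⟩
  · change stepMap (stepMap (stepMap (psi x))) = _
    rw [e, stepMap_cell₆ m0, stepMap_cell₆ m1, stepMap_cell₂ m2]
    apply plane_ext_coord <;> simp only [map_add, ca_pt, cb_pt, ca_psi, cb_psi] <;> linarith
  · rw [ca_psi]; linarith
  · rw [stepMap_cell₆ m0, map_add, ca_pt, ca_psi]; linarith

lemma psi_cellB {x : Plane} (hx : x ∈ cellB) : stepMap^[5] (psi x) = psi (stepMap x) ∧
    ca (psi x) < 1 / 2 - phi ∧ 1 / 2 - phi ≤ ca (stepMap (psi x)) := by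
  have e := stepMap_cellB hx
  have hp := phi_sq
  have hg := phi_gt
  have hl := phi_lt
  obtain ⟨h1, h2, h3⟩ := hx
  replace h1 := mul_lt_mul_of_pos_left h1 phi_pos
  replace h2 := mul_lt_mul_of_pos_left h2 phi_pos
  replace h3 := mul_lt_mul_of_pos_left h3 phi_pos
  have m0 : psi x ∈ cell₆ := by
    simp only [cell₆, mem_ofPred_eq, ca_psi, cb_psi]
    refine ⟨?_, ?_, ?_, ?_⟩ <;> linarith
  have m1 : psi x + pt (1 - phi) 0 ∈ cell₆ := by
    simp only [cell₆, mem_ofPred_eq, map_add, ca_pt, cb_pt, ca_psi, cb_psi]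
    refine ⟨?_, ?_, ?_, ?_⟩ <;> linarith
  have m2 : psi x + pt (1 - phi) 0 + pt (1 - phi) 0 ∈ cell₃ := by
    simp only [cell₃, mem_ofPred_eq, map_add, ca_pt, cb_pt, ca_psi, cb_psi]
    refine ⟨?_, ?_, ?_⟩ <;> linarith
  have m3 : psi x + pt (1 - phi) 0 + pt (1 - phi) 0 + pt 0 (phi - 1) ∈ cell₁ := by
    simp only [cell₁, mem_ofPred_eq, map_add, ca_pt, cb_pt, ca_psi, cb_psi]
    refine ⟨?_, ?_, ?_⟩ <;> linarith
  have m4 : psi x + pt (1 - phi) 0 + pt (1 - phi) 0 + pt 0 (phi - 1) + pt (phi - 1) 0 ∈ cell₅ := by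
    simp only [cell₅, mem_ofPred_eq, map_add, ca_pt, cb_pt, ca_psi, cb_psi]
    refine ⟨?_, ?_, ?_⟩ <;> linarith
  refine ⟨?_, ?_, ?_⟩
  · change stepMap (stepMap (stepMap (stepMap (stepMap (psi x))))) = _
    rw [e, stepMap_cell₆ m0, stepMap_cell₆ m1, stepMap_cell₃ m2, stepMap_cell₁ m3, stepMap_cell₅ m4]
    apply plane_ext_coord <;> simp only [map_add, ca_pt, cb_pt, ca_psi, cb_psi] <;> linarith
  · rw [ca_psi]; linarith
  · rw [stepMap_cell₆ m0, map_add, ca_pt, ca_psi]; linarith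

/-- The points of `s` reach the rescaled gaps of level `j`. -/
def Returns (j : ℕ) (s : Set Plane) : Prop :=
  ∀ y ∈ s, ∃ m x δ, IsGap j δ ∧ x ∈ δ ∧ stepMap^[m] y = psi x

lemma Move.returns {δ δ' : Set Plane} {d : Plane} {j : ℕ} (h : Move δ d δ') (h' : Returns j δ') :
    Returns j δ := by
  intro y hy
  obtain ⟨m, x, ε, h1, h2, h3⟩ := h' (stepMap y) (h.image_step ▸ mem_image_of_mem _ hy)
  exact ⟨m + 1, x, ε, h1, h2, by rwa [Function.iterate_succ_apply]⟩

/-- All triangles of `t`, except those of level zero, reach the rescaled gaps of the previous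
level. -/
def Frame.Returning (t : Frame) : Prop := ∀ j δ, Tri t (j + 1) δ → Returns j δ

lemma Carries.returning {t t' : Frame} {d : Plane} (h : Carries t d t') (h' : t'.Returning) :
    t.Returning := by
  intro j δ hδ
  obtain ⟨δ', h1, h2⟩ := h.exists_move hδ
  exact h2.returns (h' j δ' h1)

lemma returning_map {t : Frame} (h : ∀ j δ, Tri t j δ → IsGap j δ) : (t.map psi 1).Returning := by
  intro j δ hδ y hy
  obtain ⟨i, ε, h1, h2, rfl⟩ := hδ.exists_of_map
  obtain rfl : j = i := by omega
  obtain ⟨x, hx, rfl⟩ := hy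
  exact ⟨0, x, ε, h _ _ h1, hx, rfl⟩

/-- Of the five pieces, `left` and `inner` are psi-images of B and C, the two pieces in `right` move
in one step into `left`, and the lower triangle has scale zero, which j + 1 excludes. -/
lemma fA_returning : fA.Returning := by
  have hl : fA.left.Returning := by
    rw [fA_left_eq_map]; exact returning_map fun _ _ h => .inr (.inl h)
  have hi : fA.inner.Returning := by
    rw [fA_inner_eq_map]; exact returning_map fun _ _ h => .inr (.inr h)
  intro j δ h
  rcases h.cases_inner with h | ⟨hk, rfl⟩ | h | ⟨hk, rfl⟩ | h
  · exact hi _ _ h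
  · simp [fA, fr] at hk
  · exact hl _ _ h
  · refine move_fA_right_bot.returns (hl j _ ?_)
    rw [hk]; exact .bot fA.left
  · exact carries_fA_right_left.returning (fun _ _ h => hl _ _ (.left h)) _ _ h

/-- The right frame moves into A, the mirrored inner frame moves onto the psi-image `fB.left` of A,
and the pieces of the left frame move into the right one. -/
lemma fC_returning : fC.Returning := by
  have hr : fC.right.Returning :=
    carries_fC_right.returning fun _ _ h => fA_returning _ _ (.right h)
  intro j δ h
  rcases h.cases_inner_mirror with h | ⟨hk, rfl⟩ | h | ⟨hk, rfl⟩ | h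
  · refine carries_fC_mirror_inner.returning ?_ _ _ h
    rw [fB_left_eq_map]; exact returning_map fun _ _ h => .inl h
  · simp [fC, fr] at hk
  · exact hr _ _ h
  · refine move_fC_left_bot.returns (hr j _ ?_)
    rw [hk]; exact .bot fC.right
  · exact carries_fC_left_left.returning (fun _ _ h => hr _ _ (.left h)) _ _ h

/-- The left frame is the psi-image of A; the right frame moves into A and the mirrored inner frame
into C, which are already settled. -/
lemma fB_returning : fB.Returning := by
  have hl : fB.left.Returning := by
    rw [fB_left_eq_map]; exact returning_map fun _ _ h => .inl h
  intro j δ h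
  rcases h.cases_inner_mirror with h | ⟨hk, rfl⟩ | h | ⟨hk, rfl⟩ | h
  · exact carries_fB_mirror_inner.returning (fun _ _ h => fC_returning _ _ (.left h)) _ _ h
  · simp [fB, fA, fr, Frame.turn] at hk
  · exact carries_fB_right.returning
      (fun _ _ h => fA_returning _ _ h.of_inner.of_mirror) _ _ h
  · refine hl j _ ?_
    rw [hk]; exact .bot fB.left
  · exact hl _ _ (.left h)

namespace IsGap
variable {j : ℕ} {δ : Set Plane} {x : Plane}

lemma returns (h : IsGap (j + 1) δ) : Returns j δ := by
  rcases h with h | h | h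
  · exact fA_returning _ _ h
  · exact fB_returning _ _ h
  · exact fC_returning _ _ h

lemma psi_stepMap (h : IsGap j δ) (hx : x ∈ δ) :
    (∃ m, stepMap^[m] (psi x) = psi (stepMap x)) ∧
      ca (psi x) < 1 / 2 - phi ∧ 1 / 2 - phi ≤ ca (stepMap (psi x)) := by
  rcases h.subset_cells hx with h | h | h | h | h | h | h | h
  · exact (psi_cell₁ h).imp_left fun h => ⟨_, h⟩
  · exact (psi_cell₂ h).imp_left fun h => ⟨_, h⟩
  · exact (psi_cell₃ h).imp_left fun h => ⟨_, h⟩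
  · exact (psi_cell₄ h).imp_left fun h => ⟨_, h⟩
  · exact (psi_cell₅ h).imp_left fun h => ⟨_, h⟩
  · exact (psi_cell₆ h).imp_left fun h => ⟨_, h⟩
  · exact (psi_cell₇ h).imp_left fun h => ⟨_, h⟩
  · exact (psi_cellB h).imp_left fun h => ⟨_, h⟩

lemma iterate_mem (h : IsGap j δ) (hx : x ∈ δ) (n : ℕ) :
    ∃ ε, IsGap j ε ∧ stepMap^[n] x ∈ ε := by
  obtain ⟨d, h1, -⟩ := h.exists_iterate n
  exact ⟨_, h1, mem_image_of_mem _ hx⟩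

lemma mem_periodicPts (h : IsGap j δ) (hx : x ∈ δ) : x ∈ Function.periodicPts stepMap := by
  obtain ⟨n, hn, h1⟩ := h.exists_period
  exact ⟨n, hn, h1 x hx⟩

/-- The orbit of psi x contains the psi-image T of the orbit of x, which has as many points as the
period of x, and also the point after psi x, which is not in T. Counting gives the strict
inequality. -/
lemma minimalPeriod_psi (h : IsGap j δ) (hx : x ∈ δ)
    (hz : psi x ∈ Function.periodicPts stepMap) :
    Function.minimalPeriod stepMap x < Function.minimalPeriod stepMap (psi x) := by
  classical
  set p := Function.minimalPeriod stepMap x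
  set N := Function.minimalPeriod stepMap (psi x)
  have horb : ∀ i, ∃ m, stepMap^[m] (psi x) = psi (stepMap^[i] x) := by
    intro i
    induction i with
    | zero => exact ⟨0, rfl⟩
    | succ i ih =>
      obtain ⟨m, hm⟩ := ih
      obtain ⟨ε, hε, hxε⟩ := h.iterate_mem hx i
      obtain ⟨m', hm'⟩ := (hε.psi_stepMap hxε).1
      exact ⟨m' + m, by rw [Function.iterate_add_apply, hm, hm', Function.iterate_succ_apply']⟩
  let S := (Finset.range N).image fun i => stepMap^[i] (psi x)
  have hS : ∀ m, stepMap^[m] (psi x) ∈ S := fun m => Finset.mem_image.2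
    ⟨m % N, Finset.mem_range.2 (Nat.mod_lt _ (Function.minimalPeriod_pos_of_mem_periodicPts hz)),
      Function.iterate_mod_minimalPeriod_eq⟩
  let T := (Finset.range p).image fun i => psi (stepMap^[i] x)
  have hT : T.card = p := by
    rw [Finset.card_image_of_injOn, Finset.card_range]
    intro i hi i' hi' hii
    exact Function.iterate_injOn_Iio_minimalPeriod (Finset.mem_range.1 hi) (Finset.mem_range.1 hi')
      (psi.injective hii)
  -- Points of T satisfy `ca` < 1/2 - φ, and this point does not.
  have hnot : stepMap (psi x) ∉ T := by
    intro hmem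
    obtain ⟨i, -, hi⟩ := Finset.mem_image.1 hmem
    obtain ⟨ε, hε, hxε⟩ := h.iterate_mem hx i
    have h1 := (hε.psi_stepMap hxε).2.1
    have h2 := (h.psi_stepMap hx).2.2
    rw [← hi] at h2
    exact absurd h1 (not_lt.2 h2)
  have hsub : insert (stepMap (psi x)) T ⊆ S := by
    intro y hy
    rcases Finset.mem_insert.1 hy with rfl | hy
    · exact hS 1
    · obtain ⟨i, -, rfl⟩ := Finset.mem_image.1 hy
      obtain ⟨m, hm⟩ := horb i
      rw [← hm]; exact hS m
  have h1 := Finset.card_le_card hsub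
  rw [Finset.card_insert_of_notMem hnot, hT] at h1
  exact h1.trans (Finset.card_image_le.trans (Finset.card_range N).le)

/-- Some iterate of x is psi y with y in a gap of the previous scale. Iterates of a periodic point
share its minimal period, and `psi` raises that of y by at least one. -/
lemma le_minimalPeriod (h : IsGap j δ) (hx : x ∈ δ) : j < Function.minimalPeriod stepMap x := by
  induction j generalizing δ x with
  | zero => exact Function.minimalPeriod_pos_of_mem_periodicPts (h.mem_periodicPts hx)
  | succ j ih =>
    obtain ⟨m, y, ε, hε, hy, hm⟩ := h.returns x hx
    have hp := h.mem_periodicPts hx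
    have h1 := Function.minimalPeriod_apply_iterate hp m
    obtain ⟨ε', hε', hz⟩ := h.iterate_mem hx m
    have hz' := hε'.mem_periodicPts hz
    rw [hm] at hz' h1
    have h2 := hε.minimalPeriod_psi hy hz'
    have h3 := ih hε hy
    omega

end IsGap

/-! ### Periodic tiles -/

lemma cutPaste_mem {p : Plane} (hp : p ∈ domainX phi) : cutPaste phi p ∈ domainX phi := by
  have h1 := phi_gt
  have h2 := phi_lt
  by_cases h : p ∈ cutPiece phi
  · rw [cutPaste_of_mem h]
    rw [mem_cutPiece] at h
    rw [mem_domainX]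
    simp only [map_add, ca_pt, cb_pt]
    refine ⟨?_, ?_, ?_, ?_⟩ <;> linarith
  · rw [cutPaste_of_notMem h]
    rw [mem_cutPiece] at h
    rw [mem_domainX] at hp ⊢
    have h3 : 1 / 2 - phi < ca p := by
      by_contra h4
      exact h ⟨hp.1, not_lt.1 h4, hp.2.2⟩
    simp only [map_add, ca_pt, cb_pt]
    refine ⟨?_, ?_, ?_, ?_⟩ <;> linarith

/-- The images of the two pieces lie on opposite sides of the seam, so injectivity can fail only
there. -/
lemma cutPaste_eq {p q : Plane} (hp : p ∈ domainX phi) (hq : q ∈ domainX phi)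
    (h : cutPaste phi p = cutPaste phi q) (hc : ca (cutPaste phi p) ≠ phi - 1 / 2) : p = q := by
  have hle : ∀ p ∈ cutPiece phi, phi - 1 / 2 ≤ ca (cutPaste phi p) := by
    intro p hp
    rw [cutPaste_of_mem hp, map_add, ca_pt]
    linarith [((mem_cutPiece p).1 hp).1]
  have hge : ∀ p ∈ domainX phi, p ∉ cutPiece phi → ca (cutPaste phi p) ≤ phi - 1 / 2 := by
    intro p hp h
    rw [cutPaste_of_notMem h, map_add, ca_pt]
    linarith [((mem_domainX p).1 hp).2.1]
  by_cases h1 : p ∈ cutPiece phi <;> by_cases h2 : q ∈ cutPiece phi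
  · rw [cutPaste_of_mem h1, cutPaste_of_mem h2] at h
    exact add_right_cancel h
  · exact absurd (le_antisymm (h ▸ hge q hq h2) (hle p h1)) hc
  · exact absurd (le_antisymm (hge p hp h1) (h ▸ hle q h2)) hc
  · rw [cutPaste_of_notMem h1, cutPaste_of_notMem h2] at h
    exact add_right_cancel h

lemma latticeStep_unique {s : ℝ} {i : Fin 3} {p q q' : Plane} (h : latticeStep s i p q)
    (h' : latticeStep s i p q') : q = q' :=
  h'.2.2.2 q h.2.1 h.2.2.1

lemma tripleStep_unique {s : ℝ} {p q q' : Plane} (h : tripleStep s p q) (h' : tripleStep s p q') :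
    q = q' := by
  obtain ⟨p₁, p₂, h1, h2, h3⟩ := h
  obtain ⟨p₁', p₂', h1', h2', h3'⟩ := h'
  obtain rfl := latticeStep_unique h1 h1'
  obtain rfl := latticeStep_unique h2 h2'
  exact add_right_cancel (latticeStep_unique h3 h3')

lemma rawStep_unique {x y y' : Plane} (hx : ca x ≠ phi - 1 / 2) (h : rawStep phi x y)
    (h' : rawStep phi x y') : y = y' := by
  obtain ⟨p, hp, q, hq, rfl, rfl, h1⟩ := h
  obtain ⟨p', hp', q', hq', he, rfl, h1'⟩ := h'
  obtain rfl := cutPaste_eq hp hp' he hx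
  rw [tripleStep_unique h1 h1']

/-- The seam has empty interior, so near p there are points off the seam; there the raw map is
single valued and fixes the displacement. -/
lemma petStep_unique {p q q' : Plane} (h : petStep phi p q) (h' : petStep phi p q') : q = q' := by
  have hnot : ¬ ∀ᶠ x in 𝓝 p, ca x = phi - 1 / 2 := by
    intro hc
    have h1 := lt_of_mem_interior ca_ne (s := {x | ca x = phi - 1 / 2}) (fun x hx => le_of_eq hx)
      (mem_interior_iff_mem_nhds.2 hc)
    exact h1.ne hc.self_of_nhds
  have hfreq : ∃ᶠ x in 𝓝 p, ca x ≠ phi - 1 / 2 := not_eventually.1 hnot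
  obtain ⟨x, hx, h1, h2⟩ := (hfreq.and_eventually (h.and h')).exists
  have := rawStep_unique hx h1 h2
  simpa using this

lemma mem_domainX_of_petStep {p q : Plane} (h : petStep phi p q) : p ∈ domainX phi := by
  obtain ⟨p', hp', _, _, h1, _⟩ := Eventually.self_of_nhds h
  rw [h1]; exact cutPaste_mem hp'

lemma isOpen_petStep (d : Plane) : IsOpen {p | petStep phi p (p + d)} := by
  simp only [petStep, add_sub_cancel_left]
  exact isOpen_setOfPred_eventually_nhds

lemma isOpen_petDomain : IsOpen (petDomain phi) := by
  have : petDomain phi = ⋃ d, {p | petStep phi p (p + d)} := by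
    ext p
    simp only [petDomain, mem_ofPred_eq, mem_iUnion]
    exact ⟨fun ⟨q, h⟩ => ⟨q - p, by simpa using h⟩, fun ⟨d, h⟩ => ⟨_, h⟩⟩
  rw [this]
  exact isOpen_iUnion isOpen_petStep

lemma isOpen_piece (p : Plane) : IsOpen (piece phi p) := isOpen_petDomain.connectedComponentIn

lemma mem_piece {p q : Plane} (h : petStep phi p q) : p ∈ piece phi p :=
  mem_connectedComponentIn ⟨q, h⟩

/-- The map is a translation on each piece. -/
lemma petStep_of_mem_piece {p q x : Plane} (h : petStep phi p q) (hx : x ∈ piece phi p) :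
    petStep phi x (x + (q - p)) := by
  -- The sets of points with a given displacement are open and pairwise disjoint, so a connected
  -- piece meets only one of them.
  have h1 : piece phi p ⊆ {x | petStep phi x (x + (q - p))} ∪
      ⋃ d ∈ ({q - p}ᶜ : Set Plane), {x | petStep phi x (x + d)} := by
    intro y hy
    obtain ⟨z, hz⟩ := connectedComponentIn_subset _ _ hy
    by_cases h2 : z - y = q - p
    · left; simpa [← h2] using hz
    · right; exact mem_biUnion (show z - y ∈ ({q - p}ᶜ : Set Plane) from h2) (by simpa using hz)
  refine isPreconnected_connectedComponentIn.subset_left_of_subset_union (isOpen_petStep _)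
    (isOpen_biUnion fun d _ => isOpen_petStep d) ?_ h1 ⟨p, mem_piece h, by simpa using h⟩ hx
  rw [disjoint_left]
  intro y h2 h3
  obtain ⟨d, hd, h4⟩ := mem_iUnion₂.1 h3
  exact hd (add_left_cancel (petStep_unique h4 h2))

lemma sub_eq_of_piece_eq {p q p' q' : Plane} (h : petStep phi p q) (h' : petStep phi p' q')
    (he : piece phi p = piece phi p') : q' - p' = q - p := by
  have h1 := petStep_of_mem_piece h (he ▸ mem_piece h')
  rw [petStep_unique h' h1, add_sub_cancel_left]

lemma IsOrbit.unique {o o' : ℕ → Plane} (h : IsOrbit phi o) (h' : IsOrbit phi o')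
    (h0 : o 0 = o' 0) : o = o' := by
  funext n
  induction n with
  | zero => exact h0
  | succ n ih => exact petStep_unique (h n) (ih ▸ h' n)

lemma IsOrbit.eq_of_eq {o : ℕ → Plane} (h : IsOrbit phi o) {n : ℕ} (hn : o n = o 0) (m : ℕ) :
    o (m + n) = o m := by
  have h1 : IsOrbit phi fun m => o (m + n) := fun m => by
    have := h (m + n)
    rwa [add_right_comm] at this
  exact congrFun (h1.unique h (by simpa using hn)) m

lemma SameCoding.symm {p q : Plane} (h : SameCoding phi p q) : SameCoding phi q p := by
  obtain ⟨o, o', h1, h2, h3, h4, h5⟩ := h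
  exact ⟨o', o, h2, h1, h4, h3, fun n => (h5 n).symm⟩

lemma SameCoding.trans {p q r : Plane} (h : SameCoding phi p q) (h' : SameCoding phi q r) :
    SameCoding phi p r := by
  obtain ⟨o, o', h1, h2, h3, h4, h5⟩ := h
  obtain ⟨o₁, o₁', h1', h2', h3', h4', h5'⟩ := h'
  obtain rfl := h2.unique h1' (h4.trans h3'.symm)
  exact ⟨o, o₁', h1, h2', h3, h4', fun n => (h5 n).trans (h5' n)⟩

/-- Points of one piece have the same displacement, so two orbits with the same coding stay at a
constant difference. -/
lemma orbit_eq_add {o o' : ℕ → Plane} (h : IsOrbit phi o) (h' : IsOrbit phi o')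
    (hp : ∀ n, piece phi (o n) = piece phi (o' n)) (n : ℕ) : o' n = o' 0 + (o n - o 0) := by
  induction n with
  | zero => simp
  | succ n ih =>
    have := sub_eq_of_piece_eq (h n) (h' n) (hp n)
    rw [sub_eq_iff_eq_add.1 this, ih]; abel

namespace periodicTiles
variable {T T' : Set Plane}

lemma eq_of_mem (hT : T ∈ periodicTiles phi) (hT' : T' ∈ periodicTiles phi) {x : Plane}
    (hx : x ∈ T) (hx' : x ∈ T') : T = T' := by
  obtain ⟨p, -, rfl⟩ := hT
  obtain ⟨p', -, rfl⟩ := hT'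
  have h : SameCoding phi p x := hx
  have h' : SameCoding phi p' x := hx'
  ext q
  exact ⟨fun hq => (h'.trans h.symm).trans hq, fun hq => (h.trans h'.symm).trans hq⟩

lemma subset_domainX (hT : T ∈ periodicTiles phi) : T ⊆ domainX phi := by
  obtain ⟨p, -, rfl⟩ := hT
  rintro q ⟨o, o', h1, h2, h3, rfl, h5⟩
  exact mem_domainX_of_petStep (h2 0)

/-- The points of a tile have a common period. -/
lemma exists_period (hT : T ∈ periodicTiles phi) : ∃ n, 0 < n ∧ ∀ o : ℕ → Plane, IsOrbit phi o →
    o 0 ∈ T → o n = o 0 := by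
  obtain ⟨p, ⟨o, ho, rfl, n, hn, hp⟩, rfl⟩ := hT
  refine ⟨n, hn, fun o₂ ho₂ h => ?_⟩
  obtain ⟨o₁, o₁', h1, h2, h3, h4, h5⟩ := h
  obtain rfl := h1.unique ho h3
  obtain rfl := h2.unique ho₂ h4
  rw [orbit_eq_add h1 h2 h5 n, hp, sub_self, add_zero]

/-- By periodicity, following the coding of p imposes only finitely many conditions on q, each being
membership of a translate of q in an open piece. -/
lemma isOpen (hT : T ∈ periodicTiles phi) : IsOpen T := by
  obtain ⟨p, ⟨o, ho, rfl, n, hn, hp⟩, rfl⟩ := hT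
  have hT : {q | SameCoding phi (o 0) q} =
      ⋂ m ∈ Finset.range n, {q | q + (o m - o 0) ∈ piece phi (o m)} := by
    have hmod : ∀ m, o (m % n) = o m := by
      intro m
      induction m using Nat.strong_induction_on with
      | _ m ih =>
        rcases Nat.lt_or_ge m n with h | h
        · rw [Nat.mod_eq_of_lt h]
        · rw [Nat.mod_eq_sub_mod h, ih (m - n) (by omega), ← ho.eq_of_eq hp, Nat.sub_add_cancel h]
    ext q
    simp only [mem_ofPred_eq, mem_iInter, Finset.mem_range]
    constructor
    · rintro ⟨o₁, o', h1, h2, h3, rfl, h5⟩ m -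
      obtain rfl := h1.unique ho h3
      rw [← orbit_eq_add h1 h2 h5 m, h5 m]
      exact mem_piece (h2 m)
    · intro h
      have h' : ∀ m, q + (o m - o 0) ∈ piece phi (o m) := fun m => by
        rw [← hmod m]; exact h _ (Nat.mod_lt _ hn)
      refine ⟨o, fun m => q + (o m - o 0), ho, fun m => ?_, rfl, by simp, fun m => ?_⟩
      · have := petStep_of_mem_piece (ho m) (h' m)
        convert this using 1; abel_nf
      · exact connectedComponentIn_eq (h' m)
  rw [hT]
  refine isOpen_biInter_finset fun m _ => (isOpen_piece _).preimage ?_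
  fun_prop

end periodicTiles

/-- A connected set on which all iterates of the map are translations by a constant vector, one of
them trivial. -/
structure Recurrent (δ : Set Plane) : Prop where
  preconnected : ∀ n, IsPreconnected (stepMap^[n] '' δ)
  pet : ∀ n, ∀ x ∈ stepMap^[n] '' δ, petStep phi x (stepMap x)
  period : ∃ n, 0 < n ∧ ∀ x ∈ δ, stepMap^[n] x = x

namespace Recurrent
variable {δ : Set Plane} {x y : Plane}

lemma isOrbit (h : Recurrent δ) (hx : x ∈ δ) : IsOrbit phi fun n => stepMap^[n] x := by
  intro n
  simp only [Function.iterate_succ_apply']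
  exact h.pet n _ (mem_image_of_mem _ hx)

/-- Each image of δ is connected and lies in the domain of f, hence in one component of it. -/
lemma sameCoding (h : Recurrent δ) (hx : x ∈ δ) (hy : y ∈ δ) : SameCoding phi x y := by
  refine ⟨_, _, h.isOrbit hx, h.isOrbit hy, rfl, rfl, fun n => connectedComponentIn_eq ?_⟩
  exact (h.preconnected n).subset_connectedComponentIn (mem_image_of_mem _ hx)
    (fun z hz => (⟨_, h.pet n z hz⟩ : ∃ q, petStep phi z q)) (mem_image_of_mem _ hy)

lemma exists_tile (h : Recurrent δ) (hne : δ.Nonempty) : ∃ T ∈ periodicTiles phi, δ ⊆ T := by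
  obtain ⟨x, hx⟩ := hne
  obtain ⟨n, hn, hp⟩ := h.period
  exact ⟨{q | SameCoding phi x q}, ⟨x, ⟨_, h.isOrbit hx, rfl, n, hn, hp x hx⟩, rfl⟩,
    fun y hy => h.sameCoding hx hy⟩

lemma of_fixed (hc : IsPreconnected δ) (hs : ∀ x ∈ δ, stepMap x = x)
    (hp : ∀ x ∈ δ, petStep phi x (stepMap x)) : Recurrent δ := by
  have h : ∀ n, stepMap^[n] '' δ = δ := by
    intro n
    induction n with
    | zero => simp
    | succ n ih =>
      rw [Function.iterate_succ', image_comp, ih, image_congr hs, image_id']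
  exact ⟨fun n => by rwa [h], fun n => by rwa [h], 1, one_pos, by simpa using hs⟩

end Recurrent

lemma IsGap.recurrent {j : ℕ} {δ : Set Plane} (h : IsGap j δ) : Recurrent δ where
  preconnected n := by
    obtain ⟨d, h1, -⟩ := h.exists_iterate n
    exact h1.convex.isPreconnected
  pet n := by
    obtain ⟨d, h1, -⟩ := h.exists_iterate n
    obtain ⟨d', δ', -, h2⟩ := h1.exists_move
    exact h2.pet
  period := h.exists_period

/-! ### The marked trapezoids -/

lemma trapA_eq : trapA phi = fA.toTrapezoid := by
  have h := phi_sq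
  have h3 : √3 ^ 2 = 3 := Real.sq_sqrt (by norm_num)
  simp only [trapA, Frame.toTrapezoid, fA, fr, Trapezoid.mk.injEq]
  refine ⟨?_, ?_, ?_, ?_⟩ <;> ext i <;> fin_cases i <;> simp [topLeft, pt, vec] <;> grind

lemma trapB_eq : trapB phi = fB.toTrapezoid := by
  have h := phi_sq
  have h3 : √3 ^ 2 = 3 := Real.sq_sqrt (by norm_num)
  rw [trapB, trapA_eq]
  simp only [Trapezoid.map, Frame.toTrapezoid, fB_eq, fA, fr, Trapezoid.mk.injEq]
  refine ⟨?_, ?_, ?_, ?_⟩ <;> ext i <;> fin_cases i <;> simp [rotationMu, topLeft, pt, vec] <;>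
    grind

lemma trapC_eq : trapC phi = fC.toTrapezoid := by
  have h := phi_sq
  have h3 : √3 ^ 2 = 3 := Real.sq_sqrt (by norm_num)
  rw [trapC, trapA_eq]
  simp only [Trapezoid.map, Frame.toTrapezoid, fC, fA, fr, Trapezoid.mk.injEq]
  refine ⟨?_, ?_, ?_, ?_⟩ <;> ext i <;> fin_cases i <;> simp [reflectionNu, pt, vec] <;> grind

/-- The frames of the marked trapezoids of level `n`. -/
def level : ℕ → Set Frame
  | 0 => {fA, fB, fC}
  | n + 1 => ⋃ t ∈ level n, {t.left, t.top, t.right}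

lemma mem_level_succ {n : ℕ} {t : Frame} :
    t ∈ level (n + 1) ↔ ∃ s ∈ level n, t = s.left ∨ t = s.top ∨ t = s.right := by
  simp [level]

lemma marked_eq (n : ℕ) : marked n = Frame.toTrapezoid '' level n := by
  induction n with
  | zero => simp [marked, level, image_insert_eq, trapA_eq, trapB_eq, trapC_eq]
  | succ n ih =>
    simp only [marked, level, ih, biUnion_image, image_iUnion₂, image_insert_eq, image_singleton,
      Trapezoid.substitution, Frame.left_toTrapezoid, Frame.top_toTrapezoid,
      Frame.right_toTrapezoid]

lemma chain_eq (n : ℕ) : chain n = ⋃ t ∈ level n, t.region := by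
  rw [chain, marked_eq, biUnion_image]; rfl

lemma mem_chain {n : ℕ} {p : Plane} : p ∈ chain n ↔ ∃ t ∈ level n, p ∈ t.region := by
  simp [chain_eq]

lemma finite_level (n : ℕ) : (level n).Finite := by
  induction n with
  | zero => exact toFinite ({fA, fB, fC} : Set Frame)
  | succ n ih => exact ih.biUnion fun _ _ => toFinite _

lemma equilateral_of_mem_level {n : ℕ} {t : Frame} (ht : t ∈ level n) : t.Equilateral := by
  induction n generalizing t with
  | zero =>
    rcases ht with rfl | rfl | rfl
    exacts [fA_equilateral, fB_equilateral, fC_equilateral]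
  | succ n ih =>
    obtain ⟨s, hs, rfl | rfl | rfl⟩ := mem_level_succ.1 ht
    exacts [(ih hs).left, (ih hs).top, (ih hs).right]

lemma k_of_mem_level {n : ℕ} {t : Frame} (ht : t ∈ level n) : n ≤ t.k ∧ t.k ≤ 2 * n := by
  induction n generalizing t with
  | zero =>
    rcases ht with rfl | rfl | rfl <;> simp [fA, fB, fC, fr, Frame.turn]
  | succ n ih =>
    obtain ⟨s, hs, rfl | rfl | rfl⟩ := mem_level_succ.1 ht <;> have := ih hs <;>
      simp only [Frame.left, Frame.top, Frame.right] <;> omega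

lemma isGap_of_mem_level {n j : ℕ} {t : Frame} {δ : Set Plane} (ht : t ∈ level n)
    (h : Tri t j δ) : IsGap j δ := by
  induction n generalizing t with
  | zero =>
    rcases ht with rfl | rfl | rfl
    exacts [.inl h, .inr (.inl h), .inr (.inr h)]
  | succ n ih =>
    obtain ⟨s, hs, rfl | rfl | rfl⟩ := mem_level_succ.1 ht
    exacts [ih hs (.left h), ih hs (.top h), ih hs (.right h)]

lemma disjoint_fA_fB : Disjoint (interior fA.region) (interior fB.region) := by
  have h0 := phi_pos
  refine disjoint_interior cs_ne (c := phi / 2 - 1 / 2) ?_ ?_ <;> intro p hp <;>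
    obtain ⟨x, y, h1, h2, h3, h4, rfl⟩ := (Frame.mem_region _ p).1 hp <;>
    simp [Frame.para, fA, fB_eq, fr] <;> nlinarith

lemma disjoint_fA_fC : Disjoint (interior fA.region) (interior fC.region) := by
  have h0 := phi_pos
  refine disjoint_interior ca_ne (c := phi - 1 / 2) ?_ ?_ <;> intro p hp <;>
    obtain ⟨x, y, h1, h2, h3, h4, rfl⟩ := (Frame.mem_region _ p).1 hp <;>
    simp [Frame.para, fA, fC, fr] <;> nlinarith

lemma disjoint_fB_fC : Disjoint (interior fB.region) (interior fC.region) := by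
  have h0 := phi_pos
  refine disjoint_interior ca_ne (c := phi - 1 / 2) ?_ ?_ <;> intro p hp <;>
    obtain ⟨x, y, h1, h2, h3, h4, rfl⟩ := (Frame.mem_region _ p).1 hp <;>
    simp [Frame.para, fB_eq, fC, fr] <;> nlinarith

lemma pairwise_level (n : ℕ) :
    (level n).Pairwise fun t t' => Disjoint (interior t.region) (interior t'.region) := by
  induction n with
  | zero =>
    rintro t (rfl | rfl | rfl) t' (rfl | rfl | rfl) hne
    exacts [absurd rfl hne, disjoint_fA_fB, disjoint_fA_fC, disjoint_fA_fB.symm, absurd rfl hne,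
      disjoint_fB_fC, disjoint_fA_fC.symm, disjoint_fB_fC.symm, absurd rfl hne]
  | succ n ih =>
    intro t ht t' ht' hne
    have hsub : ∀ t s : Frame, (t = s.left ∨ t = s.top ∨ t = s.right) → t.region ⊆ s.region := by
      rintro t s (rfl | rfl | rfl)
      exacts [s.left_region_subset, s.top_region_subset, s.right_region_subset]
    obtain ⟨s, hs, h⟩ := mem_level_succ.1 ht
    obtain ⟨s', hs', h'⟩ := mem_level_succ.1 ht'
    by_cases he : s = s'
    · subst he
      have hE := equilateral_of_mem_level hs
      rcases h with rfl | rfl | rfl <;> rcases h' with rfl | rfl | rfl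
      exacts [absurd rfl hne, hE.disjoint_left_top, hE.disjoint_left_right,
        hE.disjoint_left_top.symm, absurd rfl hne, hE.disjoint_top_right,
        hE.disjoint_left_right.symm, hE.disjoint_top_right.symm, absurd rfl hne]
    · exact (ih hs hs' he).mono (interior_mono (hsub t s h)) (interior_mono (hsub t' s' h'))

lemma chain_succ_subset (n : ℕ) : chain (n + 1) ⊆ chain n := by
  intro p hp
  obtain ⟨t, ht, h⟩ := mem_chain.1 hp
  obtain ⟨s, hs, rfl | rfl | rfl⟩ := mem_level_succ.1 ht
  exacts [mem_chain.2 ⟨s, hs, s.left_region_subset h⟩, mem_chain.2 ⟨s, hs, s.top_region_subset h⟩,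
    mem_chain.2 ⟨s, hs, s.right_region_subset h⟩]

/-- The frame `left` keeps the vertex a, so it persists at all later levels; earlier levels are
handled by nesting. -/
lemma a_mem_chain {n : ℕ} {t : Frame} (ht : t ∈ level n) (m : ℕ) : t.a ∈ chain m := by
  have hanti : Antitone chain := antitone_nat_of_succ_le chain_succ_subset
  have h : ∀ i, ∃ s ∈ level (n + i), s.a = t.a := by
    intro i
    induction i with
    | zero => exact ⟨t, ht, rfl⟩
    | succ i ih =>
      obtain ⟨s, hs, h⟩ := ih
      exact ⟨s.left, mem_level_succ.2 ⟨s, hs, .inl rfl⟩, h⟩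
  obtain ⟨s, hs, h⟩ := h m
  exact hanti (Nat.le_add_left m n) (mem_chain.2 ⟨s, hs, h ▸ s.a_mem_region⟩)

lemma isClosed_chain (n : ℕ) : IsClosed (chain n) := by
  rw [chain_eq]
  exact (finite_level n).isClosed_biUnion fun t _ => t.isCompact_region.isClosed

/-! ### The complement of the chain is covered by finitely many tiles -/

lemma mem_closure_of_segment {s : Set Plane} {o p : Plane}
    (h : ∀ r ∈ Ioo (0 : ℝ) 1, p + r • (o - p) ∈ s) : p ∈ closure s := by
  have h1 : Tendsto (fun r : ℝ => p + r • (o - p)) (𝓝[>] 0) (𝓝 p) := by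
    have : Continuous fun r : ℝ => p + r • (o - p) := by fun_prop
    simpa using (this.tendsto 0).mono_left nhdsWithin_le_nhds
  exact mem_closure_of_tendsto h1 (eventually_of_mem (Ioo_mem_nhdsGT one_pos) h)

lemma mem_closure_cellL {p : Plane} (h1 : -1 / 2 ≤ ca p) (h2 : -phi / 2 ≤ cb p)
    (h3 : ca p + cb p ≤ 3 / 2 * phi - 3 / 2) : p ∈ closure cellL := by
  refine mem_closure_of_segment (o := pt (-1 / 2 + 1 / 10) (-phi / 2 + 1 / 10)) fun r hr => ?_
  have hg := phi_gt
  simp only [cellL, mem_ofPred_eq, map_add, map_smul, map_sub, ca_pt, cb_pt, smul_eq_mul]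
  obtain ⟨h4, h5⟩ := hr
  refine ⟨?_, ?_, ?_⟩ <;> nlinarith

lemma mem_closure_cellC {p : Plane} (h1 : ca p ≤ phi - 1 / 2) (h2 : cb p ≤ 3 / 2 * phi - 1)
    (h3 : phi / 2 - 1 / 2 ≤ ca p + cb p) : p ∈ closure cellC := by
  refine mem_closure_of_segment (o := pt (phi - 1 / 2 - 1 / 10) (3 / 2 * phi - 1 - 1 / 10))
    fun r hr => ?_
  have hg := phi_gt
  simp only [cellC, mem_ofPred_eq, map_add, map_smul, map_sub, ca_pt, cb_pt, smul_eq_mul]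
  obtain ⟨h4, h5⟩ := hr
  refine ⟨?_, ?_, ?_⟩ <;> nlinarith

lemma mem_closure_cellR {p : Plane} (h1 : ca p ≤ 1 / 2) (h2 : cb p ≤ phi / 2)
    (h3 : 3 / 2 * phi - 1 / 2 ≤ ca p + cb p) : p ∈ closure cellR := by
  refine mem_closure_of_segment (o := pt (1 / 2 - 1 / 10) (phi / 2 - 1 / 10)) fun r hr => ?_
  have hl := phi_lt
  simp only [cellR, mem_ofPred_eq, map_add, map_smul, map_sub, ca_pt, cb_pt, smul_eq_mul]
  obtain ⟨h4, h5⟩ := hr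
  refine ⟨?_, ?_, ?_⟩ <;> nlinarith

/-- Here x and y are φ times the affine coordinates of the frame, so that for A, B, C they are
linear in `ca`, `cb` without division. -/
lemma mem_region_of_coord {a b c d e f : ℝ} {k : ℕ} {p : Plane} (x y : ℝ) (h1 : 0 ≤ x) (h2 : 0 ≤ y)
    (h3 : y ≤ phi ^ 2) (h4 : x + y ≤ phi) (h5 : phi * ca p = phi * a + x * c + y * e)
    (h6 : phi * cb p = phi * b + x * d + y * f) : p ∈ (fr a b c d e f k).region := by
  have h0 := phi_pos
  refine (Frame.mem_region _ p).2 ⟨x / phi, y / phi, by positivity, by positivity, ?_, ?_, ?_⟩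
  · rw [div_le_iff₀ h0]; linarith
  · rw [← add_div, div_le_one h0]; exact h4
  · apply plane_ext_coord <;> simp only [Frame.para, fr, map_add, map_smul, ca_pt, cb_pt,
      smul_eq_mul] <;> field_simp <;> linarith

/-- X is cut by lines that carry sides of A, B, C; the three remaining parts are the closed fixed
triangles. -/
lemma mem_of_mem_domainX {p : Plane} (hp : p ∈ domainX phi) : p ∈ fA.region ∨ p ∈ fB.region ∨
    p ∈ fC.region ∨ p ∈ closure cellL ∨ p ∈ closure cellC ∨ p ∈ closure cellR := by
  obtain ⟨h1, h2, h3, h4⟩ := (mem_domainX p).1 hp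
  have hs := phi_sq
  rcases le_total (ca p + cb p) (3 / 2 * phi - 3 / 2) with h | h
  · exact .inr (.inr (.inr (.inl (mem_closure_cellL h1 h3 h))))
  rcases le_total (ca p + cb p) (phi / 2 - 1 / 2) with h' | h'
  · left
    apply mem_region_of_coord (ca p + 1 / 2) (phi / 2 - 1 / 2 - ca p - cb p) <;> linarith
  rcases le_total (phi - 1 / 2) (ca p) with h5 | h5
  · rcases le_total (ca p + cb p) (3 / 2 * phi - 1 / 2) with h6 | h6
    · right; right; left
      apply mem_region_of_coord (3 / 2 * phi - 1 / 2 - ca p - cb p) (ca p + 1 / 2 - phi) <;>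
        linarith
    · exact .inr (.inr (.inr (.inr (.inr (mem_closure_cellR h2 h4 h6)))))
  · rcases le_total (3 / 2 * phi - 1) (cb p) with h6 | h6
    · right; left
      rw [fB_eq]
      apply mem_region_of_coord (ca p + 1 / 2 + cb p - phi / 2) (phi / 2 - cb p) <;> linarith
    · exact .inr (.inr (.inr (.inr (.inl (mem_closure_cellC h5 h6 h')))))

lemma convex_cellL : Convex ℝ cellL := by
  simp only [cellL, Set.ofPred_and]
  exact (convex_halfSpace_gt ca.isLinear _).inter
    ((convex_halfSpace_gt cb.isLinear _).inter (convex_halfSpace_lt (ca + cb).isLinear _))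

lemma convex_cellC : Convex ℝ cellC := by
  simp only [cellC, Set.ofPred_and]
  exact (convex_halfSpace_lt ca.isLinear _).inter
    ((convex_halfSpace_lt cb.isLinear _).inter (convex_halfSpace_gt (ca + cb).isLinear _))

lemma convex_cellR : Convex ℝ cellR := by
  simp only [cellR, Set.ofPred_and]
  exact (convex_halfSpace_lt ca.isLinear _).inter
    ((convex_halfSpace_lt cb.isLinear _).inter (convex_halfSpace_gt (ca + cb).isLinear _))

/-- Up to finitely many closed sets that lie in closed tiles, `X` is covered by the marked
trapezoids of level `n`. -/
lemma exists_cover (n : ℕ) : ∃ G : Set (Set Plane), G.Finite ∧ (∀ δ ∈ G, Recurrent δ) ∧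
    domainX phi ⊆ chain n ∪ ⋃ δ ∈ G, closure δ := by
  induction n with
  | zero =>
    refine ⟨{cellL, cellC, cellR}, toFinite _, ?_, fun p hp => ?_⟩
    · rintro δ (rfl | rfl | rfl)
      · exact .of_fixed convex_cellL.isPreconnected (fun _ => stepMap_cellL)
          (fun _ => petStep_cellL)
      · exact .of_fixed convex_cellC.isPreconnected (fun _ => stepMap_cellC)
          (fun _ => petStep_cellC)
      · exact .of_fixed convex_cellR.isPreconnected (fun _ => stepMap_cellR)
          (fun _ => petStep_cellR)
    · have hm : ∀ t ∈ level 0, p ∈ t.region → p ∈ chain 0 := fun t ht h => mem_chain.2 ⟨t, ht, h⟩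
      rcases mem_of_mem_domainX hp with h | h | h | h | h | h
      · exact .inl (hm fA (by simp [level]) h)
      · exact .inl (hm fB (by simp [level]) h)
      · exact .inl (hm fC (by simp [level]) h)
      all_goals exact .inr (mem_biUnion (by simp) h)
  | succ n ih =>
    obtain ⟨G, h1, h2, h3⟩ := ih
    refine ⟨G ∪ (Frame.bot '' level n ∪ Frame.cap '' level n),
      h1.union (((finite_level n).image _).union ((finite_level n).image _)), ?_, fun p hp => ?_⟩
    · rintro δ (h | ⟨t, ht, rfl⟩ | ⟨t, ht, rfl⟩)
      · exact h2 δ h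
      · exact (isGap_of_mem_level ht (.bot t)).recurrent
      · exact (isGap_of_mem_level ht (.cap t)).recurrent
    · rcases h3 hp with h | h
      · obtain ⟨t, ht, hpt⟩ := mem_chain.1 h
        have hE := equilateral_of_mem_level ht
        have hm : ∀ s : Frame, s = t.left ∨ s = t.top ∨ s = t.right → p ∈ s.region →
            p ∈ chain (n + 1) :=
          fun s hs h => mem_chain.2 ⟨s, mem_level_succ.2 ⟨t, ht, hs⟩, h⟩
        rcases t.region_subset hpt with (((h | h) | h) | h) | h
        · exact .inl (hm _ (.inl rfl) h)
        · exact .inl (hm _ (.inr (.inr rfl)) h)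
        · exact .inl (hm _ (.inr (.inl rfl)) h)
        · exact .inr (mem_biUnion (.inr (.inl (mem_image_of_mem _ ht))) (hE.closure_bot h))
        · exact .inr (mem_biUnion (.inr (.inr (mem_image_of_mem _ ht))) (hE.closure_cap h))
      · exact .inr (biUnion_mono subset_union_left (fun _ _ => subset_rfl) h)

/-! ### The limit set -/

lemma limitSet_subset_closure : limitSet phi ⊆ closure (periodicPattern phi) := by
  intro p hp
  rw [mem_closure_iff_nhds]
  intro U hU
  obtain ⟨T, hT, x, hx, hxU⟩ := (hp U hU).nonempty
  exact ⟨x, hxU, T, hT, hx⟩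

/-- Off the closed level-n union, X is covered by closures of finitely many recurrent sets. An open
tile that meets such a closure meets the set itself, and a recurrent set meets only the one tile
containing it. -/
lemma limitSet_subset_chain (n : ℕ) : limitSet phi ⊆ chain n := by
  intro p hp
  by_contra hn
  obtain ⟨G, h1, h2, h3⟩ := exists_cover n
  have hU : (chain n)ᶜ ∈ 𝓝 p := (isClosed_chain n).isOpen_compl.mem_nhds hn
  refine hp _ hU (Finite.subset (s := ⋃ δ ∈ G, {T ∈ periodicTiles phi | (T ∩ δ).Nonempty}) ?_ ?_)
  · refine h1.biUnion fun δ hδ => Set.Subsingleton.finite ?_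
    rintro T ⟨hT, x, hx, hxδ⟩ T' ⟨hT', y, hy, hyδ⟩
    obtain ⟨T₀, hT₀, hsub⟩ := (h2 δ hδ).exists_tile ⟨x, hxδ⟩
    rw [periodicTiles.eq_of_mem hT hT₀ hx (hsub hxδ),
      periodicTiles.eq_of_mem hT' hT₀ hy (hsub hyδ)]
  · rintro T ⟨hT, x, hx, hxn⟩
    obtain h | h := h3 (periodicTiles.subset_domainX hT hx)
    · exact absurd h hxn
    · obtain ⟨δ, hδ, hxδ⟩ := mem_iUnion₂.1 h
      exact mem_biUnion hδ ⟨hT, mem_closure_iff.1 hxδ T (periodicTiles.isOpen hT) hx⟩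

lemma iInter_chain_subset_limitSet : ⋂ n, chain n ⊆ limitSet phi := by
  intro p hp U hU hfin
  have hp : ∀ n, p ∈ chain n := mem_iInter.1 hp
  have h0 := phi_pos
  choose! N hN using fun T (hT : T ∈ periodicTiles phi) => periodicTiles.exists_period hT
  obtain ⟨B, hB⟩ := (hfin.image N).bddAbove
  obtain ⟨ε, hε, hball⟩ := Metric.mem_nhds_iff.1 hU
  obtain ⟨n, hn⟩ := exists_pow_lt_of_lt_one (show 0 < ε / 4 by positivity)
    (show phi < 1 by linarith [phi_lt])
  obtain ⟨t, ht, hpt⟩ := mem_chain.1 (hp n)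
  have hE := equilateral_of_mem_level ht
  have hk := (k_of_mem_level ht).1
  -- If only finitely many tiles met U, B would bound their periods; a gap inside t of scale at
  -- least B has a larger period.
  obtain ⟨δ, hδ⟩ := Tri.exists_tri t (le_max_left t.k B)
  obtain ⟨x, hx⟩ := hδ.nonempty hE
  have hgap := isGap_of_mem_level ht hδ
  have hxU : x ∈ U := by
    apply hball
    have h1 := hE.dist_le (interior_subset (hδ.subset_interior hx)) hpt
    have h2 : phi ^ t.k ≤ phi ^ n := pow_le_pow_of_le_one h0.le (by linarith [phi_lt]) hk
    rw [Metric.mem_ball]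
    linarith
  obtain ⟨T, hT, hsub⟩ := hgap.recurrent.exists_tile ⟨x, hx⟩
  obtain ⟨h1, h2⟩ := hN T hT
  have h3 := h2 _ (hgap.recurrent.isOrbit hx) (hsub hx)
  have h4 : N T ≤ B := hB (mem_image_of_mem N ⟨hT, x, hsub hx, hxU⟩)
  have h5 := hgap.le_minimalPeriod hx
  have h6 : Function.minimalPeriod stepMap x ≤ N T := Function.IsPeriodicPt.minimalPeriod_le h1 h3
  have h7 := le_max_right t.k B
  omega

lemma iInter_chain : ⋂ n, chain n = limitSet phi :=
  iInter_chain_subset_limitSet.antisymm (subset_iInter limitSet_subset_chain)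

/-- A point in all unions is in the limit set, where tiles accumulate; any other point lies in the
closure of a recurrent set, which is contained in a tile. -/
lemma domainX_subset_closure : domainX phi ⊆ closure (periodicPattern phi) := by
  intro p hp
  by_cases h : p ∈ ⋂ n, chain n
  · exact limitSet_subset_closure (iInter_chain_subset_limitSet h)
  · obtain ⟨n, hn⟩ := not_forall.1 fun h' => h (mem_iInter.2 h')
    obtain ⟨G, -, h2, h3⟩ := exists_cover n
    obtain ⟨δ, hδ, hpδ⟩ := mem_iUnion₂.1 ((h3 hp).resolve_left hn)
    refine closure_mono ?_ hpδ
    intro x hx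
    obtain ⟨T, hT, hsub⟩ := (h2 δ hδ).exists_tile ⟨x, hx⟩
    exact ⟨T, hT, hsub hx⟩

lemma tendsto_hausdorffEDist_chain :
    Tendsto (fun n => Metric.hausdorffEDist (chain n) (limitSet phi)) atTop (𝓝 0) := by
  have h0 := phi_pos
  have h1 : Tendsto (fun n : ℕ => ENNReal.ofReal (4 * phi ^ n)) atTop (𝓝 0) := by
    rw [← ENNReal.ofReal_zero]
    refine ENNReal.tendsto_ofReal ?_
    simpa using (tendsto_pow_atTop_nhds_zero_of_lt_one h0.le
      (by linarith [phi_lt])).const_mul (4 : ℝ)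
  refine tendsto_of_tendsto_of_tendsto_of_le_of_le tendsto_const_nhds h1 (fun _ => zero_le)
    fun n => Metric.hausdorffEDist_le_of_mem_edist (fun p hp => ?_)
      fun p hp => ⟨p, limitSet_subset_chain n hp, by simp⟩
  obtain ⟨t, ht, hpt⟩ := mem_chain.1 hp
  -- The vertex a of a marked trapezoid lies in the limit set, at distance at most the diameter
  -- bound 4 φ^n from p.
  refine ⟨t.a, iInter_chain ▸ mem_iInter.2 (a_mem_chain ht), ?_⟩
  rw [edist_dist]
  refine ENNReal.ofReal_le_ofReal
    (((equilateral_of_mem_level ht).dist_le hpt t.a_mem_region).trans ?_)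
  have := pow_le_pow_of_le_one h0.le (by linarith [phi_lt]) (k_of_mem_level ht).1
  linarith

lemma renormMap_phi : renormMap phi = phi := by
  have h1 := phi_gt
  have h2 := phi_lt
  have h3 := phi_sq
  rw [renormMap, if_neg (by linarith), if_pos (by linarith), renormMap₂, ← h3, sq,
    mul_div_cancel_right₀ _ phi_pos.ne']

end
end TripleLattice

theorem mainTheorem2 :
    TripleLattice.renormMap TripleLattice.phi = TripleLattice.phi ∧
    -- the periodic pattern is dense, so that the limit set is defined
    TripleLattice.domainX TripleLattice.phi ⊆
      closure (TripleLattice.periodicPattern TripleLattice.phi) ∧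
    -- at each level there are finitely many marked trapezoids, all similar to the fundamental
    -- ones, shrinking with the level, and with pairwise disjoint interiors
    (∀ n, (TripleLattice.marked n).Finite ∧
      (∀ t ∈ TripleLattice.marked n, ∃ k, n ≤ k ∧ k ≤ 2 * n ∧
        t.IsGolden (2 * TripleLattice.phi ^ (k + 1))) ∧
      (TripleLattice.marked n).Pairwise
        (fun t t' => Disjoint (interior t.region) (interior t'.region))) ∧
    -- the unions are nested, and their limit is the limit set
    (∀ n, TripleLattice.chain (n + 1) ⊆ TripleLattice.chain n) ∧
    (⋂ n, TripleLattice.chain n) = TripleLattice.limitSet TripleLattice.phi ∧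
    Tendsto (fun n => Metric.hausdorffEDist (TripleLattice.chain n)
      (TripleLattice.limitSet TripleLattice.phi)) atTop (𝓝 0) := by
  refine ⟨TripleLattice.renormMap_phi, TripleLattice.domainX_subset_closure, fun n => ?_,
    TripleLattice.chain_succ_subset, TripleLattice.iInter_chain,
    TripleLattice.tendsto_hausdorffEDist_chain⟩
  rw [TripleLattice.marked_eq]
  refine ⟨(TripleLattice.finite_level n).image _, ?_, ?_⟩
  · rintro _ ⟨t, ht, rfl⟩
    have hk := TripleLattice.k_of_mem_level ht
    exact ⟨t.k, hk.1, hk.2, (TripleLattice.equilateral_of_mem_level ht).isGolden⟩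
  · rintro _ ⟨t, ht, rfl⟩ _ ⟨t', ht', rfl⟩ hne
    exact TripleLattice.pairwise_level n ht ht' fun h => hne (congrArg _ h)
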